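/- Fix integers $K, d_{\mathrm{in}}, d_{\mathrm{out}}$, an input $x\in\mathbb R^{d_{\mathrm{in}}}$, real numbers $\eta_u,\eta_v,\sigma_u,\sigma_v$, and a probability space $(\Omega,\mathcal F,\mathbb P)$ carrying two subgaussian (not necessarily centered or independent) random vectors $W_{\mathrm{in}}\in\mathbb R^{d_{\mathrm{in}}}$, $W_{\mathrm{out}}\in\mathbb R^{d_{\mathrm{out}}}$; let $\mathcal F_W=\sigma(W_{\mathrm{in}},W_{\mathrm{out}})$. Let $\rho:\mathbb R\to\mathbb R$ be twice differentiable with $|\rho(0)|\le C_\rho$, $\|\rho'\|_\infty\vee\|\rho''\|_\infty\le C_\rho$, and let $\ell:\mathbb R^{d_{\mathrm{out}}}\to\mathbb R$ be differentiable with Lipschitz gradient. For an $\mathcal F_W$-measurable $(\mathbf H,\mathbf B)=(H_k,B_k)_{0\le k\le K-1}\in L^2(\Omega,\mathcal C([0,1],\mathbb R^{2K}))$, define the mean-field skeleton maps $F_k,G_k$ as random functions of $(s,\mathbf z^h,\mathbf z^b)\in[0,1]\times\mathbb R^K\times\mathbb R^K$ by $F_0=G_0=0$ and $$F_{k+1}=F_k-\eta_u\,\rho'\big(z^h_k+\mathbb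 E[H_kF_k]\big)\big(z^b_k+\mathbb E[B_kG_k]\big)H_k,\qquad G_{k+1}=G_k-\eta_v\,\rho\big(z^h_k+\mathbb E[H_kF_k]\big)B_k .$$ Let $(\mathbf Z^h,\mathbf Z^b)$ be a centered Gaussian field on $[0,1]$ with values in $\mathbb R^{2K}$ and continuous trajectories, independent of $\mathcal F_W$ (realized on an enlarged probability space $\Omega\times\mathcal C([0,1],\mathbb R^{2K})$ with a product measure), with the same covariance as $(U\mathbf H,V\mathbf B)$, where $U,V$ are centered, with variances $\sigma_u^2,\sigma_v^2$, independent of each other and of $\mathcal F_W$; that is, with $\mathbb E[Z^h_i(s)Z^h_j(t)]=\sigma_u^2\mathbb E[H_i(s)H_j(t)]$, $\mathbb E[Z^b_i(s)Z^b_j(t)]=\sigma_v^2\mathbb E[B_i(s)B_j(t)]$ and $\mathbb E[Z^h_i(s)Z^b_j(t)]=0$. All skeleton maps below are evaluated at $(s,\mathbf Z^h(s),\mathbf Z^b(s))$; put $\mathbf Z=(\mathbf Z^h,\mathbf Z^b)$, $$P_k(s)=Z^h_k(s)+\mathbb E[H_k(s)F_k\,|\,\mathbf Z],\qquad Q_k(s)=Z^b_k(s)+\mathbb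 E[B_k(s)G_k\,|\,\mathbf Z],\qquad y_k=\mathbb E[H_k(1)W_{\mathrm{out}}].$$ The pair $(\mathbf H,\mathbf B)$ is called a solution of the limit system if such a field exists and, for all $k\in\{0,\dots,K-1\}$, almost surely, in the integrated sense (with a jointly measurable, integrable version of the right-hand sides, the integrated equation holding for all $s\in[0,1]$), $$\partial_sH_k(s)=\sigma_v^2\sum_{i<k}\mathbb E\big[\rho'(P_k(s))\,\mathbb E[H_k(s)\partial_{z^b_i}F_k|\mathbf Z]\big]B_i(s)+\mathbb E\big[\rho(P_k(s))\,G_k\,\big|\,\mathcal F_W\big],\qquad H_k(0)=W_{\mathrm{in}}\cdot x,$$ $$\begin{aligned}\partial_sB_k(s)=&-\mathbb E\big[\rho'(P_k(s))\,F_k\,Q_k(s)\,\big|\,\mathcal F_W\big]-\sigma_u^2\sum_{i<k}\mathbb E\big[\rho'(P_k(s))\,\mathbb E[B_k(s)\partial_{z^h_i}G_k|\mathbf Z]\big]H_i(s)\\&-\sigma_u^2\,\mathbb E\Big[\rho''(P_k(s))Q_k(s)\Big(H_k(s)+\sum_{i<k}\mathbb E[H_k(s)\partial_{z^h_i}F_k|\mathbf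 Z]\,H_i(s)\Big)\Big|\,\mathcal F_W\Big],\qquad B_k(1)=W_{\mathrm{out}}\cdot\nabla\ell(y_k).\end{aligned}$$ Then the limit system has exactly one solution $(\mathbf H,\mathbf B)$ in $L^2(\Omega,\mathcal C([0,1],\mathbb R^{2K}))$. -/

import Mathlib

open MeasureTheory ProbabilityTheory
open scoped NNReal

namespace LimitDynamics

/-- Subgaussian random vectors: integrable, and `𝔼[exp ⟨u, W - 𝔼 W⟩] ≤ exp (c ‖u‖² / 2)` for all
vectors `u` and some variance proxy `c`. The vector need not be centered. -/
def IsSubgaussianVector {Ω : Type*} [MeasurableSpace Ω] {d : ℕ}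
    (W : Ω → EuclideanSpace ℝ (Fin d)) (P : Measure Ω) : Prop :=
  Integrable W P ∧ ∃ c : ℝ≥0, ∀ u : EuclideanSpace ℝ (Fin d),
    HasSubgaussianMGF (fun ω => inner ℝ u (W ω - ∫ ω', W ω' ∂P)) (c * ‖u‖₊ ^ 2) P

/-- `ℝ^{2K}`, a pair of vectors of `ℝ^K`: `Sum.inl k` is the index of the `k`-th forward
coordinate (`H_k`, `z^h_k`), `Sum.inr k` that of the `k`-th backward one (`B_k`, `z^b_k`). -/
abbrev State (K : ℕ) : Type := EuclideanSpace ℝ (Fin K ⊕ Fin K)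

/-- The path space `C([0,1], ℝ^{2K})`, with the supremum norm. -/
abbrev PathSpace (K : ℕ) : Type := C(unitInterval, State K)

/-- The path space carries its Borel sigma-field. -/
instance instMeasurableSpacePathSpace (K : ℕ) : MeasurableSpace (PathSpace K) := borel _

instance instBorelSpacePathSpace (K : ℕ) : BorelSpace (PathSpace K) := ⟨rfl⟩

section

variable {Ω : Type*} [MeasurableSpace Ω] {K din dout : ℕ}

/-- The sigma-field `F_W = σ(W_in, W_out)` on `Ω`. -/
@[reducible] def initSigma (Win : Ω → EuclideanSpace ℝ (Fin din)) (Wout : Ω → EuclideanSpace ℝ (Fin dout)) :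
    MeasurableSpace Ω :=
  MeasurableSpace.comap Win inferInstance ⊔ MeasurableSpace.comap Wout inferInstance

/-- The mean-field skeleton maps `(F_k, G_k)`, for `0 ≤ k ≤ K`, of a random path `X = (H, B)`, as
functions of `(s, z, ω)`, `z = (z^h, z^b)`: `F_0 = G_0 = 0` and
`F_{k+1} = F_k - η_u ρ'(z^h_k + 𝔼[H_k F_k]) (z^b_k + 𝔼[B_k G_k]) H_k`,
`G_{k+1} = G_k - η_v ρ(z^h_k + 𝔼[H_k F_k]) B_k`. -/
noncomputable def skeleton (P : Measure Ω) (ρ : ℝ → ℝ) (ηu ηv : ℝ) (X : Ω → PathSpace K)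
    (k : Fin (K + 1)) : unitInterval → State K → Ω → ℝ × ℝ :=
  Fin.induction (motive := fun _ => unitInterval → State K → Ω → ℝ × ℝ)
    (fun _ _ _ => (0, 0))
    (fun j FG s z ω =>
      let p : ℝ := z (Sum.inl j) + ∫ ω', X ω' s (Sum.inl j) * (FG s z ω').1 ∂P
      let q : ℝ := z (Sum.inr j) + ∫ ω', X ω' s (Sum.inr j) * (FG s z ω').2 ∂P
      ((FG s z ω).1 - ηu * deriv ρ p * q * X ω s (Sum.inl j),
        (FG s z ω).2 - ηv * ρ p * X ω s (Sum.inr j)))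
    k

/-- `F_k`, for `0 ≤ k ≤ K - 1`. -/
noncomputable def skelF (P : Measure Ω) (ρ : ℝ → ℝ) (ηu ηv : ℝ) (X : Ω → PathSpace K)
    (k : Fin K) (s : unitInterval) (z : State K) (ω : Ω) : ℝ :=
  (skeleton P ρ ηu ηv X k.castSucc s z ω).1

/-- `G_k`, for `0 ≤ k ≤ K - 1`. -/
noncomputable def skelG (P : Measure Ω) (ρ : ℝ → ℝ) (ηu ηv : ℝ) (X : Ω → PathSpace K)
    (k : Fin K) (s : unitInterval) (z : State K) (ω : Ω) : ℝ :=
  (skeleton P ρ ηu ηv X k.castSucc s z ω).2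

/-- The partial derivative of `f : ℝ^{2K} → ℝ` in the coordinate `i`, at `z`. -/
noncomputable def partialDeriv (i : Fin K ⊕ Fin K) (f : State K → ℝ) (z : State K) : ℝ :=
  fderiv ℝ f z (EuclideanSpace.single i 1)

/-- The covariance kernel of `(U H, V B)`, for `U, V` centered with variances `σ_u², σ_v²`,
independent of each other and of `X = (H, B)`; see `fieldCov_eq` below. -/
noncomputable def fieldCov (P : Measure Ω) (σu σv : ℝ) (X : Ω → PathSpace K)
    (s t : unitInterval) : Fin K ⊕ Fin K → Fin K ⊕ Fin K → ℝ
  | Sum.inl i, Sum.inl j => σu ^ 2 * ∫ ω, X ω s (Sum.inl i) * X ω t (Sum.inl j) ∂P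
  | Sum.inr i, Sum.inr j => σv ^ 2 * ∫ ω, X ω s (Sum.inr i) * X ω t (Sum.inr j) ∂P
  | Sum.inl _, Sum.inr _ => 0
  | Sum.inr _, Sum.inl _ => 0

/-- The random path `(U H, V B)`, at time `s`. -/
def scaled (U V : Ω → ℝ) (X : Ω → PathSpace K) (s : unitInterval) (ω : Ω) :
    Fin K ⊕ Fin K → ℝ
  | Sum.inl i => U ω * X ω s (Sum.inl i)
  | Sum.inr i => V ω * X ω s (Sum.inr i)

/-- `fieldCov` is the covariance kernel of `(U H, V B)`. -/
theorem fieldCov_eq (P : Measure Ω) [IsProbabilityMeasure P] (σu σv : ℝ)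
    (U V : Ω → ℝ) (X : Ω → PathSpace K) (hU : Measurable U) (hV : Measurable V)
    (hX : Measurable X) (hU0 : ∫ ω, U ω ∂P = 0)
    (hU2 : ∫ ω, U ω ^ 2 ∂P = σu ^ 2) (hV2 : ∫ ω, V ω ^ 2 ∂P = σv ^ 2)
    (hUV : IndepFun U V P) (hUVX : IndepFun (fun ω => (U ω, V ω)) X P)
    (s t : unitInterval) (i j : Fin K ⊕ Fin K) :
    ∫ ω, scaled U V X s ω i * scaled U V X t ω j ∂P = fieldCov P σu σv X s t i j := by
  have hev : ∀ (r : unitInterval) (l : Fin K ⊕ Fin K), Measurable fun x : PathSpace K => x r l := by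
    intro r l
    have hc : Continuous fun x : PathSpace K => x r l :=
      (EuclideanSpace.proj l : State K →L[ℝ] ℝ).continuous.comp (continuous_eval_const r)
    exact hc.measurable
  have hg : Measurable fun x : PathSpace K => x s i * x t j := (hev s i).mul (hev t j)
  have key : ∀ φ : ℝ × ℝ → ℝ, Measurable φ →
      ∫ ω, φ (U ω, V ω) * (X ω s i * X ω t j) ∂P
        = (∫ ω, φ (U ω, V ω) ∂P) * ∫ ω, X ω s i * X ω t j ∂P := by
    intro φ hφ
    exact (hUVX.comp hφ hg).integral_fun_mul_eq_mul_integral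
      (hφ.comp (hU.prodMk hV)).aestronglyMeasurable (hg.comp hX).aestronglyMeasurable
  have hUV0 : ∫ ω, U ω * V ω ∂P = 0 := by
    rw [hUV.integral_fun_mul_eq_mul_integral hU.aestronglyMeasurable hV.aestronglyMeasurable,
      hU0, zero_mul]
  rcases i with i | i <;> rcases j with j | j
  · have h := key (fun p => p.1 ^ 2) (measurable_fst.pow_const 2)
    simp only [hU2] at h
    simp only [scaled, fieldCov, ← h]
    congr 1; ext ω; ring
  · have h := key (fun p => p.1 * p.2) (measurable_fst.mul measurable_snd)
    simp only [hUV0, zero_mul] at h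
    simp only [scaled, fieldCov, ← h]
    congr 1; ext ω; ring
  · have h := key (fun p => p.1 * p.2) (measurable_fst.mul measurable_snd)
    simp only [hUV0, zero_mul] at h
    simp only [scaled, fieldCov, ← h]
    congr 1; ext ω; ring
  · have h := key (fun p => p.2 ^ 2) (measurable_snd.pow_const 2)
    simp only [hV2] at h
    simp only [scaled, fieldCov, ← h]
    congr 1; ext ω; ring

/-- `γ` is the law, on the path space, of a centered Gaussian field `(Z^h, Z^b)` with continuous
trajectories that has the same covariance as `(U H, V B)`, where `X = (H, B)`. -/
structure IsDrivingField (P : Measure Ω) (σu σv : ℝ) (X : Ω → PathSpace K)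
    (γ : Measure (PathSpace K)) : Prop where
  gaussian : IsGaussian γ
  centered : ∀ (s : unitInterval) (i : Fin K ⊕ Fin K), ∫ z, z s i ∂γ = 0
  covariance : ∀ (s t : unitInterval) (i j : Fin K ⊕ Fin K),
    ∫ z, z s i * z t j ∂γ = fieldCov P σu σv X s t i j

/-! The Gaussian field is realized, independently of `F_W`, on the enlarged probability space
`Ω × C([0,1], ℝ^{2K})` with the measure `P ⊗ γ`: a point of it is `(ω, z)`, and `(Z^h, Z^b)` is the
second projection. -/

/-- The sigma-field `σ(Z^h, Z^b)` on the enlarged space. -/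
@[reducible] def sigmaZ (Ω : Type*) (K : ℕ) : MeasurableSpace (Ω × PathSpace K) :=
  MeasurableSpace.comap Prod.snd inferInstance

/-- The sigma-field `F_W` on the enlarged space. -/
@[reducible] def sigmaW (Win : Ω → EuclideanSpace ℝ (Fin din)) (Wout : Ω → EuclideanSpace ℝ (Fin dout))
    (K : ℕ) : MeasurableSpace (Ω × PathSpace K) :=
  MeasurableSpace.comap Prod.fst (initSigma Win Wout)

/-- `P_k(s) = Z^h_k(s) + 𝔼[H_k(s) F_k(s, Z(s)) | Z]`. -/
noncomputable def preP (P : Measure Ω) (ρ : ℝ → ℝ) (ηu ηv : ℝ) (X : Ω → PathSpace K)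
    (γ : Measure (PathSpace K)) (k : Fin K) (s : unitInterval) : Ω × PathSpace K → ℝ :=
  fun a => a.2 s (Sum.inl k) +
    ((P.prod γ)[fun b => X b.1 s (Sum.inl k) * skelF P ρ ηu ηv X k s (b.2 s) b.1
      | sigmaZ Ω K]) a

/-- `Q_k(s) = Z^b_k(s) + 𝔼[B_k(s) G_k(s, Z(s)) | Z]`. -/
noncomputable def preQ (P : Measure Ω) (ρ : ℝ → ℝ) (ηu ηv : ℝ) (X : Ω → PathSpace K)
    (γ : Measure (PathSpace K)) (k : Fin K) (s : unitInterval) : Ω × PathSpace K → ℝ :=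
  fun a => a.2 s (Sum.inr k) +
    ((P.prod γ)[fun b => X b.1 s (Sum.inr k) * skelG P ρ ηu ηv X k s (b.2 s) b.1
      | sigmaZ Ω K]) a

/-- `𝔼[H_k(s) ∂_i F_k(s, Z(s)) | Z]`, with `∂_i` the partial derivative in the `i`-th
coordinate of `z = (z^h, z^b)`. -/
noncomputable def respF (P : Measure Ω) (ρ : ℝ → ℝ) (ηu ηv : ℝ) (X : Ω → PathSpace K)
    (γ : Measure (PathSpace K)) (k : Fin K) (i : Fin K ⊕ Fin K) (s : unitInterval) :
    Ω × PathSpace K → ℝ :=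
  (P.prod γ)[fun b => X b.1 s (Sum.inl k) *
      partialDeriv i (fun z => skelF P ρ ηu ηv X k s z b.1) (b.2 s) | sigmaZ Ω K]

/-- `𝔼[B_k(s) ∂_i G_k(s, Z(s)) | Z]`. -/
noncomputable def respG (P : Measure Ω) (ρ : ℝ → ℝ) (ηu ηv : ℝ) (X : Ω → PathSpace K)
    (γ : Measure (PathSpace K)) (k : Fin K) (i : Fin K ⊕ Fin K) (s : unitInterval) :
    Ω × PathSpace K → ℝ :=
  (P.prod γ)[fun b => X b.1 s (Sum.inr k) *
      partialDeriv i (fun z => skelG P ρ ηu ηv X k s z b.1) (b.2 s) | sigmaZ Ω K]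

/-- The right-hand side of the equation for `∂_s H_k(s)`:
`σ_v² 𝔼[ρ'(P_k) 𝔼[H_k ∇_{z^b} F_k | Z]] · B_{∧ k-1} + 𝔼[ρ(P_k) G_k | F_W]`. -/
noncomputable def driftH (P : Measure Ω) (Win : Ω → EuclideanSpace ℝ (Fin din))
    (Wout : Ω → EuclideanSpace ℝ (Fin dout)) (ρ : ℝ → ℝ) (ηu ηv σv : ℝ)
    (X : Ω → PathSpace K) (γ : Measure (PathSpace K)) (k : Fin K) (s : unitInterval) :
    Ω × PathSpace K → ℝ :=
  fun a =>
    σv ^ 2 * ∑ i ∈ Finset.Iio k,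
      (∫ b, deriv ρ (preP P ρ ηu ηv X γ k s b) * respF P ρ ηu ηv X γ k (Sum.inr i) s b
        ∂(P.prod γ)) * X a.1 s (Sum.inr i)
    + ((P.prod γ)[fun b => ρ (preP P ρ ηu ηv X γ k s b) * skelG P ρ ηu ηv X k s (b.2 s) b.1
        | sigmaW Win Wout K]) a

/-- The right-hand side of the equation for `∂_s B_k(s)`:
`- 𝔼[ρ'(P_k) F_k Q_k | F_W] - σ_u² 𝔼[ρ'(P_k) 𝔼[B_k ∇_{z^h} G_k | Z]] · H_{∧ k-1}
 - σ_u² 𝔼[ρ''(P_k) Q_k (H_k + 𝔼[H_k ∇_{z^h} F_k | Z] · H_{∧ k-1}) | F_W]`. -/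
noncomputable def driftB (P : Measure Ω) (Win : Ω → EuclideanSpace ℝ (Fin din))
    (Wout : Ω → EuclideanSpace ℝ (Fin dout)) (ρ : ℝ → ℝ) (ηu ηv σu : ℝ)
    (X : Ω → PathSpace K) (γ : Measure (PathSpace K)) (k : Fin K) (s : unitInterval) :
    Ω × PathSpace K → ℝ :=
  fun a =>
    - ((P.prod γ)[fun b => deriv ρ (preP P ρ ηu ηv X γ k s b) *
          skelF P ρ ηu ηv X k s (b.2 s) b.1 * preQ P ρ ηu ηv X γ k s b
        | sigmaW Win Wout K]) a
    - σu ^ 2 * ∑ i ∈ Finset.Iio k,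
        (∫ b, deriv ρ (preP P ρ ηu ηv X γ k s b) * respG P ρ ηu ηv X γ k (Sum.inl i) s b
          ∂(P.prod γ)) * X a.1 s (Sum.inl i)
    - σu ^ 2 * ((P.prod γ)[fun b =>
          deriv (deriv ρ) (preP P ρ ηu ηv X γ k s b) * preQ P ρ ηu ηv X γ k s b *
            (X b.1 s (Sum.inl k) +
              ∑ i ∈ Finset.Iio k, respF P ρ ηu ηv X γ k (Sum.inl i) s b * X b.1 s (Sum.inl i))
        | sigmaW Win Wout K]) a

/-- `d` is a jointly measurable version of the family of random variables `D s`, `s ∈ [0,1]`, each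
of which, like a conditional expectation, is only defined up to almost sure equality on the
enlarged space. The version lives on `Ω` and its paths are almost surely integrable. -/
structure IsDriftVersion (P : Measure Ω) (γ : Measure (PathSpace K))
    (D : unitInterval → Ω × PathSpace K → ℝ) (d : unitInterval → Ω → ℝ) : Prop where
  measurable : Measurable (Function.uncurry d)
  integrable : ∀ᵐ ω ∂P, Integrable (fun s => d s ω)
  eq : ∀ s : unitInterval, (fun a : Ω × PathSpace K => d s a.1) =ᵐ[P.prod γ] D s

/-- The random path `X = (H, B)` is `F_W`-measurable and solves the limit system: for some Gaussian
field `γ` with the covariance of `(U H, V B)`, for all `k`, almost surely, for all `s`,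
`H_k(s) = W_in · x + ∫_0^s (∂_s H_k)(r) dr`, and
`B_k(s) = W_out · ∇ℓ(y_k) - ∫_s^1 (∂_s B_k)(r) dr` with `y_k = 𝔼[H_k(1) W_out]`. -/
structure IsLimitSolution (P : Measure Ω) (Win : Ω → EuclideanSpace ℝ (Fin din))
    (Wout : Ω → EuclideanSpace ℝ (Fin dout)) (x : EuclideanSpace ℝ (Fin din))
    (ρ : ℝ → ℝ) (ℓ : EuclideanSpace ℝ (Fin dout) → ℝ) (ηu ηv σu σv : ℝ)
    (X : Ω → PathSpace K) : Prop where
  measurable : AEStronglyMeasurable[initSigma Win Wout] X P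
  solves : ∃ γ : Measure (PathSpace K), IsDrivingField P σu σv X γ ∧ ∀ k : Fin K,
    (∃ d : unitInterval → Ω → ℝ,
      IsDriftVersion P γ (driftH P Win Wout ρ ηu ηv σv X γ k) d ∧
      ∀ᵐ ω ∂P, ∀ s : unitInterval,
        X ω s (Sum.inl k) = inner ℝ (Win ω) x + ∫ r in Set.Iic s, d r ω) ∧
    (∃ d : unitInterval → Ω → ℝ,
      IsDriftVersion P γ (driftB P Win Wout ρ ηu ηv σu X γ k) d ∧
      ∀ᵐ ω ∂P, ∀ s : unitInterval,
        X ω s (Sum.inr k)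
          = inner ℝ (Wout ω) (gradient ℓ (∫ ω', X ω' 1 (Sum.inl k) • Wout ω' ∂P))
            - ∫ r in Set.Ici s, d r ω)

end

end LimitDynamics

/-!
The limit system looks like a McKean-Vlasov system with values in path space, coupled forward and
backward in time, but it collapses to a finite dimensional integral equation.

By induction on `k`, `F_k = ∑_{i < k} α_i H_i` and `G_k = ∑_{i < k} β_i B_i`, where the
coefficients `α_i`, `β_i` depend only on `z` and on the second moments `𝔼[H_i H_j]`, `𝔼[B_i B_j]`
at time `s` (`skeleton_eq`). Conditioning on `Z` or on `F_W` then amounts to integrating out one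
factor of `P ⊗ γ`, so `∂_s H_k` is a combination of the `B_i`, `i < k`, and `∂_s B_k` one of the
`H_i`, `i ≤ k`, with deterministic coefficients (`driftH_ae`, `driftB_ae`).

Hence every solution stays in the span of the boundary data `e = (W_in · x, W_out)`: its
coordinates are `⟨v l s, e⟩` for deterministic paths `v l` in a Euclidean space `V`. The law of
`Z(s)` is Gaussian with covariance given by the second moments of `e`, so it is the law of a
linear function of two independent copies of one fixed Gaussian vector `n` of `V`, which has the
second moments of `e` (`isDrivingField_noisePath`, `integral_par_eq_avg`). The coefficients
thereby become explicit functions of `v` (`avg`), and solutions of the limit system correspond to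
solutions of the system `ClosedSystem` for `v` (`isLimitSolution_of_closedSystem`,
`exists_closedSystem_of_isLimitSolution`).

The closed system is triangular. The equation for `v (inl k)` runs forward from `W_in · x` and
involves only lower levels and `v (inl k)` itself; the one for `v (inr k)` runs backward from a
value computed from the end value of `v (inl k)`, and involves lower levels, `v (inl k)` and
`v (inr k)`. So `v (inr k)` never feeds back into the equation for `v (inl k)`. At each level the
vector field is locally Lipschitz with linear growth: in the forward equation `P_k` and the
response `𝔼[H_k ∂F_k | Z]` are linear in `v (inl k)`, and the response only enters multiplied by
the bounded function `ρ'`; the backward equation is linear in `v (inr k)`. Picard iteration gives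
existence and uniqueness level by level (`ClosedSystem.exists`, `ClosedSystem.unique`). Polynomial
growth of all coefficients in `z`, together with Fernique's theorem, supplies the integrability.
-/

set_option linter.unusedSectionVars false

namespace LimitDynamics

/-! ### Functions of polynomial growth -/

/-- Measurable real functions of at most polynomial growth on a normed space. -/
structure Tame {E : Type*} [NormedAddCommGroup E] [MeasurableSpace E] (f : E → ℝ) : Prop where
  measurable : Measurable f
  growth : ∃ C : ℝ, ∃ m : ℕ, 0 ≤ C ∧ ∀ x, |f x| ≤ C * (1 + ‖x‖) ^ m

namespace Tame

variable {E E' : Type*} [NormedAddCommGroup E] [MeasurableSpace E]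
  [NormedAddCommGroup E'] [MeasurableSpace E'] {f g : E → ℝ}

theorem one_le_one_add_norm {E : Type*} [NormedAddCommGroup E] (x : E) : 1 ≤ 1 + ‖x‖ := by
  linarith [norm_nonneg x]

theorem of_bounded (hf : Measurable f) {C : ℝ} (hC : ∀ x, |f x| ≤ C) : Tame f :=
  ⟨hf, C, 0, (abs_nonneg _).trans (hC 0), fun x => by simpa using hC x⟩

theorem const (c : ℝ) : Tame fun _ : E => c := of_bounded measurable_const fun _ => le_rfl

theorem of_norm_le (hf : Measurable f) {C : ℝ} (hC : ∀ x, |f x| ≤ C * ‖x‖) : Tame f := by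
  refine ⟨hf, |C|, 1, abs_nonneg _, fun x => (hC x).trans ?_⟩
  have := le_abs_self C
  have := norm_nonneg x
  have := abs_nonneg C
  nlinarith

theorem mul (hf : Tame f) (hg : Tame g) : Tame fun x => f x * g x := by
  obtain ⟨C, m, hC, h⟩ := hf.growth
  obtain ⟨C', m', hC', h'⟩ := hg.growth
  refine ⟨hf.measurable.mul hg.measurable, C * C', m + m', by positivity, fun x => ?_⟩
  rw [abs_mul, pow_add, mul_mul_mul_comm]
  gcongr
  exacts [h x, h' x]

theorem add (hf : Tame f) (hg : Tame g) : Tame fun x => f x + g x := by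
  obtain ⟨C, m, hC, h⟩ := hf.growth
  obtain ⟨C', m', hC', h'⟩ := hg.growth
  refine ⟨hf.measurable.add hg.measurable, C + C', m + m', by positivity, fun x => ?_⟩
  have h1 := one_le_one_add_norm x
  rw [add_mul]
  refine (abs_add_le _ _).trans (add_le_add ((h x).trans ?_) ((h' x).trans ?_)) <;> gcongr <;>
    first | exact h1 | omega

theorem neg (hf : Tame f) : Tame fun x => -f x := by
  simpa using (const (-1)).mul hf

theorem sub (hf : Tame f) (hg : Tame g) : Tame fun x => f x - g x := by
  simpa [sub_eq_add_neg] using hf.add hg.neg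

theorem sum {ι : Type*} (s : Finset ι) {f : ι → E → ℝ} (hf : ∀ i ∈ s, Tame (f i)) :
    Tame fun x => ∑ i ∈ s, f i x := by
  classical
  induction s using Finset.induction_on with
  | empty => simpa using const (E := E) 0
  | insert i s hi ih =>
    simp only [Finset.sum_insert hi]
    exact (hf i (by simp)).add (ih fun j hj => hf j (by simp [hj]))

theorem comp {g : E' → E} (hf : Tame f) (hg : Measurable g) (hg' : Tame fun x => ‖g x‖) :
    Tame fun x => f (g x) := by
  obtain ⟨C, m, hC, h⟩ := hf.growth
  obtain ⟨C', m', hC', h'⟩ := hg'.growth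
  refine ⟨hf.measurable.comp hg, C * (1 + C') ^ m, m' * m, by positivity, fun x => (h _).trans ?_⟩
  have h1 := one_le_one_add_norm x
  rw [mul_assoc, pow_mul, ← mul_pow]
  gcongr
  have := h' x
  rw [abs_norm] at this
  have h2 : 1 ≤ (1 + ‖x‖) ^ m' := one_le_pow₀ h1
  linarith

theorem comp_real {φ : ℝ → ℝ} (hφ : Tame φ) (hf : Tame f) : Tame fun x => φ (f x) := by
  refine hφ.comp hf.measurable ?_
  obtain ⟨C, m, hC, h⟩ := hf.growth
  exact ⟨hf.measurable.norm, C, m, hC, fun x => by simpa using h x⟩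

/-- All polynomial moments of a Gaussian measure are finite, by Fernique's theorem. -/
theorem integrable_one_add_norm_pow [NormedSpace ℝ E] [CompleteSpace E] [BorelSpace E]
    [SecondCountableTopology E] (μ : Measure E) [IsGaussian μ] (m : ℕ) :
    Integrable (fun x => (1 + ‖x‖) ^ m) μ := by
  have h0 : MemLp (fun x : E => ‖x‖) m μ :=
    (IsGaussian.memLp_id μ m (ENNReal.natCast_ne_top m)).norm
  have h1 : MemLp (fun x : E => 1 + ‖x‖) m μ := MemLp.add (memLp_const (1 : ℝ)) h0
  refine h1.integrable_norm_pow'.congr (ae_of_all _ fun x => ?_)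
  simp only [Real.norm_eq_abs]
  rw [abs_of_pos (by positivity)]

theorem integrable [NormedSpace ℝ E] [CompleteSpace E] [BorelSpace E]
    [SecondCountableTopology E] (hf : Tame f) (μ : Measure E) [IsGaussian μ] :
    Integrable f μ := by
  obtain ⟨C, m, hC, h⟩ := hf.growth
  exact ((integrable_one_add_norm_pow μ m).const_mul C).mono' hf.measurable.aestronglyMeasurable
    (ae_of_all _ h)

/-- Polynomial growth in the first variable survives integration of the second one against a
Gaussian measure. -/
theorem integral_right [NormedSpace ℝ E'] [CompleteSpace E'] [BorelSpace E']
    [SecondCountableTopology E'] {f : E × E' → ℝ} (hf : Tame f) (μ : Measure E') [IsGaussian μ] :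
    Tame fun x => ∫ y, f (x, y) ∂μ := by
  obtain ⟨C, m, hC, h⟩ := hf.growth
  have hb : ∀ x y, |f (x, y)| ≤ C * (1 + ‖x‖) ^ m * (1 + ‖y‖) ^ m := by
    intro x y
    refine (h _).trans ?_
    rw [mul_assoc, ← mul_pow]
    gcongr
    have h1 := norm_nonneg x
    have h2 := norm_nonneg y
    have h3 : ‖(x, y)‖ ≤ ‖x‖ + ‖y‖ := by
      rw [Prod.norm_def]; exact max_le (by simp) (by simp)
    nlinarith [mul_nonneg h1 h2]
  have hint := integrable_one_add_norm_pow μ m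
  refine ⟨?_, C * ∫ y, (1 + ‖y‖) ^ m ∂μ, m, mul_nonneg hC (integral_nonneg fun y => by positivity),
    fun x => ?_⟩
  · exact (hf.measurable.stronglyMeasurable.integral_prod_right' (ν := μ)).measurable
  · refine (norm_integral_le_of_norm_le (f := fun y => f (x, y))
      (hint.const_mul (C * (1 + ‖x‖) ^ m)) (ae_of_all μ (hb x))).trans ?_
    rw [integral_const_mul]
    exact le_of_eq (by ring)

/-- A family with polynomial growth is bounded, uniformly for parameters in a bounded set, by a
multiple of a fixed polynomial weight in the other variable. -/
theorem exists_bound {f : E × E' → ℝ} (hf : Tame f) (R : ℝ) :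
    ∃ C : ℝ, ∃ m : ℕ, 0 ≤ C ∧ ∀ x y, ‖x‖ ≤ R → |f (x, y)| ≤ C * (1 + ‖y‖) ^ m := by
  obtain ⟨C, m, hC, h⟩ := hf.growth
  refine ⟨C * (1 + |R|) ^ m, m, by positivity, fun x y hx => (h _).trans ?_⟩
  rw [mul_assoc, ← mul_pow]
  gcongr
  have h1 := norm_nonneg x
  have h2 := norm_nonneg y
  have h3 : ‖(x, y)‖ ≤ ‖x‖ + ‖y‖ := by
    rw [Prod.norm_def]; exact max_le (by simp) (by simp)
  have := le_abs_self R
  nlinarith [mul_nonneg (abs_nonneg R) h2]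

end Tame

/-! ### Coefficients of the skeleton maps -/

/-- The data on which the skeleton coefficients depend: the second moments `𝔼[H_i H_j]` and
`𝔼[B_i B_j]`, and the point `z`. -/
abbrev Par (K : ℕ) : Type := (Fin K → Fin K → ℝ) × (Fin K → Fin K → ℝ) × State K

section

variable {K : ℕ} (ρ : ℝ → ℝ) (ηu ηv : ℝ)

/-- The coefficients `(α_k, β_k)` of the skeleton maps: `F_k = ∑_{i < k} α_i H_i` and
`G_k = ∑_{i < k} β_i B_i`. They are defined by recursion on `k`; the sums run over all indices,
with a dependent `if` that provides the proof of `i < k` needed for termination. -/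
noncomputable def coef (q : Par K) (k : Fin K) : ℝ × ℝ :=
  (-(ηu * deriv ρ (q.2.2 (Sum.inl k) + ∑ i, if _h : i < k then q.1 k i * (coef q i).1 else 0) *
      (q.2.2 (Sum.inr k) + ∑ i, if _h : i < k then q.2.1 k i * (coef q i).2 else 0)),
    -(ηv * ρ (q.2.2 (Sum.inl k) + ∑ i, if _h : i < k then q.1 k i * (coef q i).1 else 0)))
termination_by k

/-- The coefficient of `H_i` in `F_k`, `i < k`. -/
noncomputable def cF (i : Fin K) (q : Par K) : ℝ := (coef ρ ηu ηv q i).1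

/-- The coefficient of `B_i` in `G_k`, `i < k`. -/
noncomputable def cG (i : Fin K) (q : Par K) : ℝ := (coef ρ ηu ηv q i).2

/-- `z^h_k + 𝔼[H_k F_k]`. -/
noncomputable def cP (k : Fin K) (q : Par K) : ℝ :=
  q.2.2 (Sum.inl k) + ∑ i ∈ Finset.Iio k, q.1 k i * cF ρ ηu ηv i q

/-- `z^b_k + 𝔼[B_k G_k]`. -/
noncomputable def cQ (k : Fin K) (q : Par K) : ℝ :=
  q.2.2 (Sum.inr k) + ∑ i ∈ Finset.Iio k, q.2.1 k i * cG ρ ηu ηv i q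

theorem sum_dite_lt (k : Fin K) (f : Fin K → ℝ) :
    (∑ i, if _h : i < k then f i else 0) = ∑ i ∈ Finset.Iio k, f i := by
  simp only [dite_eq_ite]
  rw [← Finset.sum_filter]
  congr 1
  ext i; simp

theorem cF_eq (k : Fin K) (q : Par K) :
    cF ρ ηu ηv k q = -(ηu * deriv ρ (cP ρ ηu ηv k q) * cQ ρ ηu ηv k q) := by
  simp only [cF, cG, cP, cQ]
  rw [coef]
  simp only [sum_dite_lt]

theorem cG_eq (k : Fin K) (q : Par K) : cG ρ ηu ηv k q = -(ηv * ρ (cP ρ ηu ηv k q)) := by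
  simp only [cF, cG, cP]
  rw [coef]
  simp only [sum_dite_lt]

/-- The partial derivative of `cF` in the `l`-th coordinate of `z`. -/
noncomputable def dF (l : Fin K ⊕ Fin K) (i : Fin K) (q : Par K) : ℝ :=
  partialDeriv l (fun z => cF ρ ηu ηv i (q.1, q.2.1, z)) q.2.2

/-- The partial derivative of `cG` in the `l`-th coordinate of `z`. -/
noncomputable def dG (l : Fin K ⊕ Fin K) (i : Fin K) (q : Par K) : ℝ :=
  partialDeriv l (fun z => cG ρ ηu ηv i (q.1, q.2.1, z)) q.2.2

variable {ρ ηu ηv}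

theorem differentiable_cF_cG (hρ : Differentiable ℝ ρ) (hρ' : Differentiable ℝ (deriv ρ))
    (A B : Fin K → Fin K → ℝ) (k : Fin K) :
    Differentiable ℝ (fun z : State K => cF ρ ηu ηv k (A, B, z)) ∧
      Differentiable ℝ (fun z : State K => cG ρ ηu ηv k (A, B, z)) := by
  induction k using WellFoundedLT.induction with
  | ind k ih =>
    have hp : Differentiable ℝ (fun z : State K => cP ρ ηu ηv k (A, B, z)) := by
      simp only [cP]
      refine Differentiable.add (by fun_prop) (Differentiable.fun_sum fun i hi => ?_)
      exact ((ih i (by simpa using hi)).1).const_mul _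
    have hq : Differentiable ℝ (fun z : State K => cQ ρ ηu ηv k (A, B, z)) := by
      simp only [cQ]
      refine Differentiable.add (by fun_prop) (Differentiable.fun_sum fun i hi => ?_)
      exact ((ih i (by simpa using hi)).2).const_mul _
    simp only [cF_eq, cG_eq]
    exact ⟨(((hρ'.comp hp).const_mul _).mul hq).neg, ((hρ.comp hp).const_mul _).neg⟩

theorem partialDeriv_coord (l m : Fin K ⊕ Fin K) (z : State K) :
    partialDeriv l (fun z => z m) z = if l = m then 1 else 0 := by
  have : fderiv ℝ (fun z : State K => z m) z = EuclideanSpace.proj m :=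
    (EuclideanSpace.proj (𝕜 := ℝ) m : State K →L[ℝ] ℝ).hasFDerivAt.fderiv
  rw [partialDeriv, this]
  simp [eq_comm]

theorem partialDeriv_cP (hρ : Differentiable ℝ ρ) (hρ' : Differentiable ℝ (deriv ρ))
    (l : Fin K ⊕ Fin K) (k : Fin K) (q : Par K) :
    DifferentiableAt ℝ (fun z => cP ρ ηu ηv k (q.1, q.2.1, z)) q.2.2 ∧
    partialDeriv l (fun z => cP ρ ηu ηv k (q.1, q.2.1, z)) q.2.2 =
      (if l = Sum.inl k then 1 else 0) + ∑ i ∈ Finset.Iio k, q.1 k i * dF ρ ηu ηv l i q := by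
  have h := fun i : Fin K => (differentiable_cF_cG (ηu := ηu) (ηv := ηv) hρ hρ' q.1 q.2.1 i).1 q.2.2
  have h0 : DifferentiableAt ℝ (fun z : State K => z (Sum.inl k)) q.2.2 := by fun_prop
  have h1 : DifferentiableAt ℝ (fun z : State K => ∑ i ∈ Finset.Iio k,
      q.1 k i * cF ρ ηu ηv i (q.1, q.2.1, z)) q.2.2 :=
    DifferentiableAt.fun_sum fun i _ => (h i).const_mul _
  refine ⟨h0.add h1, ?_⟩
  rw [← partialDeriv_coord l _ q.2.2]
  simp only [partialDeriv, cP, dF]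
  rw [fderiv_fun_add h0 h1, fderiv_fun_sum fun i _ => (h i).const_mul _]
  simp only [add_apply, sum_apply]
  congr 1
  refine Finset.sum_congr rfl fun i _ => ?_
  rw [fderiv_const_mul (h i)]
  simp

theorem partialDeriv_cQ (hρ : Differentiable ℝ ρ) (hρ' : Differentiable ℝ (deriv ρ))
    (l : Fin K ⊕ Fin K) (k : Fin K) (q : Par K) :
    DifferentiableAt ℝ (fun z => cQ ρ ηu ηv k (q.1, q.2.1, z)) q.2.2 ∧
    partialDeriv l (fun z => cQ ρ ηu ηv k (q.1, q.2.1, z)) q.2.2 =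
      (if l = Sum.inr k then 1 else 0) + ∑ i ∈ Finset.Iio k, q.2.1 k i * dG ρ ηu ηv l i q := by
  have h := fun i : Fin K => (differentiable_cF_cG (ηu := ηu) (ηv := ηv) hρ hρ' q.1 q.2.1 i).2 q.2.2
  have h0 : DifferentiableAt ℝ (fun z : State K => z (Sum.inr k)) q.2.2 := by fun_prop
  have h1 : DifferentiableAt ℝ (fun z : State K => ∑ i ∈ Finset.Iio k,
      q.2.1 k i * cG ρ ηu ηv i (q.1, q.2.1, z)) q.2.2 :=
    DifferentiableAt.fun_sum fun i _ => (h i).const_mul _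
  refine ⟨h0.add h1, ?_⟩
  rw [← partialDeriv_coord l _ q.2.2]
  simp only [partialDeriv, cQ, dG]
  rw [fderiv_fun_add h0 h1, fderiv_fun_sum fun i _ => (h i).const_mul _]
  simp only [add_apply, sum_apply]
  congr 1
  refine Finset.sum_congr rfl fun i _ => ?_
  rw [fderiv_const_mul (h i)]
  simp

/-- The recursion for the partial derivatives of the coefficients. By it their growth and their
dependence on the lower levels can be established by induction, as for the coefficients. -/
theorem dF_eq (hρ : Differentiable ℝ ρ) (hρ' : Differentiable ℝ (deriv ρ))
    (l : Fin K ⊕ Fin K) (k : Fin K) (q : Par K) :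
    dF ρ ηu ηv l k q = -(ηu * (deriv (deriv ρ) (cP ρ ηu ηv k q) *
      ((if l = Sum.inl k then 1 else 0) + ∑ i ∈ Finset.Iio k, q.1 k i * dF ρ ηu ηv l i q) *
        cQ ρ ηu ηv k q + deriv ρ (cP ρ ηu ηv k q) *
      ((if l = Sum.inr k then 1 else 0) + ∑ i ∈ Finset.Iio k, q.2.1 k i * dG ρ ηu ηv l i q))) := by
  obtain ⟨hp, hp'⟩ := partialDeriv_cP (ηu := ηu) (ηv := ηv) hρ hρ' l k q
  obtain ⟨hq, hq'⟩ := partialDeriv_cQ (ηu := ηu) (ηv := ηv) hρ hρ' l k q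
  rw [← hp', ← hq']
  conv_lhs => simp only [dF, cF_eq]
  have h1 := (hρ' (cP ρ ηu ηv k q)).hasDerivAt.comp_hasFDerivAt q.2.2 hp.hasFDerivAt
  have h2 := ((h1.const_mul ηu).mul hq.hasFDerivAt).neg
  simp only [partialDeriv]
  refine (congrArg (fun L => L (EuclideanSpace.single l 1)) h2.fderiv).trans ?_
  simp
  ring

theorem dG_eq (hρ : Differentiable ℝ ρ) (hρ' : Differentiable ℝ (deriv ρ))
    (l : Fin K ⊕ Fin K) (k : Fin K) (q : Par K) :
    dG ρ ηu ηv l k q = -(ηv * (deriv ρ (cP ρ ηu ηv k q) *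
      ((if l = Sum.inl k then 1 else 0) + ∑ i ∈ Finset.Iio k, q.1 k i * dF ρ ηu ηv l i q))) := by
  obtain ⟨hp, hp'⟩ := partialDeriv_cP (ηu := ηu) (ηv := ηv) hρ hρ' l k q
  rw [← hp']
  conv_lhs => simp only [dG, cG_eq]
  have h1 := (hρ (cP ρ ηu ηv k q)).hasDerivAt.comp_hasFDerivAt q.2.2 hp.hasFDerivAt
  have h2 := (h1.const_mul ηv).neg
  simp only [partialDeriv]
  refine (congrArg (fun L => L (EuclideanSpace.single l 1)) h2.fderiv).trans ?_
  simp

end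

/-! ### Growth of the coefficients -/

section

variable {K : ℕ} {ρ : ℝ → ℝ} {ηu ηv : ℝ}

theorem tame_fst (i j : Fin K) : Tame fun q : Par K => q.1 i j := by
  refine .of_norm_le (C := 1) (by fun_prop) fun q => ?_
  rw [one_mul]
  exact ((norm_le_pi_norm (q.1 i) j).trans (norm_le_pi_norm q.1 i)).trans (norm_fst_le q)

theorem tame_snd_fst (i j : Fin K) : Tame fun q : Par K => q.2.1 i j := by
  refine .of_norm_le (C := 1) (by fun_prop) fun q => ?_
  rw [one_mul]
  exact (((norm_le_pi_norm (q.2.1 i) j).trans (norm_le_pi_norm q.2.1 i)).trans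
    (norm_fst_le q.2)).trans (norm_snd_le q)

theorem tame_snd_snd (i : Fin K ⊕ Fin K) : Tame fun q : Par K => q.2.2 i := by
  refine .of_norm_le (C := 1) (by fun_prop) fun q => ?_
  rw [one_mul]
  exact ((PiLp.norm_apply_le q.2.2 i).trans (norm_snd_le q.2)).trans (norm_snd_le q)

variable {Cρ : ℝ}

theorem tame_rho (hρ : Differentiable ℝ ρ) (hρ1 : ∀ t, |deriv ρ t| ≤ Cρ) : Tame ρ := by
  have hC : 0 ≤ Cρ := (abs_nonneg _).trans (hρ1 0)
  have hlip : ∀ t, |ρ t - ρ 0| ≤ Cρ * |t| := by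
    intro t
    simpa using (convex_univ (𝕜 := ℝ)).norm_image_sub_le_of_norm_deriv_le (f := ρ)
      (fun x _ => hρ x) (fun x _ => hρ1 x) (Set.mem_univ 0) (Set.mem_univ t)
  have h : Tame fun t => ρ t - ρ 0 :=
    .of_norm_le (hρ.continuous.measurable.sub_const _) hlip
  simpa using h.add (.const (ρ 0))

theorem tame_deriv (hρ1 : ∀ t, |deriv ρ t| ≤ Cρ) : Tame (deriv ρ) :=
  .of_bounded (measurable_deriv ρ) hρ1

theorem tame_cP_cQ_of {k : Fin K}
    (h : ∀ i < k, Tame (cF ρ ηu ηv i) ∧ Tame (cG ρ ηu ηv i)) :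
    Tame (cP ρ ηu ηv k) ∧ Tame (cQ ρ ηu ηv k) :=
  ⟨(tame_snd_snd _).add (.sum _ fun i hi => (tame_fst _ _).mul (h i (by simpa using hi)).1),
    (tame_snd_snd _).add (.sum _ fun i hi => (tame_snd_fst _ _).mul (h i (by simpa using hi)).2)⟩

theorem tame_cF_cG (hρ : Differentiable ℝ ρ) (hρ1 : ∀ t, |deriv ρ t| ≤ Cρ) (k : Fin K) :
    Tame (cF ρ ηu ηv k) ∧ Tame (cG ρ ηu ηv k) := by
  induction k using WellFoundedLT.induction with
  | ind k ih =>
    obtain ⟨hp, hq⟩ := tame_cP_cQ_of ih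
    rw [funext (cF_eq ρ ηu ηv k), funext (cG_eq ρ ηu ηv k)]
    exact ⟨(((Tame.const _).mul ((tame_deriv hρ1).comp_real hp)).mul hq).neg,
      ((Tame.const _).mul ((tame_rho hρ hρ1).comp_real hp)).neg⟩

theorem tame_cP (hρ : Differentiable ℝ ρ) (hρ1 : ∀ t, |deriv ρ t| ≤ Cρ) (k : Fin K) :
    Tame (cP ρ ηu ηv k) := (tame_cP_cQ_of fun i _ => tame_cF_cG hρ hρ1 i).1

theorem tame_cQ (hρ : Differentiable ℝ ρ) (hρ1 : ∀ t, |deriv ρ t| ≤ Cρ) (k : Fin K) :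
    Tame (cQ ρ ηu ηv k) := (tame_cP_cQ_of fun i _ => tame_cF_cG hρ hρ1 i).2

theorem tame_dF_dG (hρ : Differentiable ℝ ρ) (hρ' : Differentiable ℝ (deriv ρ))
    (hρ1 : ∀ t, |deriv ρ t| ≤ Cρ) (hρ2 : ∀ t, |deriv (deriv ρ) t| ≤ Cρ)
    (l : Fin K ⊕ Fin K) (k : Fin K) :
    Tame (dF ρ ηu ηv l k) ∧ Tame (dG ρ ηu ηv l k) := by
  induction k using WellFoundedLT.induction with
  | ind k ih =>
    have hp := tame_cP (ηu := ηu) (ηv := ηv) hρ hρ1 k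
    have hq := tame_cQ (ηu := ηu) (ηv := ηv) hρ hρ1 k
    have h1 := (Tame.const (E := Par K) (if l = Sum.inl k then (1 : ℝ) else 0)).add
      (.sum (Finset.Iio k) fun i hi => (tame_fst k i).mul (ih i (by simpa using hi)).1)
    have h2 := (Tame.const (E := Par K) (if l = Sum.inr k then (1 : ℝ) else 0)).add
      (.sum (Finset.Iio k) fun i hi => (tame_snd_fst k i).mul (ih i (by simpa using hi)).2)
    rw [funext (dF_eq hρ hρ' l k), funext (dG_eq hρ hρ' l k)]
    exact ⟨((Tame.const _).mul (((((tame_deriv hρ2).comp_real hp).mul h1).mul hq).add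
      (((tame_deriv hρ1).comp_real hp).mul h2))).neg,
      ((Tame.const _).mul (((tame_deriv hρ1).comp_real hp).mul h1)).neg⟩

end

section

variable {K : ℕ} (ρ : ℝ → ℝ) (ηu ηv σu σv : ℝ)

/-- `𝔼[H_k ∂_l F_k | Z]`, as a function of the second moments and of `z`. -/
noncomputable def rF (l : Fin K ⊕ Fin K) (k : Fin K) (q : Par K) : ℝ :=
  ∑ j ∈ Finset.Iio k, q.1 k j * dF ρ ηu ηv l j q

/-- `𝔼[B_k ∂_l G_k | Z]`, as a function of the second moments and of `z`. -/
noncomputable def rG (l : Fin K ⊕ Fin K) (k : Fin K) (q : Par K) : ℝ :=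
  ∑ j ∈ Finset.Iio k, q.2.1 k j * dG ρ ηu ηv l j q

/-- The integrand of the coefficient of `B_i` in `∂_s H_k`, `i < k`. -/
noncomputable def coefHB (k i : Fin K) (q : Par K) : ℝ :=
  σv ^ 2 * (deriv ρ (cP ρ ηu ηv k q) * rF ρ ηu ηv (Sum.inr i) k q) +
    ρ (cP ρ ηu ηv k q) * cG ρ ηu ηv i q

/-- The integrand of the coefficient of `H_i` in `∂_s B_k`, `i < k`. -/
noncomputable def coefBH (k i : Fin K) (q : Par K) : ℝ :=
  -(deriv ρ (cP ρ ηu ηv k q) * cF ρ ηu ηv i q * cQ ρ ηu ηv k q) -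
    σu ^ 2 * (deriv ρ (cP ρ ηu ηv k q) * rG ρ ηu ηv (Sum.inl i) k q) -
    σu ^ 2 * (deriv (deriv ρ) (cP ρ ηu ηv k q) * cQ ρ ηu ηv k q * rF ρ ηu ηv (Sum.inl i) k q)

/-- The integrand of the coefficient of `H_k` in `∂_s B_k`. -/
noncomputable def coefBdiag (k : Fin K) (q : Par K) : ℝ :=
  -(σu ^ 2 * (deriv (deriv ρ) (cP ρ ηu ηv k q) * cQ ρ ηu ηv k q))

variable {ρ ηu ηv σu σv} {Cρ : ℝ}

theorem tame_rF (hρ : Differentiable ℝ ρ) (hρ' : Differentiable ℝ (deriv ρ))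
    (hρ1 : ∀ t, |deriv ρ t| ≤ Cρ) (hρ2 : ∀ t, |deriv (deriv ρ) t| ≤ Cρ)
    (l : Fin K ⊕ Fin K) (k : Fin K) : Tame (rF ρ ηu ηv l k) :=
  .sum _ fun i _ => (tame_fst k i).mul (tame_dF_dG hρ hρ' hρ1 hρ2 l i).1

theorem tame_rG (hρ : Differentiable ℝ ρ) (hρ' : Differentiable ℝ (deriv ρ))
    (hρ1 : ∀ t, |deriv ρ t| ≤ Cρ) (hρ2 : ∀ t, |deriv (deriv ρ) t| ≤ Cρ)
    (l : Fin K ⊕ Fin K) (k : Fin K) : Tame (rG ρ ηu ηv l k) :=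
  .sum _ fun i _ => (tame_snd_fst k i).mul (tame_dF_dG hρ hρ' hρ1 hρ2 l i).2

theorem tame_coefHB (hρ : Differentiable ℝ ρ) (hρ' : Differentiable ℝ (deriv ρ))
    (hρ1 : ∀ t, |deriv ρ t| ≤ Cρ) (hρ2 : ∀ t, |deriv (deriv ρ) t| ≤ Cρ)
    (k i : Fin K) : Tame (coefHB ρ ηu ηv σv k i) :=
  ((Tame.const _).mul (((tame_deriv hρ1).comp_real (tame_cP hρ hρ1 k)).mul
    (tame_rF hρ hρ' hρ1 hρ2 _ k))).add
    (((tame_rho hρ hρ1).comp_real (tame_cP hρ hρ1 k)).mul (tame_cF_cG hρ hρ1 i).2)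

theorem tame_coefBH (hρ : Differentiable ℝ ρ) (hρ' : Differentiable ℝ (deriv ρ))
    (hρ1 : ∀ t, |deriv ρ t| ≤ Cρ) (hρ2 : ∀ t, |deriv (deriv ρ) t| ≤ Cρ)
    (k i : Fin K) : Tame (coefBH ρ ηu ηv σu k i) :=
  ((((tame_deriv hρ1).comp_real (tame_cP hρ hρ1 k)).mul (tame_cF_cG hρ hρ1 i).1).mul
    (tame_cQ hρ hρ1 k)).neg.sub
    ((Tame.const _).mul (((tame_deriv hρ1).comp_real (tame_cP hρ hρ1 k)).mul
      (tame_rG hρ hρ' hρ1 hρ2 _ k))) |>.sub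
    ((Tame.const _).mul ((((tame_deriv hρ2).comp_real (tame_cP hρ hρ1 k)).mul
      (tame_cQ hρ hρ1 k)).mul (tame_rF hρ hρ' hρ1 hρ2 _ k)))

theorem tame_coefBdiag (hρ : Differentiable ℝ ρ)
    (hρ1 : ∀ t, |deriv ρ t| ≤ Cρ) (hρ2 : ∀ t, |deriv (deriv ρ) t| ≤ Cρ)
    (k : Fin K) : Tame (coefBdiag ρ ηu ηv σu k) :=
  ((Tame.const _).mul (((tame_deriv hρ2).comp_real (tame_cP hρ hρ1 k)).mul
    (tame_cQ hρ hρ1 k))).neg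

end

/-! ### The drifts as linear combinations of the coordinates -/

section CondExp

variable {α β : Type*} [mα : MeasurableSpace α] [mβ : MeasurableSpace β]
  {P : Measure α} {γ : Measure β} [IsProbabilityMeasure P] [IsProbabilityMeasure γ]

/-- Conditioning a product measure on its second factor integrates out the first one. -/
theorem condExp_comap_snd {f : α × β → ℝ} (hf : Integrable f (P.prod γ)) :
    (P.prod γ)[f | MeasurableSpace.comap Prod.snd mβ] =ᵐ[P.prod γ]
      fun a => ∫ ω, f (ω, a.2) ∂P := by
  have hle : MeasurableSpace.comap Prod.snd mβ ≤ (inferInstance : MeasurableSpace (α × β)) :=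
    measurable_snd.comap_le
  have hint : Integrable (fun a : α × β => ∫ ω, f (ω, a.2) ∂P) (P.prod γ) :=
    hf.integral_prod_right.comp_snd P
  symm
  refine ae_eq_condExp_of_forall_setIntegral_eq hle hf (fun s _ _ => hint.integrableOn) ?_ ?_
  · rintro _ ⟨t, ht, rfl⟩ -
    have hr : (P.prod γ).restrict (Prod.snd ⁻¹' t) = P.prod (γ.restrict t) := by
      rw [← Set.univ_prod, ← Measure.prod_restrict, Measure.restrict_univ]
    have hf' := hf.integrableOn (s := Prod.snd ⁻¹' t)
    have hint' := hint.integrableOn (s := Prod.snd ⁻¹' t)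
    rw [IntegrableOn, hr] at hf' hint'
    rw [hr, integral_prod_symm _ hint', integral_prod_symm _ hf']
    simp
  · obtain ⟨g, hg, hfg⟩ := hf.integral_prod_right.aestronglyMeasurable
    refine ⟨fun a => g a.2, hg.comp_measurable (comap_measurable _), ?_⟩
    exact (measurePreserving_snd (μ := P) (ν := γ)).quasiMeasurePreserving.ae_eq_comp hfg

end CondExp

/-- Conditioning a product measure on a sub-sigma-field of the first factor integrates out the
second one, provided that the result is already measurable with respect to the sub-sigma-field. -/
theorem condExp_comap_fst {α β : Type*} {m : MeasurableSpace α} [mα : MeasurableSpace α]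
    [mβ : MeasurableSpace β] {P : Measure α} {γ : Measure β} [IsProbabilityMeasure P]
    [IsProbabilityMeasure γ] (hm : m ≤ mα) {f : α × β → ℝ} (hf : Integrable f (P.prod γ))
    (hfm : AEStronglyMeasurable[m] (fun ω => ∫ z, f (ω, z) ∂γ) P) :
    (P.prod γ)[f | MeasurableSpace.comap Prod.fst m] =ᵐ[P.prod γ]
      fun a => ∫ z, f (a.1, z) ∂γ := by
  have hle : MeasurableSpace.comap Prod.fst m ≤ (inferInstance : MeasurableSpace (α × β)) :=
    (MeasurableSpace.comap_mono hm).trans measurable_fst.comap_le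
  have hint : Integrable (fun a : α × β => ∫ z, f (a.1, z) ∂γ) (P.prod γ) :=
    hf.integral_prod_left.comp_fst γ
  symm
  refine ae_eq_condExp_of_forall_setIntegral_eq hle hf (fun s _ _ => hint.integrableOn) ?_ ?_
  · rintro _ ⟨t, ht, rfl⟩ -
    rw [← Set.prod_univ, setIntegral_prod _ hint.integrableOn,
      setIntegral_prod _ hf.integrableOn]
    simp
  · obtain ⟨g, hg, hfg⟩ := hfm
    refine ⟨fun a => g a.1, hg.comp_measurable (comap_measurable _), ?_⟩
    exact (measurePreserving_fst (μ := P) (ν := γ)).quasiMeasurePreserving.ae_eq_comp hfg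

section

variable {Ω : Type*} [mΩ : MeasurableSpace Ω] {K din dout : ℕ}

/-- The second moments of the path `X` at time `s`, together with the point `z`. -/
noncomputable def par (P : Measure Ω) (X : Ω → PathSpace K) (s : unitInterval) (z : State K) :
    Par K :=
  (fun i j => ∫ ω, X ω s (Sum.inl i) * X ω s (Sum.inl j) ∂P,
    fun i j => ∫ ω, X ω s (Sum.inr i) * X ω s (Sum.inr j) ∂P, z)

theorem Tame.comp_par {f : Par K → ℝ} (hf : Tame f) (P : Measure Ω) (X : Ω → PathSpace K)
    (s : unitInterval) : Tame fun z : PathSpace K => f (par P X s (z s)) := by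
  have hev : Measurable fun z : PathSpace K => z s := (continuous_eval_const s).measurable
  have hm : Measurable fun z : PathSpace K => par P X s (z s) := by
    exact measurable_const.prodMk (measurable_const.prodMk hev)
  refine hf.comp hm ⟨hm.norm, ‖par P X s 0‖ + 1, 1, by positivity, fun z => ?_⟩
  have h0 : ‖par P X s (z s)‖ ≤ ‖par P X s 0‖ + ‖z s‖ := by
    have : par P X s (z s) = par P X s 0 + (0, 0, z s) := by simp [par]
    rw [this]
    refine (norm_add_le _ _).trans ?_
    simp [Prod.norm_def]
  have h1 := z.norm_coe_le_norm s
  have h2 := norm_nonneg (par P X s 0)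
  rw [abs_norm]
  nlinarith [norm_nonneg z]

variable {P : Measure Ω} [IsProbabilityMeasure P] {X : Ω → PathSpace K}

omit [IsProbabilityMeasure P] in
theorem memLp_coord (hX : MemLp X 2 P) (s : unitInterval) (l : Fin K ⊕ Fin K) :
    MemLp (fun ω => X ω s l) 2 P := by
  have hc : Continuous fun x : PathSpace K => x s l :=
    (EuclideanSpace.proj l : State K →L[ℝ] ℝ).continuous.comp (continuous_eval_const s)
  refine hX.mono (hc.comp_aestronglyMeasurable hX.aestronglyMeasurable) (ae_of_all _ fun ω => ?_)
  exact (PiLp.norm_apply_le (X ω s) l).trans ((X ω).norm_coe_le_norm s)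

theorem integrable_coord (hX : MemLp X 2 P) (s : unitInterval) (l : Fin K ⊕ Fin K) :
    Integrable (fun ω => X ω s l) P := (memLp_coord hX s l).integrable (by norm_num)

omit [IsProbabilityMeasure P] in
theorem integrable_coord_mul (hX : MemLp X 2 P) (s : unitInterval) (l l' : Fin K ⊕ Fin K) :
    Integrable (fun ω => X ω s l * X ω s l') P :=
  (memLp_coord hX s l).integrable_mul (memLp_coord hX s l')

variable (ρ : ℝ → ℝ) (ηu ηv σu σv : ℝ)

omit [IsProbabilityMeasure P] in
/-- The skeleton maps are linear in the path, with coefficients that only depend on the second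
moments and on `z`. -/
theorem skeleton_eq {s : unitInterval}
    (hI : ∀ l l' : Fin K ⊕ Fin K, Integrable (fun ω => X ω s l * X ω s l') P)
    (k : Fin (K + 1)) (z : State K) (ω : Ω) :
    skeleton P ρ ηu ηv X k s z ω =
      (∑ i : Fin K with i.castSucc < k, X ω s (Sum.inl i) * cF ρ ηu ηv i (par P X s z),
        ∑ i : Fin K with i.castSucc < k, X ω s (Sum.inr i) * cG ρ ηu ηv i (par P X s z)) := by
  induction k using Fin.induction generalizing ω with
  | zero => simp [skeleton]
  | succ j ih =>
    have hfil : (Finset.univ.filter fun i : Fin K => i.castSucc < j.castSucc) = Finset.Iio j := by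
      ext i; simp
    have hfil' : (Finset.univ.filter fun i : Fin K => i.castSucc < j.succ)
        = insert j (Finset.Iio j) := by
      ext i; simp [Fin.castSucc_lt_succ_iff, le_iff_eq_or_lt]
    have hp : z (Sum.inl j) + ∫ ω', X ω' s (Sum.inl j) *
        (skeleton P ρ ηu ηv X j.castSucc s z ω').1 ∂P = cP ρ ηu ηv j (par P X s z) := by
      simp only [ih, hfil, Finset.mul_sum, cP]
      rw [integral_finsetSum _ fun i _ => ?_]
      · congr 1
        refine Finset.sum_congr rfl fun i _ => ?_
        simp only [← mul_assoc]
        rw [integral_mul_const]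
        rfl
      · simp only [← mul_assoc]
        exact (hI _ _).mul_const _
    have hq : z (Sum.inr j) + ∫ ω', X ω' s (Sum.inr j) *
        (skeleton P ρ ηu ηv X j.castSucc s z ω').2 ∂P = cQ ρ ηu ηv j (par P X s z) := by
      simp only [ih, hfil, Finset.mul_sum, cQ]
      rw [integral_finsetSum _ fun i _ => ?_]
      · congr 1
        refine Finset.sum_congr rfl fun i _ => ?_
        simp only [← mul_assoc]
        rw [integral_mul_const]
        rfl
      · simp only [← mul_assoc]
        exact (hI _ _).mul_const _
    have hstep : skeleton P ρ ηu ηv X j.succ s z ω =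
        ((skeleton P ρ ηu ηv X j.castSucc s z ω).1 -
          ηu * deriv ρ (z (Sum.inl j) + ∫ ω', X ω' s (Sum.inl j) *
            (skeleton P ρ ηu ηv X j.castSucc s z ω').1 ∂P) *
          (z (Sum.inr j) + ∫ ω', X ω' s (Sum.inr j) *
            (skeleton P ρ ηu ηv X j.castSucc s z ω').2 ∂P) * X ω s (Sum.inl j),
        (skeleton P ρ ηu ηv X j.castSucc s z ω).2 -
          ηv * ρ (z (Sum.inl j) + ∫ ω', X ω' s (Sum.inl j) *
            (skeleton P ρ ηu ηv X j.castSucc s z ω').1 ∂P) * X ω s (Sum.inr j)) := by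
      conv_lhs => rw [skeleton, Fin.induction_succ]
      rfl
    rw [hstep, hp, hq, ih, hfil, hfil', Finset.sum_insert (by simp), Finset.sum_insert (by simp),
      cF_eq ρ ηu ηv j, cG_eq ρ ηu ηv j]
    refine Prod.ext ?_ ?_ <;> simp only <;> ring

omit [IsProbabilityMeasure P] in
theorem skelF_eq {s : unitInterval}
    (hI : ∀ l l' : Fin K ⊕ Fin K, Integrable (fun ω => X ω s l * X ω s l') P)
    (k : Fin K) (z : State K) (ω : Ω) :
    skelF P ρ ηu ηv X k s z ω =
      ∑ i ∈ Finset.Iio k, X ω s (Sum.inl i) * cF ρ ηu ηv i (par P X s z) := by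
  rw [skelF, skeleton_eq ρ ηu ηv hI]
  have hfil : (Finset.univ.filter fun i : Fin K => i.castSucc < k.castSucc) = Finset.Iio k := by
    ext i; simp
  simp only [hfil]

omit [IsProbabilityMeasure P] in
theorem skelG_eq {s : unitInterval}
    (hI : ∀ l l' : Fin K ⊕ Fin K, Integrable (fun ω => X ω s l * X ω s l') P)
    (k : Fin K) (z : State K) (ω : Ω) :
    skelG P ρ ηu ηv X k s z ω =
      ∑ i ∈ Finset.Iio k, X ω s (Sum.inr i) * cG ρ ηu ηv i (par P X s z) := by
  rw [skelG, skeleton_eq ρ ηu ηv hI]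
  have hfil : (Finset.univ.filter fun i : Fin K => i.castSucc < k.castSucc) = Finset.Iio k := by
    ext i; simp
  simp only [hfil]

variable {ρ ηu ηv σu σv} {Cρ : ℝ}

omit [IsProbabilityMeasure P] in
theorem partialDeriv_skelF (hρ : Differentiable ℝ ρ) (hρ' : Differentiable ℝ (deriv ρ))
    {s : unitInterval}
    (hI : ∀ l l' : Fin K ⊕ Fin K, Integrable (fun ω => X ω s l * X ω s l') P)
    (l : Fin K ⊕ Fin K) (k : Fin K) (z : State K) (ω : Ω) :
    partialDeriv l (fun z => skelF P ρ ηu ηv X k s z ω) z =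
      ∑ i ∈ Finset.Iio k, X ω s (Sum.inl i) * dF ρ ηu ηv l i (par P X s z) := by
  have h := fun i : Fin K => (differentiable_cF_cG (ηu := ηu) (ηv := ηv) hρ hρ'
    (par P X s z).1 (par P X s z).2.1 i).1 z
  simp only [skelF_eq ρ ηu ηv hI, partialDeriv, dF]
  change (fderiv ℝ (fun z => ∑ i ∈ Finset.Iio k, X ω s (Sum.inl i) *
    cF ρ ηu ηv i ((par P X s z).1, (par P X s z).2.1, z)) z) _ = _
  refine (congrArg (fun L => L (EuclideanSpace.single l 1))
    (fderiv_fun_sum fun i _ => (h i).const_mul _)).trans ?_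
  simp only [sum_apply]
  refine Finset.sum_congr rfl fun i _ => ?_
  exact congrArg (fun L => L (EuclideanSpace.single l 1)) (fderiv_const_mul (h i) _)

omit [IsProbabilityMeasure P] in
theorem partialDeriv_skelG (hρ : Differentiable ℝ ρ) (hρ' : Differentiable ℝ (deriv ρ))
    {s : unitInterval}
    (hI : ∀ l l' : Fin K ⊕ Fin K, Integrable (fun ω => X ω s l * X ω s l') P)
    (l : Fin K ⊕ Fin K) (k : Fin K) (z : State K) (ω : Ω) :
    partialDeriv l (fun z => skelG P ρ ηu ηv X k s z ω) z =
      ∑ i ∈ Finset.Iio k, X ω s (Sum.inr i) * dG ρ ηu ηv l i (par P X s z) := by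
  have h := fun i : Fin K => (differentiable_cF_cG (ηu := ηu) (ηv := ηv) hρ hρ'
    (par P X s z).1 (par P X s z).2.1 i).2 z
  simp only [skelG_eq ρ ηu ηv hI, partialDeriv, dG]
  change (fderiv ℝ (fun z => ∑ i ∈ Finset.Iio k, X ω s (Sum.inr i) *
    cG ρ ηu ηv i ((par P X s z).1, (par P X s z).2.1, z)) z) _ = _
  refine (congrArg (fun L => L (EuclideanSpace.single l 1))
    (fderiv_fun_sum fun i _ => (h i).const_mul _)).trans ?_
  simp only [sum_apply]
  refine Finset.sum_congr rfl fun i _ => ?_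
  exact congrArg (fun L => L (EuclideanSpace.single l 1)) (fderiv_const_mul (h i) _)

variable {γ : Measure (PathSpace K)} [IsGaussian γ]

omit [IsProbabilityMeasure P] in
theorem integrable_sum_mul {ι : Type*} (t : Finset ι) (s : unitInterval) {Y : ι → Ω → ℝ}
    {φ : ι → Par K → ℝ} (hY : ∀ i ∈ t, Integrable (Y i) P) (hφ : ∀ i ∈ t, Tame (φ i)) :
    Integrable (fun b : Ω × PathSpace K => ∑ i ∈ t, Y i b.1 * φ i (par P X s (b.2 s)))
      (P.prod γ) :=
  integrable_finsetSum _ fun i hi =>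
    (hY i hi).mul_prod (((hφ i hi).comp_par P X s).integrable γ)

theorem condExp_sigmaZ {ι : Type*} (t : Finset ι) (s : unitInterval) {Y : ι → Ω → ℝ}
    {φ : ι → Par K → ℝ} (hY : ∀ i ∈ t, Integrable (Y i) P) (hφ : ∀ i ∈ t, Tame (φ i)) :
    (P.prod γ)[fun b : Ω × PathSpace K => ∑ i ∈ t, Y i b.1 * φ i (par P X s (b.2 s))
      | sigmaZ Ω K] =ᵐ[P.prod γ]
    fun a => ∑ i ∈ t, (∫ ω, Y i ω ∂P) * φ i (par P X s (a.2 s)) := by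
  refine (condExp_comap_snd (integrable_sum_mul t s hY hφ)).trans (ae_of_all _ fun a => ?_)
  simp only
  rw [integral_finsetSum _ fun i hi => (hY i hi).mul_const _]
  simp only [integral_mul_const]

theorem condExp_sigmaW {Win : Ω → EuclideanSpace ℝ (Fin din)}
    {Wout : Ω → EuclideanSpace ℝ (Fin dout)} (hle : initSigma Win Wout ≤ mΩ)
    {ι : Type*} (t : Finset ι) (s : unitInterval) {Y : ι → Ω → ℝ}
    {φ : ι → Par K → ℝ} (hY : ∀ i ∈ t, Integrable (Y i) P)
    (hYm : ∀ i ∈ t, AEStronglyMeasurable[initSigma Win Wout] (Y i) P)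
    (hφ : ∀ i ∈ t, Tame (φ i)) :
    (P.prod γ)[fun b : Ω × PathSpace K => ∑ i ∈ t, Y i b.1 * φ i (par P X s (b.2 s))
      | sigmaW Win Wout K] =ᵐ[P.prod γ]
    fun a => ∑ i ∈ t, Y i a.1 * ∫ z, φ i (par P X s (z s)) ∂γ := by
  have h : ∀ ω, ∫ z, ∑ i ∈ t, Y i ω * φ i (par P X s (z s)) ∂γ =
      ∑ i ∈ t, Y i ω * ∫ z, φ i (par P X s (z s)) ∂γ := by
    intro ω
    rw [integral_finsetSum _ fun i hi =>
      (((hφ i hi).comp_par P X s).integrable γ).const_mul _]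
    simp only [integral_const_mul]
  refine (condExp_comap_fst hle (integrable_sum_mul t s hY hφ) ?_).trans
    (ae_of_all _ fun a => h a.1)
  simp only [h]
  choose! g hg hYg using hYm
  refine ⟨fun ω => ∑ i ∈ t, g i ω * ∫ z, φ i (par P X s (z s)) ∂γ,
    Finset.stronglyMeasurable_fun_sum t fun i hi => (hg i hi).mul_const _, ?_⟩
  filter_upwards [(Filter.eventually_all_finset t).2 hYg] with ω hω
  exact Finset.sum_congr rfl fun i hi => by rw [hω i hi]

theorem preP_ae (hρ : Differentiable ℝ ρ) (hρ1 : ∀ t, |deriv ρ t| ≤ Cρ)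
    (hX : MemLp X 2 P) (k : Fin K) (s : unitInterval) :
    preP P ρ ηu ηv X γ k s =ᵐ[P.prod γ] fun a => cP ρ ηu ηv k (par P X s (a.2 s)) := by
  have h := condExp_sigmaZ (P := P) (X := X) (γ := γ) (Finset.Iio k) s
    (Y := fun i ω => X ω s (Sum.inl k) * X ω s (Sum.inl i)) (φ := fun i => cF ρ ηu ηv i)
    (fun i _ => integrable_coord_mul hX s _ _) (fun i _ => (tame_cF_cG hρ hρ1 i).1)
  filter_upwards [h] with a ha
  simp only [preP, skelF_eq ρ ηu ηv (integrable_coord_mul hX s), Finset.mul_sum, ← mul_assoc]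
  rw [ha]
  rfl

theorem preQ_ae (hρ : Differentiable ℝ ρ) (hρ1 : ∀ t, |deriv ρ t| ≤ Cρ)
    (hX : MemLp X 2 P) (k : Fin K) (s : unitInterval) :
    preQ P ρ ηu ηv X γ k s =ᵐ[P.prod γ] fun a => cQ ρ ηu ηv k (par P X s (a.2 s)) := by
  have h := condExp_sigmaZ (P := P) (X := X) (γ := γ) (Finset.Iio k) s
    (Y := fun i ω => X ω s (Sum.inr k) * X ω s (Sum.inr i)) (φ := fun i => cG ρ ηu ηv i)
    (fun i _ => integrable_coord_mul hX s _ _) (fun i _ => (tame_cF_cG hρ hρ1 i).2)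
  filter_upwards [h] with a ha
  simp only [preQ, skelG_eq ρ ηu ηv (integrable_coord_mul hX s), Finset.mul_sum, ← mul_assoc]
  rw [ha]
  rfl

theorem respF_ae (hρ : Differentiable ℝ ρ) (hρ' : Differentiable ℝ (deriv ρ))
    (hρ1 : ∀ t, |deriv ρ t| ≤ Cρ) (hρ2 : ∀ t, |deriv (deriv ρ) t| ≤ Cρ)
    (hX : MemLp X 2 P) (k : Fin K) (l : Fin K ⊕ Fin K) (s : unitInterval) :
    respF P ρ ηu ηv X γ k l s =ᵐ[P.prod γ] fun a => rF ρ ηu ηv l k (par P X s (a.2 s)) := by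
  have h := condExp_sigmaZ (P := P) (X := X) (γ := γ) (Finset.Iio k) s
    (Y := fun i ω => X ω s (Sum.inl k) * X ω s (Sum.inl i)) (φ := fun i => dF ρ ηu ηv l i)
    (fun i _ => integrable_coord_mul hX s _ _) (fun i _ => (tame_dF_dG hρ hρ' hρ1 hρ2 l i).1)
  filter_upwards [h] with a ha
  simp only [respF, partialDeriv_skelF hρ hρ' (integrable_coord_mul hX s), Finset.mul_sum,
    ← mul_assoc]
  rw [ha]
  rfl

theorem respG_ae (hρ : Differentiable ℝ ρ) (hρ' : Differentiable ℝ (deriv ρ))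
    (hρ1 : ∀ t, |deriv ρ t| ≤ Cρ) (hρ2 : ∀ t, |deriv (deriv ρ) t| ≤ Cρ)
    (hX : MemLp X 2 P) (k : Fin K) (l : Fin K ⊕ Fin K) (s : unitInterval) :
    respG P ρ ηu ηv X γ k l s =ᵐ[P.prod γ] fun a => rG ρ ηu ηv l k (par P X s (a.2 s)) := by
  have h := condExp_sigmaZ (P := P) (X := X) (γ := γ) (Finset.Iio k) s
    (Y := fun i ω => X ω s (Sum.inr k) * X ω s (Sum.inr i)) (φ := fun i => dG ρ ηu ηv l i)
    (fun i _ => integrable_coord_mul hX s _ _) (fun i _ => (tame_dF_dG hρ hρ' hρ1 hρ2 l i).2)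
  filter_upwards [h] with a ha
  simp only [respG, partialDeriv_skelG hρ hρ' (integrable_coord_mul hX s), Finset.mul_sum,
    ← mul_assoc]
  rw [ha]
  rfl

theorem integral_prod_snd_congr {f : Ω × PathSpace K → ℝ} {g : PathSpace K → ℝ}
    (h : f =ᵐ[P.prod γ] fun a => g a.2) : ∫ a, f a ∂(P.prod γ) = ∫ z, g z ∂γ := by
  rw [integral_congr_ae h, integral_fun_snd]
  simp

variable {Win : Ω → EuclideanSpace ℝ (Fin din)} {Wout : Ω → EuclideanSpace ℝ (Fin dout)}

omit [IsProbabilityMeasure P] in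
theorem aestronglyMeasurable_coord (hXm : AEStronglyMeasurable[initSigma Win Wout] X P)
    (s : unitInterval) (l : Fin K ⊕ Fin K) :
    AEStronglyMeasurable[initSigma Win Wout] (fun ω => X ω s l) P := by
  have hc : Continuous fun x : PathSpace K => x s l :=
    (EuclideanSpace.proj l : State K →L[ℝ] ℝ).continuous.comp (continuous_eval_const s)
  exact hc.comp_aestronglyMeasurable hXm

/-- The forward drift is a combination of the backward coordinates with deterministic
coefficients. -/
theorem driftH_ae (hρ : Differentiable ℝ ρ) (hρ' : Differentiable ℝ (deriv ρ))
    (hρ1 : ∀ t, |deriv ρ t| ≤ Cρ) (hρ2 : ∀ t, |deriv (deriv ρ) t| ≤ Cρ)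
    (hle : initSigma Win Wout ≤ mΩ) (hX : MemLp X 2 P)
    (hXm : AEStronglyMeasurable[initSigma Win Wout] X P) (k : Fin K) (s : unitInterval) :
    driftH P Win Wout ρ ηu ηv σv X γ k s =ᵐ[P.prod γ] fun a =>
      ∑ i ∈ Finset.Iio k,
        (∫ z, coefHB ρ ηu ηv σv k i (par P X s (z s)) ∂γ) * X a.1 s (Sum.inr i) := by
  have hp := preP_ae (ηu := ηu) (ηv := ηv) (γ := γ) hρ hρ1 hX k s
  have h1 : (fun b : Ω × PathSpace K =>
      ρ (preP P ρ ηu ηv X γ k s b) * skelG P ρ ηu ηv X k s (b.2 s) b.1) =ᵐ[P.prod γ]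
      fun b => ∑ i ∈ Finset.Iio k, X b.1 s (Sum.inr i) *
        (ρ (cP ρ ηu ηv k (par P X s (b.2 s))) * cG ρ ηu ηv i (par P X s (b.2 s))) := by
    filter_upwards [hp] with b hb
    rw [hb, skelG_eq ρ ηu ηv (integrable_coord_mul hX s), Finset.mul_sum]
    exact Finset.sum_congr rfl fun i _ => by ring
  have ht : ∀ i : Fin K, Tame fun q : Par K => ρ (cP ρ ηu ηv k q) * cG ρ ηu ηv i q := fun i =>
    ((tame_rho hρ hρ1).comp_real (tame_cP hρ hρ1 k)).mul (tame_cF_cG hρ hρ1 i).2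
  have ht' : ∀ i : Fin K, Tame fun q : Par K =>
      deriv ρ (cP ρ ηu ηv k q) * rF ρ ηu ηv (Sum.inr i) k q := fun i =>
    ((tame_deriv hρ1).comp_real (tame_cP hρ hρ1 k)).mul (tame_rF hρ hρ' hρ1 hρ2 _ k)
  have h2 := condExp_sigmaW (P := P) (X := X) (γ := γ) hle (Finset.Iio k) s
    (Y := fun i ω => X ω s (Sum.inr i))
    (φ := fun i q => ρ (cP ρ ηu ηv k q) * cG ρ ηu ηv i q)
    (fun i _ => integrable_coord hX s _) (fun i _ => aestronglyMeasurable_coord hXm s _)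
    (fun i _ => ht i)
  have h3 : ∀ i : Fin K, ∫ b, deriv ρ (preP P ρ ηu ηv X γ k s b) *
      respF P ρ ηu ηv X γ k (Sum.inr i) s b ∂(P.prod γ) =
      ∫ z, deriv ρ (cP ρ ηu ηv k (par P X s (z s))) *
        rF ρ ηu ηv (Sum.inr i) k (par P X s (z s)) ∂γ := by
    intro i
    refine integral_prod_snd_congr (g := fun z => deriv ρ (cP ρ ηu ηv k (par P X s (z s))) *
        rF ρ ηu ηv (Sum.inr i) k (par P X s (z s))) ?_
    filter_upwards [hp, respF_ae (ηu := ηu) (ηv := ηv) (γ := γ) hρ hρ' hρ1 hρ2 hX k (Sum.inr i) s]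
      with b hb hb'
    rw [hb, hb']
  filter_upwards [(condExp_congr_ae (m := sigmaW Win Wout K) h1).trans h2] with a ha
  simp only [driftH, h3]
  rw [ha, Finset.mul_sum, ← Finset.sum_add_distrib]
  refine Finset.sum_congr rfl fun i _ => ?_
  simp only [coefHB]
  rw [integral_add ((((Tame.const _).mul (ht' i)).comp_par P X s).integrable γ)
    (((ht i).comp_par P X s).integrable γ), integral_const_mul]
  ring

/-- The backward drift is a combination of the forward coordinates with deterministic
coefficients. -/
theorem driftB_ae (hρ : Differentiable ℝ ρ) (hρ' : Differentiable ℝ (deriv ρ))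
    (hρ1 : ∀ t, |deriv ρ t| ≤ Cρ) (hρ2 : ∀ t, |deriv (deriv ρ) t| ≤ Cρ)
    (hle : initSigma Win Wout ≤ mΩ) (hX : MemLp X 2 P)
    (hXm : AEStronglyMeasurable[initSigma Win Wout] X P) (k : Fin K) (s : unitInterval) :
    driftB P Win Wout ρ ηu ηv σu X γ k s =ᵐ[P.prod γ] fun a =>
      ∑ i ∈ Finset.Iio k,
        (∫ z, coefBH ρ ηu ηv σu k i (par P X s (z s)) ∂γ) * X a.1 s (Sum.inl i) +
      (∫ z, coefBdiag ρ ηu ηv σu k (par P X s (z s)) ∂γ) * X a.1 s (Sum.inl k) := by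
  have hp := preP_ae (ηu := ηu) (ηv := ηv) (γ := γ) hρ hρ1 hX k s
  have hq := preQ_ae (ηu := ηu) (ηv := ηv) (γ := γ) hρ hρ1 hX k s
  have hr := fun i : Fin K =>
    respF_ae (ηu := ηu) (ηv := ηv) (γ := γ) hρ hρ' hρ1 hρ2 hX k (Sum.inl i) s
  have hr' : ∀ᵐ a ∂(P.prod γ), ∀ i : Fin K, respF P ρ ηu ηv X γ k (Sum.inl i) s a =
      rF ρ ηu ηv (Sum.inl i) k (par P X s (a.2 s)) := ae_all_iff.2 hr
  have t0 : Tame fun q : Par K => deriv (deriv ρ) (cP ρ ηu ηv k q) * cQ ρ ηu ηv k q :=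
    ((tame_deriv hρ2).comp_real (tame_cP hρ hρ1 k)).mul (tame_cQ hρ hρ1 k)
  have t1 : ∀ i : Fin K, Tame fun q : Par K =>
      deriv ρ (cP ρ ηu ηv k q) * cF ρ ηu ηv i q * cQ ρ ηu ηv k q := fun i =>
    (((tame_deriv hρ1).comp_real (tame_cP hρ hρ1 k)).mul (tame_cF_cG hρ hρ1 i).1).mul
      (tame_cQ hρ hρ1 k)
  have t2 : ∀ i : Fin K, Tame fun q : Par K =>
      deriv ρ (cP ρ ηu ηv k q) * rG ρ ηu ηv (Sum.inl i) k q := fun i =>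
    ((tame_deriv hρ1).comp_real (tame_cP hρ hρ1 k)).mul (tame_rG hρ hρ' hρ1 hρ2 _ k)
  have t3 : ∀ i : Fin K, Tame fun q : Par K =>
      deriv (deriv ρ) (cP ρ ηu ηv k q) * cQ ρ ηu ηv k q * rF ρ ηu ηv (Sum.inl i) k q := fun i =>
    t0.mul (tame_rF hρ hρ' hρ1 hρ2 _ k)
  have h1 : (fun b : Ω × PathSpace K => deriv ρ (preP P ρ ηu ηv X γ k s b) *
      skelF P ρ ηu ηv X k s (b.2 s) b.1 * preQ P ρ ηu ηv X γ k s b) =ᵐ[P.prod γ]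
      fun b => ∑ i ∈ Finset.Iio k, X b.1 s (Sum.inl i) *
        (deriv ρ (cP ρ ηu ηv k (par P X s (b.2 s))) * cF ρ ηu ηv i (par P X s (b.2 s)) *
          cQ ρ ηu ηv k (par P X s (b.2 s))) := by
    filter_upwards [hp, hq] with b hb hb'
    rw [hb, hb', skelF_eq ρ ηu ηv (integrable_coord_mul hX s), Finset.mul_sum, Finset.sum_mul]
    exact Finset.sum_congr rfl fun i _ => by ring
  have h2 := condExp_sigmaW (P := P) (X := X) (γ := γ) hle (Finset.Iio k) s
    (Y := fun i ω => X ω s (Sum.inl i))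
    (φ := fun i q => deriv ρ (cP ρ ηu ηv k q) * cF ρ ηu ηv i q * cQ ρ ηu ηv k q)
    (fun i _ => integrable_coord hX s _) (fun i _ => aestronglyMeasurable_coord hXm s _)
    (fun i _ => t1 i)
  have h3 : ∀ i : Fin K, ∫ b, deriv ρ (preP P ρ ηu ηv X γ k s b) *
      respG P ρ ηu ηv X γ k (Sum.inl i) s b ∂(P.prod γ) =
      ∫ z, deriv ρ (cP ρ ηu ηv k (par P X s (z s))) *
        rG ρ ηu ηv (Sum.inl i) k (par P X s (z s)) ∂γ := by
    intro i
    refine integral_prod_snd_congr (g := fun z => deriv ρ (cP ρ ηu ηv k (par P X s (z s))) *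
        rG ρ ηu ηv (Sum.inl i) k (par P X s (z s))) ?_
    filter_upwards [hp, respG_ae (ηu := ηu) (ηv := ηv) (γ := γ) hρ hρ' hρ1 hρ2 hX k (Sum.inl i) s]
      with b hb hb'
    rw [hb, hb']
  -- `none` indexes the term with `H_k`, `some i` the one with `H_i`, `i < k`.
  have h4 : (fun b : Ω × PathSpace K => deriv (deriv ρ) (preP P ρ ηu ηv X γ k s b) *
      preQ P ρ ηu ηv X γ k s b * (X b.1 s (Sum.inl k) + ∑ i ∈ Finset.Iio k,
        respF P ρ ηu ηv X γ k (Sum.inl i) s b * X b.1 s (Sum.inl i))) =ᵐ[P.prod γ]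
      fun b => ∑ o ∈ Finset.insertNone (Finset.Iio k), X b.1 s (Sum.inl (o.getD k)) *
        (o.elim (fun q : Par K => deriv (deriv ρ) (cP ρ ηu ηv k q) * cQ ρ ηu ηv k q)
          (fun i q => deriv (deriv ρ) (cP ρ ηu ηv k q) * cQ ρ ηu ηv k q *
            rF ρ ηu ηv (Sum.inl i) k q) (par P X s (b.2 s))) := by
    filter_upwards [hp, hq, hr'] with b hb hb' hb''
    simp only [hb, hb', hb'', Finset.sum_insertNone, Option.getD_none, Option.getD_some,
      Option.elim_none, Option.elim_some, mul_add, Finset.mul_sum]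
    congr 1
    · ring
    · exact Finset.sum_congr rfl fun i _ => by ring
  have h5 := condExp_sigmaW (P := P) (X := X) (γ := γ) hle (Finset.insertNone (Finset.Iio k)) s
    (Y := fun o ω => X ω s (Sum.inl (o.getD k)))
    (φ := fun o => o.elim (fun q : Par K => deriv (deriv ρ) (cP ρ ηu ηv k q) * cQ ρ ηu ηv k q)
          (fun i q => deriv (deriv ρ) (cP ρ ηu ηv k q) * cQ ρ ηu ηv k q *
            rF ρ ηu ηv (Sum.inl i) k q))
    (fun i _ => integrable_coord hX s _) (fun i _ => aestronglyMeasurable_coord hXm s _)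
    (fun o _ => by cases o with
      | none => exact t0
      | some i => exact t3 i)
  filter_upwards [(condExp_congr_ae (m := sigmaW Win Wout K) h1).trans h2,
    (condExp_congr_ae (m := sigmaW Win Wout K) h4).trans h5] with a ha ha'
  simp only [driftB, h3]
  rw [ha, ha']
  simp only [Finset.sum_insertNone, Option.getD_none, Option.getD_some,
      Option.elim_none, Option.elim_some, coefBdiag]
  have h6 : ∀ i : Fin K, ∫ z, coefBH ρ ηu ηv σu k i (par P X s (z s)) ∂γ =
      -(∫ z, deriv ρ (cP ρ ηu ηv k (par P X s (z s))) * cF ρ ηu ηv i (par P X s (z s)) *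
          cQ ρ ηu ηv k (par P X s (z s)) ∂γ) -
      σu ^ 2 * (∫ z, deriv ρ (cP ρ ηu ηv k (par P X s (z s))) *
        rG ρ ηu ηv (Sum.inl i) k (par P X s (z s)) ∂γ) -
      σu ^ 2 * ∫ z, deriv (deriv ρ) (cP ρ ηu ηv k (par P X s (z s))) *
        cQ ρ ηu ηv k (par P X s (z s)) * rF ρ ηu ηv (Sum.inl i) k (par P X s (z s)) ∂γ := by
    intro i
    have i1 := (((t1 i).neg).comp_par P X s).integrable γ
    have i2 := (((Tame.const (σu ^ 2)).mul (t2 i)).comp_par P X s).integrable γ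
    have i12 := (((t1 i).neg.sub ((Tame.const (σu ^ 2)).mul (t2 i))).comp_par P X s).integrable γ
    have i3 := (((Tame.const (σu ^ 2)).mul (t3 i)).comp_par P X s).integrable γ
    simp only [coefBH]
    rw [integral_sub i12 i3, integral_sub i1 i2, integral_neg, integral_const_mul,
      integral_const_mul]
  simp only [h6, integral_neg, integral_const_mul, mul_add, Finset.mul_sum, sub_mul, neg_mul,
    Finset.sum_sub_distrib, Finset.sum_neg_distrib]
  simp only [mul_assoc, mul_comm, mul_left_comm]
  ring

end

/-! ### Integral equations on the unit interval -/

section Carath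

variable {E : Type*} [NormedAddCommGroup E] [NormedSpace ℝ E]

theorem setIntegral_Iic_eq (g : ℝ → E) (s : unitInterval) :
    ∫ r in Set.Iic s, g r = ∫ t in (0 : ℝ)..s, g t := by
  have h := unitInterval.measurePreserving_coe.setIntegral_image_emb
    unitInterval.measurableEmbedding_coe g (Set.Iic s)
  rw [← h, Set.image_subtype_val_Icc_Iic, Measure.restrict_restrict measurableSet_Icc,
    intervalIntegral.integral_of_le s.2.1, ← integral_Icc_eq_integral_Ioc,
    Set.inter_eq_left.2 (Set.Icc_subset_Icc_right s.2.2)]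

/-- The primitive of an integrable function on the unit interval, as a continuous path. -/
theorem continuous_setIntegral_Iic {g : unitInterval → E} (hg : Integrable g) :
    Continuous fun s : unitInterval => ∫ r in Set.Iic s, g r := by
  have h1 : IntegrableOn (Set.IccExtend zero_le_one g) (Set.uIcc (0 : ℝ) 1) volume := by
    rw [Set.uIcc_of_le zero_le_one]
    rw [IntegrableOn, ← unitInterval.measurePreserving_coe.integrable_comp_emb
      unitInterval.measurableEmbedding_coe]
    convert hg using 1
    ext r
    simp
  have h2 := intervalIntegral.continuousOn_primitive_interval h1
  rw [Set.uIcc_of_le zero_le_one] at h2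
  have h3 := continuousOn_iff_continuous_domRestrict.1 h2
  convert h3 using 2 with s
  rw [Set.domRestrict_apply, ← setIntegral_Iic_eq]
  simp

theorem setIntegral_Ici_eq (g : unitInterval → E) (s : unitInterval) :
    ∫ r in Set.Ici s, g r = ∫ r in Set.Iic (unitInterval.symm s), g (unitInterval.symm r) := by
  have h := unitInterval.measurePreserving_symm.setIntegral_preimage_emb
    unitInterval.symmMeasurableEquiv.measurableEmbedding g (Set.Ici s)
  rw [← h]
  congr 2
  ext r
  simp only [Set.mem_preimage, Set.mem_Ici, Set.mem_Iic]
  rw [unitInterval.le_symm_comm]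

/-- Iterated Gronwall bound. It is applied to the distances between the Picard iterates of two
paths, and to a constant sequence in the proof of uniqueness. -/
theorem iterate_bound {d : ℕ → unitInterval → ℝ} (hd : ∀ n, Continuous (d n)) {M L : ℝ}
    (hL : 0 ≤ L) (h0 : ∀ s, d 0 s ≤ M)
    (h : ∀ n s, d (n + 1) s ≤ ∫ r in Set.Iic s, L * d n r) (n : ℕ) (s : unitInterval) :
    d n s ≤ M * ((L * s) ^ n / n.factorial) := by
  induction n generalizing s with
  | zero => simpa using h0 s
  | succ n ih =>
    have hc : Continuous fun r : unitInterval => L * (M * ((L * (r : ℝ)) ^ n / n.factorial)) := by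
      fun_prop
    refine (h n s).trans ((setIntegral_mono
      ((continuous_const.mul (hd n)).integrable_of_hasCompactSupport
        (.of_compactSpace _)).integrableOn
      (hc.integrable_of_hasCompactSupport (.of_compactSpace _)).integrableOn
      fun r => mul_le_mul_of_nonneg_left (ih r) hL).trans (le_of_eq ?_))
    rw [setIntegral_Iic_eq fun t => L * (M * ((L * t) ^ n / n.factorial))]
    have : ∀ t : ℝ, L * (M * ((L * t) ^ n / n.factorial)) =
        (M * L ^ (n + 1) / n.factorial) * t ^ n := by
      intro t; rw [mul_pow]; ring
    simp only [this]
    rw [intervalIntegral.integral_const_mul, integral_pow, Nat.factorial_succ, mul_pow]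
    push_cast
    have := Nat.factorial_ne_zero n
    field_simp
    simp

variable [MeasurableSpace E] [BorelSpace E] [CompleteSpace E] [SecondCountableTopology E]

/-- Conditions on a time dependent vector field, merely measurable in time, that make the integral
equation well posed. -/
structure IsCaratheodory (f : unitInterval → E → E) : Prop where
  measurable : Measurable (Function.uncurry f)
  lipschitz : ∀ R : ℝ, ∃ L : ℝ, ∀ s x y, ‖x‖ ≤ R → ‖y‖ ≤ R → ‖f s x - f s y‖ ≤ L * ‖x - y‖
  growth : ∃ A : ℝ, ∀ s x, ‖f s x‖ ≤ A * (1 + ‖x‖)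

namespace IsCaratheodory

variable {f : unitInterval → E → E}

theorem integrable_comp (hf : IsCaratheodory f) (x : C(unitInterval, E)) :
    Integrable fun r => f r (x r) := by
  obtain ⟨A, hA⟩ := hf.growth
  have hm : Measurable fun r => f r (x r) :=
    hf.measurable.comp (measurable_id.prodMk x.continuous.measurable)
  refine Integrable.mono' (g := fun r => A * (1 + ‖x r‖)) ?_ hm.aestronglyMeasurable
    (ae_of_all _ fun r => hA r (x r))
  exact Continuous.integrable_of_hasCompactSupport (by fun_prop) (.of_compactSpace _)

/-- The Picard map. -/
noncomputable def picard (hf : IsCaratheodory f) (x₀ : E) (x : C(unitInterval, E)) :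
    C(unitInterval, E) where
  toFun s := x₀ + ∫ r in Set.Iic s, f r (x r)
  continuous_toFun := continuous_const.add (continuous_setIntegral_Iic (hf.integrable_comp x))

theorem norm_picard_sub_le (hf : IsCaratheodory f) (x₀ : E) {R L : ℝ}
    (hL : ∀ s x y, ‖x‖ ≤ R → ‖y‖ ≤ R → ‖f s x - f s y‖ ≤ L * ‖x - y‖)
    {x y : C(unitInterval, E)} (hx : ∀ s, ‖x s‖ ≤ R) (hy : ∀ s, ‖y s‖ ≤ R) (s : unitInterval) :
    ‖hf.picard x₀ x s - hf.picard x₀ y s‖ ≤ ∫ r in Set.Iic s, L * ‖x r - y r‖ := by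
  simp only [picard, ContinuousMap.coe_mk, add_sub_add_left_eq_sub]
  rw [← integral_sub (hf.integrable_comp x).integrableOn (hf.integrable_comp y).integrableOn]
  refine norm_integral_le_of_norm_le ?_ (ae_of_all _ fun r => hL r _ _ (hx r) (hy r))
  exact (Continuous.integrable_of_hasCompactSupport (by fun_prop) (.of_compactSpace _)).integrableOn

theorem eq_of_solves (hf : IsCaratheodory f) {x₀ : E} {x y : C(unitInterval, E)}
    (hx : hf.picard x₀ x = x) (hy : hf.picard x₀ y = y) : x = y := by
  obtain ⟨L, hL⟩ := hf.lipschitz (max ‖x‖ ‖y‖)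
  have hL' : ∀ s u v, ‖u‖ ≤ max ‖x‖ ‖y‖ → ‖v‖ ≤ max ‖x‖ ‖y‖ →
      ‖f s u - f s v‖ ≤ |L| * ‖u - v‖ := fun s u v hu hv =>
    (hL s u v hu hv).trans (by gcongr; exact le_abs_self L)
  have hb := iterate_bound (d := fun _ s => ‖x s - y s‖) (M := ‖x - y‖) (fun _ => by fun_prop)
    (abs_nonneg L) (fun s => (x - y).norm_coe_le_norm s) (fun _ s => by
      have := hf.norm_picard_sub_le x₀ hL'
        (fun s => (x.norm_coe_le_norm s).trans (le_max_left _ _))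
        (fun s => (y.norm_coe_le_norm s).trans (le_max_right _ _)) s
      rwa [hx, hy] at this)
  ext s
  have h0 := (FloorSemiring.tendsto_pow_div_factorial_atTop (|L| * (s : ℝ))).const_mul ‖x - y‖
  rw [mul_zero] at h0
  have := ge_of_tendsto' h0 fun n => hb n s
  exact sub_eq_zero.1 (norm_le_zero_iff.1 this)

/-- Picard's theorem for integral equations: the iterates of the Picard map contract on the set of
paths below the a priori bound `(1 + ‖x₀‖) exp (A s) - 1`. -/
theorem exists_solves (hf : IsCaratheodory f) (x₀ : E) : ∃ x, hf.picard x₀ x = x := by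
  obtain ⟨A', hA'⟩ := hf.growth
  obtain ⟨A, hA0, hA⟩ : ∃ A : ℝ, 0 ≤ A ∧ ∀ s x, ‖f s x‖ ≤ A * (1 + ‖x‖) :=
    ⟨|A'|, abs_nonneg _, fun s x => (hA' s x).trans (by gcongr; exact le_abs_self A')⟩
  set φ : ℝ → ℝ := fun t => (1 + ‖x₀‖) * Real.exp (A * t) - 1 with hφ
  have hφint : ∀ s : unitInterval, ∫ r in Set.Iic s, A * (1 + φ r) = φ s - ‖x₀‖ := by
    intro s
    rw [setIntegral_Iic_eq fun t => A * (1 + φ t),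
      intervalIntegral.integral_eq_sub_of_hasDerivAt (f := φ)]
    · simp [hφ]
    · intro t _
      have := (((hasDerivAt_id t).const_mul A).exp.const_mul (1 + ‖x₀‖)).sub_const 1
      refine this.congr_deriv ?_
      simp [hφ]; ring
    · exact Continuous.intervalIntegrable (by fun_prop) _ _
  let S : Set C(unitInterval, E) := {x | ∀ s, ‖x s‖ ≤ φ s}
  have hSc : IsClosed S := by
    simp only [S, Set.ofPred_forall]
    exact isClosed_iInter fun s => isClosed_le (by fun_prop) continuous_const
  have hST : ∀ x ∈ S, hf.picard x₀ x ∈ S := by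
    intro x hx s
    have h1 : ‖∫ r in Set.Iic s, f r (x r)‖ ≤ ∫ r in Set.Iic s, A * (1 + φ r) := by
      refine norm_integral_le_of_norm_le ?_ (ae_of_all _ fun r => (hA r (x r)).trans ?_)
      · exact (Continuous.integrable_of_hasCompactSupport (by fun_prop)
          (.of_compactSpace _)).integrableOn
      · have := hx r
        gcongr
    rw [hφint] at h1
    refine (norm_add_le _ _).trans ?_
    linarith
  have hne : (0 : C(unitInterval, E)) ∈ S := by
    intro s
    have h1 : 1 ≤ Real.exp (A * s) := Real.one_le_exp (mul_nonneg hA0 s.2.1)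
    have h2 := norm_nonneg x₀
    simp only [ContinuousMap.zero_apply, norm_zero, hφ]
    nlinarith
  obtain ⟨L', hL'⟩ := hf.lipschitz (φ 1)
  have hL : ∀ s u v, ‖u‖ ≤ φ 1 → ‖v‖ ≤ φ 1 → ‖f s u - f s v‖ ≤ |L'| * ‖u - v‖ := fun s u v hu hv =>
    (hL' s u v hu hv).trans (by gcongr; exact le_abs_self L')
  have hSR : ∀ x ∈ S, ∀ s, ‖x s‖ ≤ φ 1 := fun x hx s => (hx s).trans (by
    simp only [hφ]
    have := s.2.2
    gcongr)
  let T : S → S := fun x => ⟨hf.picard x₀ x, hST x x.2⟩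
  have hT : ∀ (x y : S) (n : ℕ), dist (T^[n] x) (T^[n] y) ≤ |L'| ^ n / n.factorial * dist x y := by
    intro x y n
    rw [Subtype.dist_eq, ContinuousMap.dist_le (by positivity)]
    intro s
    have hb := iterate_bound (d := fun n s => ‖(T^[n] x).1 s - (T^[n] y).1 s‖)
      (M := ‖(x : C(unitInterval, E)) - y‖) (fun _ => by fun_prop)
      (abs_nonneg L') (fun s => (x.1 - y.1).norm_coe_le_norm s) (fun n s => by
        simp only [Function.iterate_succ_apply']
        exact hf.norm_picard_sub_le x₀ hL (hSR _ (T^[n] x).2) (hSR _ (T^[n] y).2) s) n s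
    rw [dist_eq_norm, Subtype.dist_eq, dist_eq_norm, mul_comm]
    refine hb.trans ?_
    have h1 := s.2.1
    have h2 := s.2.2
    gcongr
    exact mul_le_of_le_one_right (abs_nonneg _) h2
  obtain ⟨n, hn⟩ := (FloorSemiring.tendsto_pow_div_factorial_atTop |L'|).eventually
    (gt_mem_nhds zero_lt_one) |>.exists
  have hcon : ContractingWith ⟨|L'| ^ n / n.factorial, by positivity⟩ T^[n] :=
    ⟨by exact_mod_cast hn, LipschitzWith.of_dist_le_mul fun x y => hT x y n⟩
  have : CompleteSpace S := hSc.completeSpace_coe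
  have : Nonempty S := ⟨⟨0, hne⟩⟩
  exact ⟨_, congrArg Subtype.val hcon.isFixedPt_fixedPoint_iterate⟩

theorem existsUnique_forward (hf : IsCaratheodory f) (x₀ : E) :
    ∃! x : C(unitInterval, E), ∀ s, x s = x₀ + ∫ r in Set.Iic s, f r (x r) := by
  have key : ∀ x : C(unitInterval, E), (∀ s, x s = x₀ + ∫ r in Set.Iic s, f r (x r)) ↔
      hf.picard x₀ x = x := fun x => ⟨fun h => by ext s; exact (h s).symm, fun h s =>
    (congrArg (fun y : C(unitInterval, E) => y s) h).symm⟩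
  obtain ⟨x, hx⟩ := hf.exists_solves x₀
  exact ⟨x, (key x).2 hx, fun y hy => hf.eq_of_solves ((key y).1 hy) hx⟩

/-- The backward equation is the forward one after the time change `s ↦ 1 - s`. -/
theorem existsUnique_backward (hf : IsCaratheodory f) (x₁ : E) :
    ∃! x : C(unitInterval, E), ∀ s, x s = x₁ - ∫ r in Set.Ici s, f r (x r) := by
  let σ : C(unitInterval, unitInterval) := ⟨unitInterval.symm, unitInterval.continuous_symm⟩
  have hσσ : ∀ x : C(unitInterval, E), (x.comp σ).comp σ = x := fun x => by ext s; simp [σ]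
  have hf' : IsCaratheodory fun r x => -f (unitInterval.symm r) x := by
    refine ⟨?_, fun R => ?_, ?_⟩
    · exact (hf.measurable.comp ((unitInterval.measurable_symm.comp measurable_fst).prodMk
        measurable_snd)).neg
    · obtain ⟨L, hL⟩ := hf.lipschitz R
      refine ⟨L, fun s x y hx hy => ?_⟩
      rw [neg_sub_neg, norm_sub_rev]
      exact hL _ x y hx hy
    · obtain ⟨A, hA⟩ := hf.growth
      exact ⟨A, fun s x => by rw [norm_neg]; exact hA _ x⟩
  have key : ∀ x : C(unitInterval, E), (∀ s, x s = x₁ - ∫ r in Set.Ici s, f r (x r)) ↔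
      ∀ s, x.comp σ s = x₁ + ∫ r in Set.Iic s, -f (unitInterval.symm r) (x.comp σ r) := by
    intro x
    rw [unitInterval.symmMeasurableEquiv.toEquiv.forall_congr_left]
    refine forall_congr' fun s => ?_
    rw [setIntegral_Ici_eq, integral_neg, ← sub_eq_add_neg]
    simp [σ]
  obtain ⟨x, hx, hu⟩ := hf'.existsUnique_forward x₁
  refine ⟨x.comp σ, (key _).2 (by rwa [hσσ]), fun y hy => ?_⟩
  rw [← hu _ ((key y).1 hy), hσσ]

end IsCaratheodory

end Carath

/-! ### Causality, averages over the noise, and the vector fields -/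

section Causality

variable {K : ℕ} {ρ : ℝ → ℝ} {ηu ηv : ℝ}

/-- Two data agree below the level `k`. Second moments are only compared for pairs `j < i < k`,
the pairs that enter the coefficients of levels below `k`. -/
def AgreeBelow (k : Fin K) (q q' : Par K) : Prop :=
  ∀ i < k, (∀ j < i, q.1 i j = q'.1 i j ∧ q.2.1 i j = q'.2.1 i j) ∧
    q.2.2 (Sum.inl i) = q'.2.2 (Sum.inl i) ∧ q.2.2 (Sum.inr i) = q'.2.2 (Sum.inr i)

theorem cP_congr_of {k : Fin K} {q q' : Par K}
    (h : ∀ i < k, cF ρ ηu ηv i q = cF ρ ηu ηv i q')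
    (hA : ∀ j < k, q.1 k j = q'.1 k j) (hz : q.2.2 (Sum.inl k) = q'.2.2 (Sum.inl k)) :
    cP ρ ηu ηv k q = cP ρ ηu ηv k q' := by
  rw [cP, cP, hz]
  congr 1
  refine Finset.sum_congr rfl fun i hi => ?_
  have hi' : i < k := by simpa using hi
  rw [h i hi', hA i hi']

theorem cQ_congr_of {k : Fin K} {q q' : Par K}
    (h : ∀ i < k, cG ρ ηu ηv i q = cG ρ ηu ηv i q')
    (hB : ∀ j < k, q.2.1 k j = q'.2.1 k j) (hz : q.2.2 (Sum.inr k) = q'.2.2 (Sum.inr k)) :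
    cQ ρ ηu ηv k q = cQ ρ ηu ηv k q' := by
  rw [cQ, cQ, hz]
  congr 1
  refine Finset.sum_congr rfl fun i hi => ?_
  have hi' : i < k := by simpa using hi
  rw [h i hi', hB i hi']

/-- The coefficients of levels below `k` only depend on the data below level `k`. -/
theorem AgreeBelow.coef {k : Fin K} {q q' : Par K} (h : AgreeBelow k q q') (i : Fin K)
    (hi : i < k) : cF ρ ηu ηv i q = cF ρ ηu ηv i q' ∧ cG ρ ηu ηv i q = cG ρ ηu ηv i q' := by
  induction i using WellFoundedLT.induction with
  | ind i ih =>
    have hp := cP_congr_of (ρ := ρ) (ηu := ηu) (ηv := ηv) (k := i) (q := q) (q' := q')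
      (fun j hj => (ih j hj (hj.trans hi)).1) (fun j hj => ((h i hi).1 j hj).1) (h i hi).2.1
    have hq := cQ_congr_of (ρ := ρ) (ηu := ηu) (ηv := ηv) (k := i) (q := q) (q' := q')
      (fun j hj => (ih j hj (hj.trans hi)).2) (fun j hj => ((h i hi).1 j hj).2) (h i hi).2.2
    rw [cF_eq, cF_eq, cG_eq, cG_eq, hp, hq]
    exact ⟨rfl, rfl⟩

theorem AgreeBelow.dcoef (hρ : Differentiable ℝ ρ) (hρ' : Differentiable ℝ (deriv ρ))
    {k : Fin K} {q q' : Par K} (h : AgreeBelow k q q') (l : Fin K ⊕ Fin K) (i : Fin K)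
    (hi : i < k) :
    dF ρ ηu ηv l i q = dF ρ ηu ηv l i q' ∧ dG ρ ηu ηv l i q = dG ρ ηu ηv l i q' := by
  induction i using WellFoundedLT.induction with
  | ind i ih =>
    have hp := cP_congr_of (ρ := ρ) (ηu := ηu) (ηv := ηv) (k := i) (q := q) (q' := q')
      (fun j hj => (h.coef j (hj.trans hi)).1) (fun j hj => ((h i hi).1 j hj).1) (h i hi).2.1
    have hq := cQ_congr_of (ρ := ρ) (ηu := ηu) (ηv := ηv) (k := i) (q := q) (q' := q')
      (fun j hj => (h.coef j (hj.trans hi)).2) (fun j hj => ((h i hi).1 j hj).2) (h i hi).2.2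
    have hs1 : ∑ j ∈ Finset.Iio i, q.1 i j * dF ρ ηu ηv l j q =
        ∑ j ∈ Finset.Iio i, q'.1 i j * dF ρ ηu ηv l j q' := by
      refine Finset.sum_congr rfl fun j hj => ?_
      have hj' : j < i := by simpa using hj
      rw [(ih j hj' (hj'.trans hi)).1, ((h i hi).1 j hj').1]
    have hs2 : ∑ j ∈ Finset.Iio i, q.2.1 i j * dG ρ ηu ηv l j q =
        ∑ j ∈ Finset.Iio i, q'.2.1 i j * dG ρ ηu ηv l j q' := by
      refine Finset.sum_congr rfl fun j hj => ?_
      have hj' : j < i := by simpa using hj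
      rw [(ih j hj' (hj'.trans hi)).2, ((h i hi).1 j hj').2]
    rw [dF_eq hρ hρ', dF_eq hρ hρ', dG_eq hρ hρ', dG_eq hρ hρ', hp, hq, hs1, hs2]
    exact ⟨rfl, rfl⟩

end Causality

section TamePar

theorem Tame.mono {E : Type*} [NormedAddCommGroup E] [MeasurableSpace E] {f g : E → ℝ}
    (hg : Tame g) (hf : Measurable f) (h : ∀ x, |f x| ≤ |g x|) : Tame f := by
  obtain ⟨C, m, hC, hb⟩ := hg.growth
  exact ⟨hf, C, m, hC, fun x => (h x).trans (hb x)⟩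

theorem Tame.abs {E : Type*} [NormedAddCommGroup E] [MeasurableSpace E] {f : E → ℝ}
    (hf : Tame f) : Tame fun x => |f x| :=
  hf.mono hf.measurable.norm fun x => by simp

/-- A tame function of data whose coordinates are tame is tame. -/
theorem Tame.comp_coord {K : ℕ} {E : Type*} [NormedAddCommGroup E] [MeasurableSpace E]
    {f : Par K → ℝ} (hf : Tame f) {g : E → Par K} (h1 : ∀ i j, Tame fun x => (g x).1 i j)
    (h2 : ∀ i j, Tame fun x => (g x).2.1 i j) (h3 : ∀ l, Tame fun x => (g x).2.2 l) :
    Tame fun x => f (g x) := by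
  have hm3 : Measurable fun x => (g x).2.2 := by
    have : Measurable fun x => WithLp.toLp 2 fun l => (g x).2.2 l :=
      (WithLp.measurable_toLp 2 _).comp (measurable_pi_lambda _ fun l => (h3 l).measurable)
    exact this
  have hm : Measurable g := by
    refine Measurable.prodMk (measurable_pi_lambda _ fun i => measurable_pi_lambda _ fun j =>
      (h1 i j).measurable) (Measurable.prodMk (measurable_pi_lambda _ fun i =>
      measurable_pi_lambda _ fun j => (h2 i j).measurable) hm3)
  refine hf.comp hm ?_
  have ht : Tame fun x => (∑ i, ∑ j, |(g x).1 i j|) + ((∑ i, ∑ j, |(g x).2.1 i j|) +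
      ∑ l, |(g x).2.2 l|) :=
    (Tame.sum _ fun i _ => Tame.sum _ fun j _ => (h1 i j).abs).add
      ((Tame.sum _ fun i _ => Tame.sum _ fun j _ => (h2 i j).abs).add
        (Tame.sum _ fun l _ => (h3 l).abs))
  have hpi : ∀ A : Fin K → Fin K → ℝ, ‖A‖ ≤ ∑ i, ∑ j, |A i j| := by
    intro A
    refine (pi_norm_le_iff_of_nonneg (by positivity)).2 fun i =>
      (pi_norm_le_iff_of_nonneg (by positivity)).2 fun j => ?_
    exact (Finset.single_le_sum (f := fun j => |A i j|) (fun _ _ => abs_nonneg _)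
      (Finset.mem_univ j)).trans (Finset.single_le_sum (f := fun i => ∑ j, |A i j|)
      (fun _ _ => by positivity) (Finset.mem_univ i))
  have hz : ∀ z : State K, ‖z‖ ≤ ∑ l, |z l| := by
    intro z
    rw [EuclideanSpace.norm_eq]
    refine Real.sqrt_le_iff.2 ⟨by positivity, ?_⟩
    simpa using Finset.sum_sq_le_sq_sum_of_nonneg (s := Finset.univ) (f := fun l => |z l|)
      (fun _ _ => abs_nonneg _)
  refine ht.mono hm.norm fun x => ?_
  have e1 := hpi (g x).1
  have e2 := hpi (g x).2.1
  have e3 := hz (g x).2.2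
  have p1 := norm_nonneg (g x).1
  have p2 := norm_nonneg (g x).2.1
  have p3 := norm_nonneg (g x).2.2
  rw [abs_norm, Prod.norm_def, Prod.norm_def]
  refine le_trans ?_ (le_abs_self _)
  refine max_le (by linarith) (max_le (by linarith) (by linarith))

end TamePar

section Closed

variable {K : ℕ} {V : Type*} [NormedAddCommGroup V] [InnerProductSpace ℝ V] [MeasurableSpace V]
  [BorelSpace V] [CompleteSpace V] [SecondCountableTopology V]
  (ν : Measure V)

/-- The covariance form of a centered measure. -/
noncomputable def gram (v w : V) : ℝ := ∫ n, inner ℝ v n * inner ℝ w n ∂ν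

/-- The data determined by a configuration `v` of vectors and a pair `n` of noise vectors: the
second moments of the variables `⟨v l, ·⟩`, and the value `z` of the Gaussian field. The forward
coordinates of `z` use the first noise vector and the backward ones the second, so that they are
independent when `n` is distributed as `ν ⊗ ν`. -/
noncomputable def vpar (σu σv : ℝ) (v : Fin K ⊕ Fin K → V) (n : V × V) : Par K :=
  (fun i j => gram ν (v (Sum.inl i)) (v (Sum.inl j)),
    fun i j => gram ν (v (Sum.inr i)) (v (Sum.inr j)),
    WithLp.toLp 2 (Sum.elim (fun i => σu * inner ℝ (v (Sum.inl i)) n.1)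
      (fun i => σv * inner ℝ (v (Sum.inr i)) n.2)))

/-- The average of a function of the data over a pair of independent noise vectors of law `ν`. -/
noncomputable def avg (σu σv : ℝ) (f : Par K → ℝ) (v : Fin K ⊕ Fin K → V) : ℝ :=
  ∫ n, f (vpar ν σu σv v n) ∂(ν.prod ν)

variable {ν} [IsGaussian ν]

theorem integrable_inner_mul (v w : V) : Integrable (fun n => inner ℝ v n * inner ℝ w n) ν := by
  have h : ∀ v : V, MemLp (fun n => (inner ℝ v n : ℝ)) 2 ν := fun v =>
    IsGaussian.memLp_dual ν (innerSL ℝ v) 2 (by simp)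
  exact (h v).integrable_mul (h w)

theorem gram_linear (w : V) : IsLinearMap ℝ fun v => gram ν v w where
  map_add v v' := by
    simp only [gram, inner_add_left, add_mul]
    exact integral_add (integrable_inner_mul v w) (integrable_inner_mul v' w)
  map_smul c v := by
    simp only [gram, real_inner_smul_left, mul_assoc, smul_eq_mul]
    exact integral_const_mul _ _

theorem tame_inner {E : Type*} [NormedAddCommGroup E] [MeasurableSpace E] {f g : E → V}
    (hf : Measurable f) (hg : Measurable g) (hf' : Tame fun x => ‖f x‖)
    (hg' : Tame fun x => ‖g x‖) : Tame fun x => (inner ℝ (f x) (g x) : ℝ) :=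
  (hf'.mul hg').mono (hf.inner hg) fun x => by
    rw [abs_mul, abs_norm, abs_norm]; exact abs_real_inner_le_norm _ _

theorem tame_norm_coord {E' : Type*} [NormedAddCommGroup E'] [MeasurableSpace E']
    (l : Fin K ⊕ Fin K) : Tame fun x : (Fin K ⊕ Fin K → V) × E' => ‖x.1 l‖ :=
  .of_norm_le (C := 1) (by fun_prop) fun x => by
    rw [one_mul, abs_norm]
    exact (norm_le_pi_norm x.1 l).trans (norm_fst_le x)

theorem tame_gram (l l' : Fin K ⊕ Fin K) :
    Tame fun v : Fin K ⊕ Fin K → V => gram ν (v l) (v l') := by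
  have hn : Tame fun x : (Fin K ⊕ Fin K → V) × V => ‖x.2‖ :=
    .of_norm_le (C := 1) (by fun_prop) fun x => by
      rw [one_mul, abs_norm]; exact norm_snd_le x
  have h : ∀ l : Fin K ⊕ Fin K,
      Tame fun x : (Fin K ⊕ Fin K → V) × V => (inner ℝ (x.1 l) x.2 : ℝ) := fun l =>
    tame_inner (by fun_prop) (by fun_prop) (tame_norm_coord l) hn
  exact ((h l).mul (h l')).integral_right ν

theorem Tame.comp_vpar {f : Par K → ℝ} (hf : Tame f) (σu σv : ℝ) :
    Tame fun x : (Fin K ⊕ Fin K → V) × (V × V) => f (vpar ν σu σv x.1 x.2) := by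
  have hfst : Tame fun x : (Fin K ⊕ Fin K → V) × (V × V) => ‖x.1‖ :=
    .of_norm_le (C := 1) (by fun_prop) fun x => by
      rw [one_mul, abs_norm]; exact norm_fst_le x
  have hg : ∀ l l' : Fin K ⊕ Fin K, Tame fun x : (Fin K ⊕ Fin K → V) × (V × V) =>
      gram ν (x.1 l) (x.1 l') := fun l l' => (tame_gram l l').comp measurable_fst hfst
  refine hf.comp_coord (fun i j => hg _ _) (fun i j => hg _ _) ?_
  rintro (l | l)
  · refine (Tame.const σu).mul (tame_inner (by fun_prop) (by fun_prop) (tame_norm_coord _) ?_)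
    exact .of_norm_le (C := 1) (by fun_prop) fun x => by
      rw [one_mul, abs_norm]; exact (norm_fst_le x.2).trans (norm_snd_le x)
  · refine (Tame.const σv).mul (tame_inner (by fun_prop) (by fun_prop) (tame_norm_coord _) ?_)
    exact .of_norm_le (C := 1) (by fun_prop) fun x => by
      rw [one_mul, abs_norm]; exact (norm_snd_le x.2).trans (norm_snd_le x)

theorem Tame.avg {f : Par K → ℝ} (hf : Tame f) (σu σv : ℝ) :
    Tame (avg ν σu σv f : (Fin K ⊕ Fin K → V) → ℝ) :=
  (hf.comp_vpar σu σv).integral_right _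

theorem Tame.integrable_vpar {f : Par K → ℝ} (hf : Tame f) (σu σv : ℝ) (v : Fin K ⊕ Fin K → V) :
    Integrable (fun n => f (vpar ν σu σv v n)) (ν.prod ν) := by
  obtain ⟨C, m, hC, hb⟩ := (hf.comp_vpar (ν := ν) σu σv).exists_bound ‖v‖
  exact ((Tame.integrable_one_add_norm_pow (ν.prod ν) m).const_mul C).mono'
    ((hf.comp_vpar (ν := ν) σu σv).measurable.comp measurable_prodMk_left).aestronglyMeasurable
    (ae_of_all _ fun n => hb v n le_rfl)

/-- A tame function that is linear in one slot is bounded by a multiple of the norm of that slot,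
uniformly for the other slots in a bounded set. -/
theorem linear_bound {E' : Type*} [NormedAddCommGroup E'] [MeasurableSpace E']
    {g : (Fin K ⊕ Fin K → V) → E' → ℝ} (hg : Tame fun x : (Fin K ⊕ Fin K → V) × E' => g x.1 x.2)
    (a : Fin K ⊕ Fin K) (hlin : ∀ u n, IsLinearMap ℝ fun h => g (Function.update u a h) n) (R : ℝ) :
    ∃ C : ℝ, ∃ m : ℕ, 0 ≤ C ∧ ∀ u, ‖u‖ ≤ R → ∀ h n,
      |g (Function.update u a h) n| ≤ C * (1 + ‖n‖) ^ m * ‖h‖ := by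
  -- By homogeneity it suffices to bound `g` where the slot holds a unit vector.
  obtain ⟨C, m, hC, hb⟩ := hg.exists_bound (max R 1)
  refine ⟨C, m, hC, fun u hu h n => ?_⟩
  rcases eq_or_ne h 0 with rfl | hh
  · simp [(hlin u n).map_zero]
  have hh' : 0 < ‖h‖ := norm_pos_iff.2 hh
  have h1 : g (Function.update u a h) n = ‖h‖ * g (Function.update u a (‖h‖⁻¹ • h)) n := by
    have := (hlin u n).map_smul ‖h‖ (‖h‖⁻¹ • h)
    rw [smul_smul, mul_inv_cancel₀ hh'.ne', one_smul] at this
    simpa using this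
  have h2 : ‖Function.update u a (‖h‖⁻¹ • h)‖ ≤ max R 1 := by
    refine (pi_norm_le_iff_of_nonneg (le_max_of_le_right zero_le_one)).2 fun l => ?_
    rcases eq_or_ne l a with rfl | hl
    · rw [Function.update_self, norm_smul, norm_inv, norm_norm, inv_mul_cancel₀ hh'.ne']
      exact le_max_right _ _
    · rw [Function.update_of_ne hl]
      exact ((norm_le_pi_norm u l).trans hu).trans (le_max_left _ _)
  rw [h1, abs_mul, abs_norm, mul_comm]
  gcongr
  exact hb _ n h2

omit [CompleteSpace V] [SecondCountableTopology V] [BorelSpace V] [IsGaussian ν] in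
theorem agreeBelow_vpar {σu σv : ℝ} {k : Fin K} {u u' : Fin K ⊕ Fin K → V}
    (h : ∀ i < k, u (Sum.inl i) = u' (Sum.inl i) ∧ u (Sum.inr i) = u' (Sum.inr i)) (n : V × V) :
    AgreeBelow k (vpar ν σu σv u n) (vpar ν σu σv u' n) := by
  intro i hi
  simp only [vpar, Sum.elim_inl, Sum.elim_inr, (h i hi).1, (h i hi).2, and_true]
  intro j hj
  rw [(h j (hj.trans hi)).1, (h j (hj.trans hi)).2]
  exact ⟨rfl, rfl⟩

variable {ρ : ℝ → ℝ} {ηu ηv σu σv : ℝ} {Cρ : ℝ}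

section Congr

variable {k : Fin K} {u u' : Fin K ⊕ Fin K → V}

omit [CompleteSpace V] [SecondCountableTopology V] [BorelSpace V] [IsGaussian ν] in
theorem cP_vpar_congr
    (h : ∀ i < k, u (Sum.inl i) = u' (Sum.inl i) ∧ u (Sum.inr i) = u' (Sum.inr i))
    (hk : u (Sum.inl k) = u' (Sum.inl k)) (n : V × V) :
    cP ρ ηu ηv k (vpar ν σu σv u n) = cP ρ ηu ηv k (vpar ν σu σv u' n) :=
  cP_congr_of (fun i hi => ((agreeBelow_vpar h n).coef i hi).1)
    (fun j hj => by simp only [vpar, hk, (h j hj).1]) (by simp only [vpar, Sum.elim_inl, hk])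

omit [CompleteSpace V] [SecondCountableTopology V] [BorelSpace V] [IsGaussian ν] in
theorem cQ_vpar_congr
    (h : ∀ i < k, u (Sum.inl i) = u' (Sum.inl i) ∧ u (Sum.inr i) = u' (Sum.inr i))
    (hk : u (Sum.inr k) = u' (Sum.inr k)) (n : V × V) :
    cQ ρ ηu ηv k (vpar ν σu σv u n) = cQ ρ ηu ηv k (vpar ν σu σv u' n) :=
  cQ_congr_of (fun i hi => ((agreeBelow_vpar h n).coef i hi).2)
    (fun j hj => by simp only [vpar, hk, (h j hj).2]) (by simp only [vpar, Sum.elim_inr, hk])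

omit [CompleteSpace V] [SecondCountableTopology V] [BorelSpace V] [IsGaussian ν] in
theorem rF_vpar_congr (hρ : Differentiable ℝ ρ) (hρ' : Differentiable ℝ (deriv ρ))
    (h : ∀ i < k, u (Sum.inl i) = u' (Sum.inl i) ∧ u (Sum.inr i) = u' (Sum.inr i))
    (hk : u (Sum.inl k) = u' (Sum.inl k)) (l : Fin K ⊕ Fin K) (n : V × V) :
    rF ρ ηu ηv l k (vpar ν σu σv u n) = rF ρ ηu ηv l k (vpar ν σu σv u' n) := by
  refine Finset.sum_congr rfl fun j hj => ?_
  have hj' : j < k := by simpa using hj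
  rw [((agreeBelow_vpar h n).dcoef hρ hρ' l j hj').1]
  simp only [vpar, hk, (h j hj').1]

omit [CompleteSpace V] [SecondCountableTopology V] [BorelSpace V] [IsGaussian ν] in
theorem rG_vpar_congr (hρ : Differentiable ℝ ρ) (hρ' : Differentiable ℝ (deriv ρ))
    (h : ∀ i < k, u (Sum.inl i) = u' (Sum.inl i) ∧ u (Sum.inr i) = u' (Sum.inr i))
    (hk : u (Sum.inr k) = u' (Sum.inr k)) (l : Fin K ⊕ Fin K) (n : V × V) :
    rG ρ ηu ηv l k (vpar ν σu σv u n) = rG ρ ηu ηv l k (vpar ν σu σv u' n) := by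
  refine Finset.sum_congr rfl fun j hj => ?_
  have hj' : j < k := by simpa using hj
  rw [((agreeBelow_vpar h n).dcoef hρ hρ' l j hj').2]
  simp only [vpar, hk, (h j hj').2]

end Congr

/-- Updating the slots of level `k` does not change lower levels. -/
theorem update_below {W : Type*} (u : Fin K ⊕ Fin K → W) {k : Fin K} {a : Fin K ⊕ Fin K} (h : W)
    (ha : a = Sum.inl k ∨ a = Sum.inr k) (i : Fin K) (hi : i < k) :
    Function.update u a h (Sum.inl i) = u (Sum.inl i) ∧
      Function.update u a h (Sum.inr i) = u (Sum.inr i) := by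
  rcases ha with rfl | rfl <;> simp [Function.update, hi.ne]

theorem sum_gram_linear (s : Finset (Fin K)) (w : Fin K → V) (c : Fin K → ℝ) :
    IsLinearMap ℝ fun h => ∑ i ∈ s, gram ν h (w i) * c i where
  map_add h h' := by simp only [(gram_linear _).map_add, add_mul, Finset.sum_add_distrib]
  map_smul a h := by
    simp only [(gram_linear _).map_smul, smul_eq_mul, Finset.mul_sum, mul_assoc]

omit [MeasurableSpace V] [BorelSpace V] [CompleteSpace V] [SecondCountableTopology V] in
theorem inner_linear (c : ℝ) (n : V) : IsLinearMap ℝ fun h : V => c * inner ℝ h n where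
  map_add h h' := by simp only [inner_add_left, mul_add]
  map_smul a h := by simp only [real_inner_smul_left, smul_eq_mul]; ring

theorem cP_linear (k : Fin K) (u : Fin K ⊕ Fin K → V) (n : V × V) :
    IsLinearMap ℝ fun h => cP ρ ηu ηv k (vpar ν σu σv (Function.update u (Sum.inl k) h) n) := by
  have : ∀ h, cP ρ ηu ηv k (vpar ν σu σv (Function.update u (Sum.inl k) h) n) =
      σu * inner ℝ h n.1 + ∑ i ∈ Finset.Iio k,
        gram ν h (u (Sum.inl i)) * cF ρ ηu ηv i (vpar ν σu σv u n) := by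
    intro h
    rw [cP]
    congr 1
    · simp [vpar]
    · refine Finset.sum_congr rfl fun i hi => ?_
      have hi' : i < k := by simpa using hi
      rw [((agreeBelow_vpar (update_below u h (.inl rfl)) n).coef i hi').1]
      simp [vpar, hi'.ne]
  simp only [this]
  exact ((inner_linear _ _).mk' _ + (sum_gram_linear _ _ _).mk' _).isLinear

theorem cQ_linear (k : Fin K) (u : Fin K ⊕ Fin K → V) (n : V × V) :
    IsLinearMap ℝ fun h => cQ ρ ηu ηv k (vpar ν σu σv (Function.update u (Sum.inr k) h) n) := by
  have : ∀ h, cQ ρ ηu ηv k (vpar ν σu σv (Function.update u (Sum.inr k) h) n) =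
      σv * inner ℝ h n.2 + ∑ i ∈ Finset.Iio k,
        gram ν h (u (Sum.inr i)) * cG ρ ηu ηv i (vpar ν σu σv u n) := by
    intro h
    rw [cQ]
    congr 1
    · simp [vpar]
    · refine Finset.sum_congr rfl fun i hi => ?_
      have hi' : i < k := by simpa using hi
      rw [((agreeBelow_vpar (update_below u h (.inr rfl)) n).coef i hi').2]
      simp [vpar, hi'.ne]
  simp only [this]
  exact ((inner_linear _ _).mk' _ + (sum_gram_linear _ _ _).mk' _).isLinear

theorem rF_linear (hρ : Differentiable ℝ ρ) (hρ' : Differentiable ℝ (deriv ρ))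
    (l : Fin K ⊕ Fin K) (k : Fin K) (u : Fin K ⊕ Fin K → V) (n : V × V) :
    IsLinearMap ℝ fun h => rF ρ ηu ηv l k (vpar ν σu σv (Function.update u (Sum.inl k) h) n) := by
  have : ∀ h, rF ρ ηu ηv l k (vpar ν σu σv (Function.update u (Sum.inl k) h) n) =
      ∑ i ∈ Finset.Iio k, gram ν h (u (Sum.inl i)) * dF ρ ηu ηv l i (vpar ν σu σv u n) := by
    intro h
    refine Finset.sum_congr rfl fun i hi => ?_
    have hi' : i < k := by simpa using hi
    rw [((agreeBelow_vpar (update_below u h (.inl rfl)) n).dcoef hρ hρ' l i hi').1]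
    simp [vpar, hi'.ne]
  simp only [this]
  exact sum_gram_linear _ _ _

theorem rG_linear (hρ : Differentiable ℝ ρ) (hρ' : Differentiable ℝ (deriv ρ))
    (l : Fin K ⊕ Fin K) (k : Fin K) (u : Fin K ⊕ Fin K → V) (n : V × V) :
    IsLinearMap ℝ fun h => rG ρ ηu ηv l k (vpar ν σu σv (Function.update u (Sum.inr k) h) n) := by
  have : ∀ h, rG ρ ηu ηv l k (vpar ν σu σv (Function.update u (Sum.inr k) h) n) =
      ∑ i ∈ Finset.Iio k, gram ν h (u (Sum.inr i)) * dG ρ ηu ηv l i (vpar ν σu σv u n) := by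
    intro h
    refine Finset.sum_congr rfl fun i hi => ?_
    have hi' : i < k := by simpa using hi
    rw [((agreeBelow_vpar (update_below u h (.inr rfl)) n).dcoef hρ hρ' l i hi').2]
    simp [vpar, hi'.ne]
  simp only [this]
  exact sum_gram_linear _ _ _

theorem coefBH_linear (hρ : Differentiable ℝ ρ) (hρ' : Differentiable ℝ (deriv ρ))
    {k i : Fin K} (hi : i < k) (u : Fin K ⊕ Fin K → V) (n : V × V) :
    IsLinearMap ℝ fun h =>
      coefBH ρ ηu ηv σu k i (vpar ν σu σv (Function.update u (Sum.inr k) h) n) := by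
  have hk : ∀ h, Function.update u (Sum.inr k) h (Sum.inl k) = u (Sum.inl k) := by simp
  have hb := fun h => update_below u (k := k) (a := Sum.inr k) h (.inr rfl)
  simp only [coefBH, cP_vpar_congr (hb _) (hk _), rF_vpar_congr hρ hρ' (hb _) (hk _),
    fun h => ((agreeBelow_vpar (ν := ν) (σu := σu) (σv := σv) (hb h) n).coef
      (ρ := ρ) (ηu := ηu) (ηv := ηv) i hi).1]
  have hq := cQ_linear (ν := ν) (ρ := ρ) (ηu := ηu) (ηv := ηv) (σu := σu) (σv := σv) k u n
  have hr := rG_linear (ν := ν) (ρ := ρ) (ηu := ηu) (ηv := ηv) (σu := σu) (σv := σv)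
    hρ hρ' (Sum.inl i) k u n
  constructor
  · intro h h'
    rw [hq.map_add, hr.map_add]; ring
  · intro c h
    rw [hq.map_smul, hr.map_smul]; simp only [smul_eq_mul]; ring

theorem coefBdiag_linear (k : Fin K) (u : Fin K ⊕ Fin K → V) (n : V × V) :
    IsLinearMap ℝ fun h =>
      coefBdiag ρ ηu ηv σu k (vpar ν σu σv (Function.update u (Sum.inr k) h) n) := by
  have hk : ∀ h, Function.update u (Sum.inr k) h (Sum.inl k) = u (Sum.inl k) := by simp
  have hb := fun h => update_below u (k := k) (a := Sum.inr k) h (.inr rfl)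
  simp only [coefBdiag, cP_vpar_congr (hb _) (hk _)]
  have hq := cQ_linear (ν := ν) (ρ := ρ) (ηu := ηu) (ηv := ηv) (σu := σu) (σv := σv) k u n
  constructor
  · intro h h'
    rw [hq.map_add]; ring
  · intro c h
    rw [hq.map_smul]; simp only [smul_eq_mul]; ring

theorem avg_linear {f : Par K → ℝ} (hf : Tame f) {a : Fin K ⊕ Fin K} {u : Fin K ⊕ Fin K → V}
    (hlin : ∀ n, IsLinearMap ℝ fun h => f (vpar ν σu σv (Function.update u a h) n)) :
    IsLinearMap ℝ fun h => avg ν σu σv f (Function.update u a h) where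
  map_add h h' := by
    simp only [avg, (hlin _).map_add]
    exact integral_add (hf.integrable_vpar _ _ _) (hf.integrable_vpar _ _ _)
  map_smul c h := by
    simp only [avg, (hlin _).map_smul, smul_eq_mul]
    exact integral_const_mul _ _

variable (ν ρ ηu ηv σu σv) in
/-- The right-hand side of the equation for `v (inl k)` in the closed deterministic system. -/
noncomputable def fieldH (k : Fin K) (v : Fin K ⊕ Fin K → V) : V :=
  ∑ i ∈ Finset.Iio k, avg ν σu σv (coefHB ρ ηu ηv σv k i) v • v (Sum.inr i)

variable (ν ρ ηu ηv σu σv) in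
/-- The right-hand side of the equation for `v (inr k)` in the closed deterministic system. -/
noncomputable def fieldB (k : Fin K) (v : Fin K ⊕ Fin K → V) : V :=
  ∑ i ∈ Finset.Iio k, avg ν σu σv (coefBH ρ ηu ηv σu k i) v • v (Sum.inl i) +
    avg ν σu σv (coefBdiag ρ ηu ηv σu k) v • v (Sum.inl k)

section Congr

variable {k : Fin K} {u u' : Fin K ⊕ Fin K → V}

omit [CompleteSpace V] [SecondCountableTopology V] [BorelSpace V] [IsGaussian ν] in
theorem fieldH_congr (hρ : Differentiable ℝ ρ) (hρ' : Differentiable ℝ (deriv ρ))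
    (h : ∀ i < k, u (Sum.inl i) = u' (Sum.inl i) ∧ u (Sum.inr i) = u' (Sum.inr i))
    (hk : u (Sum.inl k) = u' (Sum.inl k)) :
    fieldH ν ρ ηu ηv σu σv k u = fieldH ν ρ ηu ηv σu σv k u' := by
  refine Finset.sum_congr rfl fun i hi => ?_
  have hi' : i < k := by simpa using hi
  rw [(h i hi').2]
  congr 1
  refine integral_congr_ae (ae_of_all _ fun n => ?_)
  simp only [coefHB, cP_vpar_congr h hk, rF_vpar_congr hρ hρ' h hk,
    ((agreeBelow_vpar h n).coef i hi').2]

omit [CompleteSpace V] [SecondCountableTopology V] [BorelSpace V] [IsGaussian ν] in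
theorem fieldB_congr (hρ : Differentiable ℝ ρ) (hρ' : Differentiable ℝ (deriv ρ))
    (h : ∀ i < k, u (Sum.inl i) = u' (Sum.inl i) ∧ u (Sum.inr i) = u' (Sum.inr i))
    (hk : u (Sum.inl k) = u' (Sum.inl k)) (hk' : u (Sum.inr k) = u' (Sum.inr k)) :
    fieldB ν ρ ηu ηv σu σv k u = fieldB ν ρ ηu ηv σu σv k u' := by
  rw [fieldB, fieldB, hk]
  congr 1
  · refine Finset.sum_congr rfl fun i hi => ?_
    have hi' : i < k := by simpa using hi
    rw [(h i hi').1]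
    congr 1
    refine integral_congr_ae (ae_of_all _ fun n => ?_)
    simp only [coefBH, cP_vpar_congr h hk, rF_vpar_congr hρ hρ' h hk, cQ_vpar_congr h hk',
      rG_vpar_congr hρ hρ' h hk', ((agreeBelow_vpar h n).coef i hi').1]
  · congr 1
    refine integral_congr_ae (ae_of_all _ fun n => ?_)
    simp only [coefBdiag, cP_vpar_congr h hk, cQ_vpar_congr h hk']

end Congr

end Closed

/-! ### The closed deterministic system -/

section

variable {E : Type*} [NormedAddCommGroup E] [NormedSpace ℝ E] [MeasurableSpace E] [BorelSpace E]
  [CompleteSpace E] [SecondCountableTopology E]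

namespace IsCaratheodory

theorem add {f g : unitInterval → E → E} (hf : IsCaratheodory f) (hg : IsCaratheodory g) :
    IsCaratheodory fun r x => f r x + g r x where
  measurable := hf.measurable.add hg.measurable
  lipschitz R := by
    obtain ⟨L, hL⟩ := hf.lipschitz R
    obtain ⟨L', hL'⟩ := hg.lipschitz R
    refine ⟨L + L', fun s x y hx hy => ?_⟩
    rw [add_sub_add_comm, add_mul]
    exact (norm_add_le _ _).trans (add_le_add (hL s x y hx hy) (hL' s x y hx hy))
  growth := by
    obtain ⟨A, hA⟩ := hf.growth
    obtain ⟨A', hA'⟩ := hg.growth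
    refine ⟨A + A', fun s x => ?_⟩
    rw [add_mul]
    exact (norm_add_le _ _).trans (add_le_add (hA s x) (hA' s x))

theorem zero : IsCaratheodory fun (_ : unitInterval) (_ : E) => (0 : E) where
  measurable := measurable_const
  lipschitz _ := ⟨0, fun s x y _ _ => by simp⟩
  growth := ⟨0, fun s x => by simp⟩

theorem sum {ι : Type*} (t : Finset ι) {f : ι → unitInterval → E → E}
    (hf : ∀ i ∈ t, IsCaratheodory (f i)) : IsCaratheodory fun r x => ∑ i ∈ t, f i r x := by
  classical
  induction t using Finset.induction_on with
  | empty => simpa using zero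
  | insert i s hi ih =>
    simp only [Finset.sum_insert hi]
    exact (hf i (by simp)).add (ih fun j hj => hf j (by simp [hj]))

theorem smul_path {c : unitInterval → E → ℝ} (hc : Measurable (Function.uncurry c))
    (hlip : ∀ R : ℝ, ∃ L : ℝ, ∀ s x y, ‖x‖ ≤ R → ‖y‖ ≤ R → |c s x - c s y| ≤ L * ‖x - y‖)
    (hgr : ∃ A : ℝ, ∀ s x, |c s x| ≤ A * (1 + ‖x‖)) (w : C(unitInterval, E)) :
    IsCaratheodory fun r x => c r x • w r where
  measurable := hc.smul (w.continuous.measurable.comp measurable_fst)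
  lipschitz R := by
    obtain ⟨L, hL⟩ := hlip R
    refine ⟨L * ‖w‖, fun s x y hx hy => ?_⟩
    rw [← sub_smul, norm_smul, Real.norm_eq_abs, mul_right_comm]
    exact mul_le_mul (hL s x y hx hy) (w.norm_coe_le_norm s) (norm_nonneg _)
      ((abs_nonneg _).trans (hL s x y hx hy))
  growth := by
    obtain ⟨A, hA⟩ := hgr
    refine ⟨A * ‖w‖, fun s x => ?_⟩
    rw [norm_smul, Real.norm_eq_abs, mul_right_comm]
    exact mul_le_mul (hA s x) (w.norm_coe_le_norm s) (norm_nonneg _)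
      ((abs_nonneg _).trans (hA s x))

end IsCaratheodory

theorem Tame.one_add_norm_pow (m : ℕ) : Tame fun x : E => (1 + ‖x‖) ^ m :=
  ⟨by fun_prop, 1, m, zero_le_one, fun x => by rw [one_mul, abs_of_nonneg (by positivity)]⟩

end

section Closed

variable {K : ℕ} {V : Type*} [NormedAddCommGroup V] [InnerProductSpace ℝ V] [MeasurableSpace V]
  [BorelSpace V] [CompleteSpace V] [SecondCountableTopology V]
  {ν : Measure V} [IsGaussian ν] {ρ : ℝ → ℝ} {ηu ηv σu σv : ℝ} {Cρ : ℝ}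

theorem measurable_update_path (v : Fin K ⊕ Fin K → C(unitInterval, V)) (a : Fin K ⊕ Fin K) :
    Measurable fun p : unitInterval × V => Function.update (fun l => v l p.1) a p.2 := by
  refine measurable_pi_lambda _ fun l => ?_
  rcases eq_or_ne l a with rfl | hl
  · simpa using measurable_snd
  · simp only [Function.update_of_ne hl]
    exact (v l).continuous.measurable.comp measurable_fst

theorem norm_path_le (v : Fin K ⊕ Fin K → C(unitInterval, V)) (r : unitInterval) :
    ‖fun l => v l r‖ ≤ ‖v‖ :=
  (pi_norm_le_iff_of_nonneg (norm_nonneg _)).2 fun l =>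
    ((v l).norm_coe_le_norm r).trans (norm_le_pi_norm v l)

/-- As functions of `h = v (inl k)`, `P_k` and the response of `F_k` are linear, and the
coefficient `β_i` of the lower level `i` is constant; the bounds are uniform for lower levels in a
bounded set. -/
theorem coefHB_weight (hρ : Differentiable ℝ ρ) (hρ' : Differentiable ℝ (deriv ρ))
    (hρ1 : ∀ t, |deriv ρ t| ≤ Cρ) (hρ2 : ∀ t, |deriv (deriv ρ) t| ≤ Cρ) {k i : Fin K} (hi : i < k)
    (R : ℝ) : ∃ W : V × V → ℝ, Tame W ∧ (∀ n, 0 ≤ W n) ∧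
      ∀ u : Fin K ⊕ Fin K → V, ‖u‖ ≤ R → ∀ h n,
        |cP ρ ηu ηv k (vpar ν σu σv (Function.update u (Sum.inl k) h) n)| ≤ W n * ‖h‖ ∧
        |rF ρ ηu ηv (Sum.inr i) k (vpar ν σu σv (Function.update u (Sum.inl k) h) n)|
          ≤ W n * ‖h‖ ∧
        |cG ρ ηu ηv i (vpar ν σu σv (Function.update u (Sum.inl k) h) n)| ≤ W n := by
  obtain ⟨C1, m1, hC1, h1⟩ := linear_bound (g := fun u n => cP ρ ηu ηv k (vpar ν σu σv u n))
    ((tame_cP (ηu := ηu) (ηv := ηv) hρ hρ1 k).comp_vpar (ν := ν) σu σv) (Sum.inl k)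
    (fun u n => cP_linear k u n) R
  obtain ⟨C2, m2, hC2, h2⟩ := linear_bound
    (g := fun u n => rF ρ ηu ηv (Sum.inr i) k (vpar ν σu σv u n))
    ((tame_rF (ηu := ηu) (ηv := ηv) hρ hρ' hρ1 hρ2 (Sum.inr i) k).comp_vpar (ν := ν) σu σv)
    (Sum.inl k) (fun u n => rF_linear hρ hρ' _ k u n) R
  obtain ⟨C3, m3, hC3, h3⟩ :=
    ((tame_cF_cG (ηu := ηu) (ηv := ηv) hρ hρ1 i).2.comp_vpar (ν := ν) σu σv).exists_bound R
  refine ⟨fun n => C1 * (1 + ‖n‖) ^ m1 + (C2 * (1 + ‖n‖) ^ m2 + C3 * (1 + ‖n‖) ^ m3),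
    ((Tame.const _).mul (.one_add_norm_pow _)).add (((Tame.const _).mul (.one_add_norm_pow _)).add
      ((Tame.const _).mul (.one_add_norm_pow _))), fun n => by positivity,
    fun u hu h n => ⟨(h1 u hu h n).trans ?_, (h2 u hu h n).trans ?_, ?_⟩⟩
  · have : 0 ≤ C2 * (1 + ‖n‖) ^ m2 + C3 * (1 + ‖n‖) ^ m3 := by positivity
    gcongr
    linarith
  · have : 0 ≤ C1 * (1 + ‖n‖) ^ m1 := by positivity
    have : 0 ≤ C3 * (1 + ‖n‖) ^ m3 := by positivity
    gcongr
    linarith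
  · rw [((agreeBelow_vpar (update_below u h (.inl rfl)) n).coef i hi).2]
    refine (h3 u n hu).trans ?_
    have : 0 ≤ C1 * (1 + ‖n‖) ^ m1 := by positivity
    have : 0 ≤ C2 * (1 + ‖n‖) ^ m2 := by positivity
    linarith

theorem abs_sub_le_of_deriv {φ : ℝ → ℝ} (hφ : Differentiable ℝ φ) (h : ∀ t, |deriv φ t| ≤ Cρ)
    (s t : ℝ) : |φ s - φ t| ≤ Cρ * |s - t| := by
  simpa using (convex_univ (𝕜 := ℝ)).norm_image_sub_le_of_norm_deriv_le (f := φ)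
    (fun x _ => hφ x) (fun x _ => h x) (Set.mem_univ t) (Set.mem_univ s)

/-- Linear growth: the response, which is linear in `h`, is multiplied by the bounded function
`ρ'`, and `ρ (P_k)`, which grows linearly in `h`, by a factor that does not depend on `h`. -/
theorem avg_coefHB_growth (hρ : Differentiable ℝ ρ) (hρ' : Differentiable ℝ (deriv ρ))
    (hρ1 : ∀ t, |deriv ρ t| ≤ Cρ) (hρ2 : ∀ t, |deriv (deriv ρ) t| ≤ Cρ) {k i : Fin K} (hi : i < k)
    (R : ℝ) : ∃ A : ℝ, ∀ u : Fin K ⊕ Fin K → V, ‖u‖ ≤ R → ∀ h,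
      |avg ν σu σv (coefHB ρ ηu ηv σv k i) (Function.update u (Sum.inl k) h)| ≤
        A * (1 + ‖h‖) := by
  have hC : 0 ≤ Cρ := (abs_nonneg _).trans (hρ1 0)
  obtain ⟨W, hW, hW0, hb⟩ := coefHB_weight (ν := ν) (ηu := ηu) (ηv := ηv) (σu := σu) (σv := σv)
    hρ hρ' hρ1 hρ2 hi R
  have ht : Tame fun n : V × V => σv ^ 2 * (Cρ * W n) + (|ρ 0| + Cρ * W n) * W n :=
    ((Tame.const _).mul ((Tame.const _).mul hW)).add
      (((Tame.const _).add ((Tame.const _).mul hW)).mul hW)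
  refine ⟨∫ n, σv ^ 2 * (Cρ * W n) + (|ρ 0| + Cρ * W n) * W n ∂(ν.prod ν), fun u hu h => ?_⟩
  rw [← integral_mul_const]
  have hint := (ht.integrable (ν.prod ν)).mul_const (1 + ‖h‖)
  refine norm_integral_le_of_norm_le (f := fun n => coefHB ρ ηu ηv σv k i
    (vpar ν σu σv (Function.update u (Sum.inl k) h) n)) hint (ae_of_all _ fun n => ?_)
  obtain ⟨h1, h2, h3⟩ := hb u hu h n
  have hh := norm_nonneg h
  have hw := hW0 n
  rw [coefHB, Real.norm_eq_abs]
  set p := cP ρ ηu ηv k (vpar ν σu σv (Function.update u (Sum.inl k) h) n)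
  have h4 : |ρ p| ≤ (|ρ 0| + Cρ * W n) * (1 + ‖h‖) := by
    have := abs_sub_le_of_deriv hρ hρ1 p 0
    rw [sub_zero] at this
    have h5 : |ρ p| ≤ |ρ 0| + |ρ p - ρ 0| := by
      have := abs_add_le (ρ 0) (ρ p - ρ 0); simpa using this
    have h6 : Cρ * |p| ≤ Cρ * (W n * ‖h‖) := by gcongr
    have : 0 ≤ |ρ 0| * ‖h‖ := by positivity
    have : 0 ≤ Cρ * W n := by positivity
    nlinarith
  have h7 : |deriv ρ p| ≤ Cρ := hρ1 p
  refine (abs_add_le _ _).trans ?_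
  rw [abs_mul, abs_mul, abs_mul, abs_of_nonneg (sq_nonneg σv)]
  set r := rF ρ ηu ηv (Sum.inr i) k (vpar ν σu σv (Function.update u (Sum.inl k) h) n)
  set b := cG ρ ηu ηv i (vpar ν σu σv (Function.update u (Sum.inl k) h) n)
  have h8 : |r| ≤ W n * (1 + ‖h‖) := h2.trans (by gcongr; linarith)
  calc σv ^ 2 * (|deriv ρ p| * |r|) + |ρ p| * |b|
      ≤ σv ^ 2 * (Cρ * (W n * (1 + ‖h‖))) + (|ρ 0| + Cρ * W n) * (1 + ‖h‖) * W n := by gcongr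
    _ = _ := by ring

/-- Only a local Lipschitz bound holds: the difference of the factors `ρ' (P_k)` is multiplied by
the response, which is unbounded in `h`. -/
theorem avg_coefHB_lipschitz (hρ : Differentiable ℝ ρ) (hρ' : Differentiable ℝ (deriv ρ))
    (hρ1 : ∀ t, |deriv ρ t| ≤ Cρ) (hρ2 : ∀ t, |deriv (deriv ρ) t| ≤ Cρ) {k i : Fin K} (hi : i < k)
    (R R' : ℝ) : ∃ L : ℝ, ∀ u : Fin K ⊕ Fin K → V, ‖u‖ ≤ R → ∀ h h', ‖h‖ ≤ R' → ‖h'‖ ≤ R' →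
      |avg ν σu σv (coefHB ρ ηu ηv σv k i) (Function.update u (Sum.inl k) h) -
        avg ν σu σv (coefHB ρ ηu ηv σv k i) (Function.update u (Sum.inl k) h')| ≤
        L * ‖h - h'‖ := by
  have hC : 0 ≤ Cρ := (abs_nonneg _).trans (hρ1 0)
  obtain ⟨W, hW, hW0, hb⟩ := coefHB_weight (ν := ν) (ηu := ηu) (ηv := ηv) (σu := σu) (σv := σv)
    hρ hρ' hρ1 hρ2 hi R
  have ht : Tame fun n : V × V => σv ^ 2 * (Cρ * W n * (W n * R') + Cρ * W n) + Cρ * W n * W n :=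
    ((Tame.const _).mul ((((Tame.const _).mul hW).mul (hW.mul (.const _))).add
      ((Tame.const _).mul hW))).add (((Tame.const _).mul hW).mul hW)
  have hI := fun v => (tame_coefHB (ηu := ηu) (ηv := ηv) (σv := σv) hρ hρ' hρ1 hρ2
    k i).integrable_vpar (ν := ν) σu σv v
  refine ⟨∫ n, σv ^ 2 * (Cρ * W n * (W n * R') + Cρ * W n) + Cρ * W n * W n ∂(ν.prod ν),
    fun u hu h h' hh hh' => ?_⟩
  rw [← integral_mul_const, avg, avg, ← integral_sub (hI _) (hI _)]
  have hint := (ht.integrable (ν.prod ν)).mul_const ‖h - h'‖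
  refine norm_integral_le_of_norm_le (f := fun n =>
    coefHB ρ ηu ηv σv k i (vpar ν σu σv (Function.update u (Sum.inl k) h) n) -
      coefHB ρ ηu ηv σv k i (vpar ν σu σv (Function.update u (Sum.inl k) h') n)) hint
    (ae_of_all _ fun n => ?_)
  obtain ⟨-, h2, h3⟩ := hb u hu h n
  obtain ⟨h4, h5, -⟩ := hb u hu (h - h') n
  have h6 : cG ρ ηu ηv i (vpar ν σu σv (Function.update u (Sum.inl k) h') n) =
      cG ρ ηu ηv i (vpar ν σu σv (Function.update u (Sum.inl k) h) n) := by
    rw [((agreeBelow_vpar (update_below u h (.inl rfl)) n).coef i hi).2,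
      ((agreeBelow_vpar (update_below u h' (.inl rfl)) n).coef i hi).2]
  rw [(cP_linear k u n).map_sub] at h4
  rw [(rF_linear hρ hρ' _ k u n).map_sub] at h5
  have hw := hW0 n
  rw [coefHB, coefHB, Real.norm_eq_abs, h6]
  set p := cP ρ ηu ηv k (vpar ν σu σv (Function.update u (Sum.inl k) h) n)
  set p' := cP ρ ηu ηv k (vpar ν σu σv (Function.update u (Sum.inl k) h') n)
  set r := rF ρ ηu ηv (Sum.inr i) k (vpar ν σu σv (Function.update u (Sum.inl k) h) n)
  set r' := rF ρ ηu ηv (Sum.inr i) k (vpar ν σu σv (Function.update u (Sum.inl k) h') n)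
  set b := cG ρ ηu ηv i (vpar ν σu σv (Function.update u (Sum.inl k) h) n)
  have e1 : |ρ p - ρ p'| ≤ Cρ * (W n * ‖h - h'‖) :=
    (abs_sub_le_of_deriv hρ hρ1 p p').trans (by gcongr)
  have e2 : |deriv ρ p - deriv ρ p'| ≤ Cρ * (W n * ‖h - h'‖) :=
    (abs_sub_le_of_deriv hρ' hρ2 p p').trans (by gcongr)
  have e3 : |r| ≤ W n * R' := h2.trans (by gcongr)
  have e4 : |deriv ρ p'| ≤ Cρ := hρ1 p'
  have hd : σv ^ 2 * (deriv ρ p * r) + ρ p * b - (σv ^ 2 * (deriv ρ p' * r') + ρ p' * b) =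
      σv ^ 2 * ((deriv ρ p - deriv ρ p') * r + deriv ρ p' * (r - r')) + (ρ p - ρ p') * b := by ring
  have e5 : |(deriv ρ p - deriv ρ p') * r + deriv ρ p' * (r - r')| ≤
      Cρ * (W n * ‖h - h'‖) * (W n * R') + Cρ * (W n * ‖h - h'‖) := by
    refine (abs_add_le _ _).trans ?_
    rw [abs_mul, abs_mul]
    gcongr
  rw [hd]
  refine (abs_add_le _ _).trans ?_
  rw [abs_mul, abs_mul, abs_of_nonneg (sq_nonneg σv)]
  calc σv ^ 2 * |(deriv ρ p - deriv ρ p') * r + deriv ρ p' * (r - r')| + |ρ p - ρ p'| * |b|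
      ≤ σv ^ 2 * (Cρ * (W n * ‖h - h'‖) * (W n * R') + Cρ * (W n * ‖h - h'‖)) +
        Cρ * (W n * ‖h - h'‖) * W n := by gcongr
    _ = _ := by ring

theorem avg_linear_bound {f : Par K → ℝ} (hf : Tame f) {a : Fin K ⊕ Fin K}
    (hlin : ∀ (u : Fin K ⊕ Fin K → V) n,
      IsLinearMap ℝ fun h => f (vpar ν σu σv (Function.update u a h) n)) (R : ℝ) :
    ∃ C : ℝ, 0 ≤ C ∧ ∀ u : Fin K ⊕ Fin K → V, ‖u‖ ≤ R → ∀ h,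
      |avg ν σu σv f (Function.update u a h)| ≤ C * ‖h‖ := by
  obtain ⟨C, m, hC, hb⟩ := linear_bound (g := fun u n => f (vpar ν σu σv u n))
    (hf.comp_vpar (ν := ν) σu σv) a hlin R
  refine ⟨∫ n, C * (1 + ‖n‖) ^ m ∂(ν.prod ν), integral_nonneg fun n => by positivity,
    fun u hu h => ?_⟩
  rw [← integral_mul_const]
  exact norm_integral_le_of_norm_le (f := fun n => f (vpar ν σu σv (Function.update u a h) n))
    (((Tame.integrable_one_add_norm_pow (ν.prod ν) m).const_mul C).mul_const ‖h‖)
    (ae_of_all _ fun n => hb u hu h n)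

theorem caratheodory_fieldH (hρ : Differentiable ℝ ρ) (hρ' : Differentiable ℝ (deriv ρ))
    (hρ1 : ∀ t, |deriv ρ t| ≤ Cρ) (hρ2 : ∀ t, |deriv (deriv ρ) t| ≤ Cρ)
    (v : Fin K ⊕ Fin K → C(unitInterval, V)) (k : Fin K) :
    IsCaratheodory fun r h =>
      fieldH ν ρ ηu ηv σu σv k (Function.update (fun l => v l r) (Sum.inl k) h) := by
  simp only [fieldH, ne_eq, reduceCtorEq, not_false_eq_true, Function.update_of_ne]
  refine .sum _ fun i hi => ?_
  have hi' : i < k := by simpa using hi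
  refine .smul_path (c := fun r h => avg ν σu σv (coefHB ρ ηu ηv σv k i)
    (Function.update (fun l => v l r) (Sum.inl k) h))
    (((tame_coefHB hρ hρ' hρ1 hρ2 k i).avg σu σv).measurable.comp (measurable_update_path v _))
    (fun R => ?_) ?_ _
  · obtain ⟨L, hL⟩ := avg_coefHB_lipschitz (ν := ν) (ηu := ηu) (ηv := ηv) (σu := σu) (σv := σv)
      hρ hρ' hρ1 hρ2 hi' ‖v‖ R
    exact ⟨L, fun s x y hx hy => hL _ (norm_path_le v s) x y hx hy⟩
  · obtain ⟨A, hA⟩ := avg_coefHB_growth (ν := ν) (ηu := ηu) (ηv := ηv) (σu := σu) (σv := σv)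
      hρ hρ' hρ1 hρ2 hi' ‖v‖
    exact ⟨A, fun s x => hA _ (norm_path_le v s) x⟩

theorem caratheodory_avg_smul {f : Par K → ℝ} (hf : Tame f) {a : Fin K ⊕ Fin K}
    (hlin : ∀ (u : Fin K ⊕ Fin K → V) n,
      IsLinearMap ℝ fun h => f (vpar ν σu σv (Function.update u a h) n))
    (v : Fin K ⊕ Fin K → C(unitInterval, V)) (w : C(unitInterval, V)) :
    IsCaratheodory fun r h => avg ν σu σv f (Function.update (fun l => v l r) a h) • w r := by
  obtain ⟨C, hC, hb⟩ := avg_linear_bound hf hlin ‖v‖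
  refine .smul_path (c := fun r h => avg ν σu σv f (Function.update (fun l => v l r) a h))
    ((hf.avg σu σv).measurable.comp (measurable_update_path v _))
    (fun R => ⟨C, fun s x y _ _ => ?_⟩) ⟨C, fun s x => ?_⟩ _
  · rw [← (avg_linear hf (hlin _)).map_sub]
    exact hb _ (norm_path_le v s) _
  · exact (hb _ (norm_path_le v s) x).trans (by gcongr; linarith)

/-- The field of the backward equation is linear in the unknown `v (inr k)`. -/
theorem caratheodory_fieldB (hρ : Differentiable ℝ ρ) (hρ' : Differentiable ℝ (deriv ρ))
    (hρ1 : ∀ t, |deriv ρ t| ≤ Cρ) (hρ2 : ∀ t, |deriv (deriv ρ) t| ≤ Cρ)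
    (v : Fin K ⊕ Fin K → C(unitInterval, V)) (k : Fin K) :
    IsCaratheodory fun r h =>
      fieldB ν ρ ηu ηv σu σv k (Function.update (fun l => v l r) (Sum.inr k) h) := by
  simp only [fieldB, ne_eq, reduceCtorEq, not_false_eq_true, Function.update_of_ne]
  refine .add (.sum _ fun i hi => ?_) ?_
  · have hi' : i < k := by simpa using hi
    exact caratheodory_avg_smul (tame_coefBH hρ hρ' hρ1 hρ2 k i)
      (fun u n => coefBH_linear hρ hρ' hi' u n) v _
  · exact caratheodory_avg_smul (tame_coefBdiag hρ hρ1 hρ2 k)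
      (fun u n => coefBdiag_linear k u n) v _

variable (ν ρ ηu ηv σu σv) in
/-- The closed deterministic system at level `k`: the forward equation for `v (inl k)`, started at
`e₀`, and the backward equation for `v (inr k)`, whose end value is a function `τ` of the end value
of `v (inl k)`. -/
def ClosedSystem (e₀ : V) (τ : V → V) (v : Fin K ⊕ Fin K → C(unitInterval, V)) (k : Fin K) : Prop :=
  (∀ s, v (Sum.inl k) s =
    e₀ + ∫ r in Set.Iic s, fieldH ν ρ ηu ηv σu σv k (fun l => v l r)) ∧
  ∀ s, v (Sum.inr k) s =
    τ (v (Sum.inl k) 1) - ∫ r in Set.Ici s, fieldB ν ρ ηu ηv σu σv k (fun l => v l r)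

/-- By induction on the level: if two solutions agree below level `k`, they solve the same forward
equation at level `k`, and then the same backward equation. -/
theorem ClosedSystem.unique (hρ : Differentiable ℝ ρ) (hρ' : Differentiable ℝ (deriv ρ))
    (hρ1 : ∀ t, |deriv ρ t| ≤ Cρ) (hρ2 : ∀ t, |deriv (deriv ρ) t| ≤ Cρ) {e₀ : V} {τ : V → V}
    {v v' : Fin K ⊕ Fin K → C(unitInterval, V)}
    (h : ∀ k, ClosedSystem ν ρ ηu ηv σu σv e₀ τ v k)
    (h' : ∀ k, ClosedSystem ν ρ ηu ηv σu σv e₀ τ v' k) : v = v' := by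
  have key : ∀ k : Fin K, v (Sum.inl k) = v' (Sum.inl k) ∧ v (Sum.inr k) = v' (Sum.inr k) := by
    intro k
    induction k using WellFoundedLT.induction with
    | ind k ih =>
      have hb : ∀ (r : unitInterval) (i : Fin K), i < k →
          v (Sum.inl i) r = v' (Sum.inl i) r ∧ v (Sum.inr i) r = v' (Sum.inr i) r := by
        intro r i hi
        rw [(ih i hi).1, (ih i hi).2]
        exact ⟨rfl, rfl⟩
      have hH : v (Sum.inl k) = v' (Sum.inl k) := by
        refine (caratheodory_fieldH (ν := ν) (ηu := ηu) (ηv := ηv) (σu := σu) (σv := σv)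
          hρ hρ' hρ1 hρ2 v k).existsUnique_forward e₀ |>.unique (fun s => ?_) (fun s => ?_)
        · rw [(h k).1 s]
          congr 2
          ext r
          rw [show Function.update (fun l => v l r) (Sum.inl k) (v (Sum.inl k) r) =
            fun l => v l r from Function.update_eq_self _ _]
        · rw [(h' k).1 s]
          congr 2
          ext r
          refine fieldH_congr hρ hρ' (fun i hi => ?_) (by simp)
          have := update_below (fun l => v l r) (k := k) (v' (Sum.inl k) r) (.inl rfl) i hi
          rw [this.1, this.2]
          exact ⟨(hb r i hi).1.symm, (hb r i hi).2.symm⟩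
      refine ⟨hH, ?_⟩
      refine (caratheodory_fieldB (ν := ν) (ηu := ηu) (ηv := ηv) (σu := σu) (σv := σv)
          hρ hρ' hρ1 hρ2 v k).existsUnique_backward (τ (v (Sum.inl k) 1)) |>.unique
          (fun s => ?_) (fun s => ?_)
      · rw [(h k).2 s]
        congr 2
        ext r
        rw [show Function.update (fun l => v l r) (Sum.inr k) (v (Sum.inr k) r) =
          fun l => v l r from Function.update_eq_self _ _]
      · rw [(h' k).2 s, hH]
        congr 2
        ext r
        refine fieldB_congr hρ hρ' (fun i hi => ?_) (by simp [hH]) (by simp)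
        have := update_below (fun l => v l r) (k := k) (v' (Sum.inr k) r) (.inr rfl) i hi
        rw [this.1, this.2]
        exact ⟨(hb r i hi).1.symm, (hb r i hi).2.symm⟩
  funext l
  rcases l with k | k
  exacts [(key k).1, (key k).2]

/-- Triangular systems can be solved level by level: it suffices that the condition at level `k`
only involves the levels up to `k` and can be met by a choice of the two slots of level `k`. -/
theorem exists_of_triangular {K : ℕ} {W : Type*} {Good : (Fin K ⊕ Fin K → W) → Fin K → Prop}
    (hcongr : ∀ k v v', (∀ i ≤ k, v (Sum.inl i) = v' (Sum.inl i) ∧ v (Sum.inr i) = v' (Sum.inr i)) →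
      Good v k → Good v' k)
    (hstep : ∀ k v, (∀ i < k, Good v i) →
      ∃ x y, Good (Function.update (Function.update v (Sum.inl k) x) (Sum.inr k) y) k)
    (v₀ : Fin K ⊕ Fin K → W) : ∃ v, ∀ k, Good v k := by
  have key : ∀ n ≤ K, ∃ v, ∀ k : Fin K, k.val < n → Good v k := by
    intro n
    induction n with
    | zero => exact fun _ => ⟨v₀, fun k hk => absurd hk (by simp)⟩
    | succ n ih =>
      intro hn
      obtain ⟨v, hv⟩ := ih (by omega)
      let k : Fin K := ⟨n, hn⟩
      obtain ⟨x, y, hxy⟩ := hstep k v fun i hi => hv i hi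
      refine ⟨Function.update (Function.update v (Sum.inl k) x) (Sum.inr k) y, fun j hj => ?_⟩
      rcases (Nat.lt_succ_iff_lt_or_eq.1 hj) with hj' | hj'
      · refine hcongr j v _ (fun i hi => ?_) (hv j hj')
        have hik : i < k := lt_of_le_of_lt hi hj'
        have h1 := update_below (Function.update v (Sum.inl k) x) y (k := k) (.inr rfl) i hik
        have h2 := update_below v x (k := k) (.inl rfl) i hik
        rw [h1.1, h1.2, h2.1, h2.2]
        exact ⟨rfl, rfl⟩
      · obtain rfl : j = k := Fin.ext hj'
        exact hxy
  obtain ⟨v, hv⟩ := key K le_rfl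
  exact ⟨v, fun k => hv k k.2⟩

theorem ClosedSystem.exists (hρ : Differentiable ℝ ρ) (hρ' : Differentiable ℝ (deriv ρ))
    (hρ1 : ∀ t, |deriv ρ t| ≤ Cρ) (hρ2 : ∀ t, |deriv (deriv ρ) t| ≤ Cρ) (e₀ : V) (τ : V → V) :
    ∃ v : Fin K ⊕ Fin K → C(unitInterval, V), ∀ k, ClosedSystem ν ρ ηu ηv σu σv e₀ τ v k := by
  refine exists_of_triangular (fun k v v' h hv => ⟨fun s => ?_, fun s => ?_⟩)
    (fun k v _ => ?_) 0
  · rw [← (h k le_rfl).1, hv.1 s]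
    congr 2
    ext r
    exact fieldH_congr hρ hρ' (fun i hi => by simp only [h i hi.le, and_self])
      (by simp only [h k le_rfl])
  · rw [← (h k le_rfl).1, ← (h k le_rfl).2, hv.2 s]
    congr 2
    ext r
    exact fieldB_congr hρ hρ' (fun i hi => by simp only [h i hi.le, and_self])
      (by simp only [h k le_rfl]) (by simp only [h k le_rfl])
  obtain ⟨x, hx, -⟩ := (caratheodory_fieldH (ν := ν) (ηu := ηu) (ηv := ηv) (σu := σu)
    (σv := σv) hρ hρ' hρ1 hρ2 v k).existsUnique_forward e₀
  obtain ⟨y, hy, -⟩ := (caratheodory_fieldB (ν := ν) (ηu := ηu) (ηv := ηv) (σu := σu)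
    (σv := σv) hρ hρ' hρ1 hρ2 (Function.update v (Sum.inl k) x) k).existsUnique_backward
    (τ (x 1))
  have hxk : Function.update (Function.update v (Sum.inl k) x) (Sum.inr k) y (Sum.inl k) = x := by
    simp
  have hyk : Function.update (Function.update v (Sum.inl k) x) (Sum.inr k) y (Sum.inr k) = y := by
    simp
  have h2 := fun i hi => update_below v x (k := k) (.inl rfl) i hi
  have hlow := fun i hi =>
    update_below (Function.update v (Sum.inl k) x) y (k := k) (.inr rfl) i hi
  refine ⟨x, y, fun s => ?_, fun s => ?_⟩
  · rw [hxk, hx s]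
    congr 2
    ext r
    refine fieldH_congr hρ hρ' (fun i hi => ?_) (by simp)
    have := update_below (fun l => v l r) (k := k) (x r) (.inl rfl) i hi
    rw [(hlow i hi).1, (hlow i hi).2, this.1, this.2, (h2 i hi).1, (h2 i hi).2]
    exact ⟨rfl, rfl⟩
  · rw [hxk, hyk, hy s]
    congr 2
    ext r
    refine fieldB_congr hρ hρ' (fun i hi => ?_) (by simp) (by simp)
    have := update_below (fun l => Function.update v (Sum.inl k) x l r) (k := k) (y r)
      (.inr rfl) i hi
    rw [(hlow i hi).1, (hlow i hi).2, this.1, this.2, (h2 i hi).1, (h2 i hi).2]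
    exact ⟨rfl, rfl⟩

end Closed

/-! ### Gaussian vectors and the driving field -/

section Gaussian

variable {ι : Type*} [Fintype ι]

theorem integral_inner_mul_inner {Ω : Type*} [MeasurableSpace Ω] {P : Measure Ω}
    {e : Ω → EuclideanSpace ℝ ι} (h : ∀ i j, Integrable (fun ω => e ω i * e ω j) P)
    (x y : EuclideanSpace ℝ ι) :
    ∫ ω, inner ℝ x (e ω) * inner ℝ y (e ω) ∂P =
      ∑ i, ∑ j, x i * y j * ∫ ω, e ω i * e ω j ∂P := by
  have h1 : ∀ ω, (inner ℝ x (e ω) * inner ℝ y (e ω) : ℝ) =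
      ∑ i, ∑ j, x i * y j * (e ω i * e ω j) := by
    intro ω
    simp only [PiLp.inner_apply, RCLike.inner_apply, conj_trivial, Finset.sum_mul_sum]
    exact Finset.sum_congr rfl fun i _ => Finset.sum_congr rfl fun j _ => by ring
  simp only [h1]
  rw [integral_finsetSum _ fun i _ => integrable_finsetSum _ fun j _ => (h i j).const_mul _]
  refine Finset.sum_congr rfl fun i _ => ?_
  rw [integral_finsetSum _ fun j _ => (h i j).const_mul _]
  simp only [integral_const_mul]

theorem covarianceBilin_of_centered {μ : Measure (EuclideanSpace ℝ ι)} [IsGaussian μ]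
    (h0 : μ[id] = 0) (x y : EuclideanSpace ℝ ι) :
    covarianceBilin μ x y = ∫ z, inner ℝ x z * inner ℝ y z ∂μ := by
  rw [covarianceBilin_apply IsGaussian.memLp_two_id, h0]
  simp

theorem integrable_eval_mul (μ : Measure (EuclideanSpace ℝ ι)) [IsGaussian μ] (i j : ι) :
    Integrable (fun z => z i * z j) μ := by
  have h : ∀ i, MemLp (fun z : EuclideanSpace ℝ ι => z i) 2 μ := fun i =>
    IsGaussian.memLp_dual μ (EuclideanSpace.proj i) 2 (by simp)
  exact (h i).integrable_mul (h j)

/-- A centered Gaussian measure on a Euclidean space is determined by its second moments. -/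
theorem gaussian_ext {μ μ' : Measure (EuclideanSpace ℝ ι)} [IsGaussian μ] [IsGaussian μ']
    (h0 : μ[id] = 0) (h0' : μ'[id] = 0)
    (h : ∀ i j, ∫ z, z i * z j ∂μ = ∫ z, z i * z j ∂μ') : μ = μ' := by
  refine IsGaussian.ext (h0.trans h0'.symm) ?_
  ext x y
  rw [covarianceBilin_of_centered h0, covarianceBilin_of_centered h0',
    integral_inner_mul_inner (integrable_eval_mul μ),
    integral_inner_mul_inner (integrable_eval_mul μ')]
  simp only [h]

/-- There is a centered Gaussian measure with the second moments of any given square integrable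
random vector. -/
theorem exists_gaussian_gram {Ω : Type*} [MeasurableSpace Ω] {P : Measure Ω}
    {e : Ω → EuclideanSpace ℝ ι} (he : MemLp e 2 P) :
    ∃ ν : Measure (EuclideanSpace ℝ ι), IsGaussian ν ∧ ν[id] = 0 ∧
      ∀ x y, gram ν x y = ∫ ω, inner ℝ x (e ω) * inner ℝ y (e ω) ∂P := by
  classical
  have hc : ∀ i, MemLp (fun ω => e ω i) 2 P := fun i =>
    (EuclideanSpace.proj (𝕜 := ℝ) i : EuclideanSpace ℝ ι →L[ℝ] ℝ).comp_memLp' he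
  have hint : ∀ i j, Integrable (fun ω => e ω i * e ω j) P := fun i j =>
    (hc i).integrable_mul (hc j)
  let S : Matrix ι ι ℝ := Matrix.of fun i j => ∫ ω, e ω i * e ω j ∂P
  have hquad : ∀ x y : ι → ℝ, x ⬝ᵥ S.mulVec y =
      ∫ ω, inner ℝ (WithLp.toLp 2 x) (e ω) * inner ℝ (WithLp.toLp 2 y) (e ω) ∂P := by
    intro x y
    rw [integral_inner_mul_inner hint]
    simp only [dotProduct, Matrix.mulVec, Finset.mul_sum, S, Matrix.of_apply]
    exact Finset.sum_congr rfl fun i _ => Finset.sum_congr rfl fun j _ => by ring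
  have hS : S.PosSemidef := by
    refine Matrix.PosSemidef.of_dotProduct_mulVec_nonneg ?_ fun x => ?_
    · ext i j
      simp [S, Matrix.conjTranspose_apply, mul_comm]
    · rw [star_trivial, hquad]
      exact integral_nonneg fun ω => mul_self_nonneg _
  refine ⟨multivariateGaussian 0 S, inferInstance, by simp, fun x y => ?_⟩
  rw [gram, ← covarianceBilin_of_centered (by simp), covarianceBilin_multivariateGaussian hS, hquad]

end Gaussian

section Path

variable {K : ℕ} {V : Type*} [NormedAddCommGroup V] [NormedSpace ℝ V] [FiniteDimensional ℝ V]

/-- The path of `ℝ^{2K}` whose coordinates are given linear functionals, depending continuously on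
time, of a vector. -/
noncomputable def linearPath (φ : Fin K ⊕ Fin K → C(unitInterval, StrongDual ℝ V)) :
    V →L[ℝ] PathSpace K :=
  LinearMap.toContinuousLinearMap
    { toFun := fun x => ⟨fun s => WithLp.toLp 2 fun l => φ l s x, by fun_prop⟩
      map_add' := fun x y => by ext s l; simp
      map_smul' := fun c x => by ext s l; simp }

end Path

section Noise

variable {K : ℕ} {V : Type*} [NormedAddCommGroup V] [InnerProductSpace ℝ V]
  [FiniteDimensional ℝ V]

/-- The path with coordinates `s ↦ ⟨v l s, x⟩`, as a linear function of `x`. -/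
noncomputable def pathOf (v : Fin K ⊕ Fin K → C(unitInterval, V)) : V →L[ℝ] PathSpace K :=
  linearPath fun l => ⟨fun s => innerSL ℝ (v l s), by fun_prop⟩

theorem pathOf_apply (v : Fin K ⊕ Fin K → C(unitInterval, V)) (x : V) (s : unitInterval)
    (l : Fin K ⊕ Fin K) : pathOf v x s l = inner ℝ (v l s) x := rfl

/-- The path with forward coordinates `σ_u ⟨v (inl i) s, n⟩` and backward coordinates
`σ_v ⟨v (inr i) s, n'⟩`. -/
noncomputable def noisePath (σu σv : ℝ) (v : Fin K ⊕ Fin K → C(unitInterval, V)) :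
    V × V →L[ℝ] PathSpace K :=
  linearPath (Sum.elim
    (fun i => ⟨fun s => σu • (innerSL ℝ (v (Sum.inl i) s)).comp (.fst ℝ V V), by fun_prop⟩)
    (fun i => ⟨fun s => σv • (innerSL ℝ (v (Sum.inr i) s)).comp (.snd ℝ V V), by fun_prop⟩))

theorem noisePath_inl (σu σv : ℝ) (v : Fin K ⊕ Fin K → C(unitInterval, V)) (n : V × V)
    (s : unitInterval) (i : Fin K) :
    noisePath σu σv v n s (Sum.inl i) = σu * inner ℝ (v (Sum.inl i) s) n.1 := rfl

theorem noisePath_inr (σu σv : ℝ) (v : Fin K ⊕ Fin K → C(unitInterval, V)) (n : V × V)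
    (s : unitInterval) (i : Fin K) :
    noisePath σu σv v n s (Sum.inr i) = σv * inner ℝ (v (Sum.inr i) s) n.2 := rfl

variable [MeasurableSpace V] [BorelSpace V] {ν : Measure V} [IsGaussian ν]
  {Ω : Type*} [MeasurableSpace Ω] {P : Measure Ω} {e : Ω → V} {X : Ω → PathSpace K}
  {σu σv : ℝ} {v : Fin K ⊕ Fin K → C(unitInterval, V)}

theorem integral_inner_eq_zero (h0 : ν[id] = 0) (w : V) : ∫ n, inner ℝ w n ∂ν = 0 := by
  have := IsGaussian.integral_dual (μ := ν) (innerSL ℝ w)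
  simp only [id_eq] at h0
  rw [h0, map_zero] at this
  exact this

/-- If the coordinates of `X` are `⟨v l s, e⟩`, then the image under `noisePath` of a pair of
independent Gaussian vectors with the covariance of `e` is a driving field for `X`. -/
theorem isDrivingField_noisePath (h0 : ν[id] = 0)
    (hν : ∀ x y, gram ν x y = ∫ ω, inner ℝ x (e ω) * inner ℝ y (e ω) ∂P)
    (hX : ∀ᵐ ω ∂P, ∀ s l, X ω s l = inner ℝ (v l s) (e ω)) :
    IsDrivingField P σu σv X ((ν.prod ν).map (noisePath σu σv v)) := by
  have hmap : ∀ f : PathSpace K → ℝ, Measurable f →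
      ∫ z, f z ∂((ν.prod ν).map (noisePath σu σv v)) =
        ∫ n, f (noisePath σu σv v n) ∂(ν.prod ν) := fun f hf =>
    integral_map (noisePath σu σv v).continuous.measurable.aemeasurable hf.aestronglyMeasurable
  have hev : ∀ (s : unitInterval) (l : Fin K ⊕ Fin K), Measurable fun z : PathSpace K => z s l :=
    fun s l => ((EuclideanSpace.proj (𝕜 := ℝ) l : State K →L[ℝ] ℝ).continuous.comp
      (continuous_eval_const s)).measurable
  have hXX : ∀ s t l l', ∫ ω, X ω s l * X ω t l' ∂P = gram ν (v l s) (v l' t) := by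
    intro s t l l'
    rw [hν]
    refine integral_congr_ae ?_
    filter_upwards [hX] with ω hω
    rw [hω, hω]
  refine ⟨inferInstance, fun s l => ?_, fun s t l l' => ?_⟩
  · rw [hmap _ (hev s l)]
    rcases l with i | i
    · simp only [noisePath_inl]
      rw [integral_const_mul, integral_fun_fst (fun n => inner ℝ (v (Sum.inl i) s) n),
        integral_inner_eq_zero h0]
      simp
    · simp only [noisePath_inr]
      rw [integral_const_mul, integral_fun_snd (fun n => inner ℝ (v (Sum.inr i) s) n),
        integral_inner_eq_zero h0]
      simp
  · rw [hmap (fun z => z s l * z t l') ((hev s l).mul (hev t l'))]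
    rcases l with i | i <;> rcases l' with j | j <;>
      simp only [noisePath_inl, noisePath_inr, fieldCov]
    · have : ∀ n : V × V, σu * inner ℝ (v (Sum.inl i) s) n.1 *
          (σu * inner ℝ (v (Sum.inl j) t) n.1) =
        σu ^ 2 * (inner ℝ (v (Sum.inl i) s) n.1 * inner ℝ (v (Sum.inl j) t) n.1) := fun n => by ring
      simp only [this, hXX]
      rw [integral_const_mul, integral_fun_fst
        (fun n => inner ℝ (v (Sum.inl i) s) n * inner ℝ (v (Sum.inl j) t) n)]
      simp [gram]
    · rw [integral_prod_mul (fun n : V => σu * inner ℝ (v (Sum.inl i) s) n)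
        (fun n : V => σv * inner ℝ (v (Sum.inr j) t) n), integral_const_mul,
        integral_inner_eq_zero h0]
      simp
    · have : ∀ n : V × V, σv * inner ℝ (v (Sum.inr i) s) n.2 *
          (σu * inner ℝ (v (Sum.inl j) t) n.1) =
        σu * inner ℝ (v (Sum.inl j) t) n.1 * (σv * inner ℝ (v (Sum.inr i) s) n.2) :=
          fun n => by ring
      simp only [this]
      rw [integral_prod_mul (fun n : V => σu * inner ℝ (v (Sum.inl j) t) n)
        (fun n : V => σv * inner ℝ (v (Sum.inr i) s) n), integral_const_mul,
        integral_inner_eq_zero h0]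
      simp
    · have : ∀ n : V × V, σv * inner ℝ (v (Sum.inr i) s) n.2 *
          (σv * inner ℝ (v (Sum.inr j) t) n.2) =
        σv ^ 2 * (inner ℝ (v (Sum.inr i) s) n.2 * inner ℝ (v (Sum.inr j) t) n.2) := fun n => by ring
      simp only [this, hXX]
      rw [integral_const_mul, integral_fun_snd
        (fun n => inner ℝ (v (Sum.inr i) s) n * inner ℝ (v (Sum.inr j) t) n)]
      simp [gram]

/-- Two driving fields of the same random path have the same marginal laws. -/
theorem IsDrivingField.map_eval_eq {γ γ' : Measure (PathSpace K)}
    (h : IsDrivingField P σu σv X γ) (h' : IsDrivingField P σu σv X γ') (s : unitInterval) :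
    γ.map (fun z => z s) = γ'.map fun z => z s := by
  let L : PathSpace K →L[ℝ] State K := ContinuousMap.evalCLM ℝ s
  have hL : Measurable L := L.continuous.measurable
  have hmean : ∀ {γ : Measure (PathSpace K)}, IsDrivingField P σu σv X γ →
      (γ.map L)[id] = 0 := by
    intro γ h
    have := h.gaussian
    have hi : Integrable (fun z => L z) γ := L.integrable_comp IsGaussian.integrable_id
    rw [integral_map hL.aemeasurable (by fun_prop)]
    ext l
    exact (ContinuousLinearMap.integral_comp_comm
      (EuclideanSpace.proj (𝕜 := ℝ) l : State K →L[ℝ] ℝ) hi).symm.trans (h.centered s l)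
  have hcov : ∀ {γ : Measure (PathSpace K)}, IsDrivingField P σu σv X γ → ∀ l l',
      ∫ z, z l * z l' ∂(γ.map L) = fieldCov P σu σv X s s l l' := by
    intro γ h l l'
    rw [integral_map hL.aemeasurable (by fun_prop)]
    exact h.covariance s s l l'
  have := h.gaussian
  have := h'.gaussian
  exact gaussian_ext (μ := γ.map L) (μ' := γ'.map L) (hmean h) (hmean h') fun i j =>
    (hcov h i j).trans (hcov h' i j).symm

/-- The average of a function of the data under any driving field of `X`, when the coordinates of
`X` are `⟨v l s, e⟩`. -/
theorem integral_par_eq_avg (h0 : ν[id] = 0)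
    (hν : ∀ x y, gram ν x y = ∫ ω, inner ℝ x (e ω) * inner ℝ y (e ω) ∂P)
    (hX : ∀ᵐ ω ∂P, ∀ s l, X ω s l = inner ℝ (v l s) (e ω))
    {γ : Measure (PathSpace K)} (hγ : IsDrivingField P σu σv X γ) {f : Par K → ℝ}
    (hf : Measurable f) (s : unitInterval) :
    ∫ z, f (par P X s (z s)) ∂γ = avg ν σu σv f fun l => v l s := by
  have hev : Measurable fun z : PathSpace K => z s := (continuous_eval_const s).measurable
  have hp : Measurable fun z : State K => f (par P X s z) :=
    hf.comp (measurable_const.prodMk (measurable_const.prodMk measurable_id))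
  have hp' : Measurable fun z : PathSpace K => f (par P X s (z s)) := hp.comp hev
  rw [← integral_map (φ := fun z : PathSpace K => z s) (f := fun z => f (par P X s z))
    hev.aemeasurable hp.aestronglyMeasurable,
    hγ.map_eval_eq (isDrivingField_noisePath h0 hν hX) s,
    integral_map hev.aemeasurable hp.aestronglyMeasurable,
    integral_map (noisePath σu σv v).continuous.measurable.aemeasurable
      hp'.aestronglyMeasurable, avg]
  congr 1
  ext n
  congr 1
  have hXX : ∀ l l', ∫ ω, X ω s l * X ω s l' ∂P = gram ν (v l s) (v l' s) := by
    intro l l'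
    rw [hν]
    refine integral_congr_ae ?_
    filter_upwards [hX] with ω hω
    rw [hω, hω]
  simp only [par, vpar, hXX]
  congr 2
  ext l
  rcases l with i | i <;> rfl

end Noise

/-! ### From the closed system to the limit system -/

section

variable {Ω : Type*} [mΩ : MeasurableSpace Ω] {P : Measure Ω} {K : ℕ} {X : Ω → PathSpace K}
  {γ : Measure (PathSpace K)}

theorem measurable_uncurry_coord (hX : Measurable X) (l : Fin K ⊕ Fin K) :
    Measurable fun p : unitInterval × Ω => X p.2 p.1 l := by
  have hc : ∀ s : unitInterval, Measurable fun x : PathSpace K => x s l := fun s =>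
    ((EuclideanSpace.proj (𝕜 := ℝ) l : State K →L[ℝ] ℝ).continuous.comp
      (continuous_eval_const s)).measurable
  exact measurable_uncurry_of_continuous_of_measurable (u := fun s ω => X ω s l)
    (fun ω => by fun_prop) fun s => (hc s).comp hX

theorem measurable_integral_par [SFinite P] [SFinite γ] (hX : Measurable X) {f : Par K → ℝ}
    (hf : Measurable f) : Measurable fun s => ∫ z, f (par P X s (z s)) ∂γ := by
  have hmom : ∀ l l' : Fin K ⊕ Fin K, Measurable fun s => ∫ ω, X ω s l * X ω s l' ∂P :=
    fun l l' => (((measurable_uncurry_coord hX l).mul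
      (measurable_uncurry_coord hX l')).stronglyMeasurable.integral_prod_right' (ν := P)).measurable
  have hz : Measurable fun p : unitInterval × PathSpace K => p.2 p.1 :=
    measurable_uncurry_of_continuous_of_measurable (u := fun s (z : PathSpace K) => z s)
      (fun z => z.continuous) fun s => (continuous_eval_const s).measurable
  have hp : Measurable fun p : unitInterval × PathSpace K => f (par P X p.1 (p.2 p.1)) := by
    refine hf.comp (Measurable.prodMk ?_ (Measurable.prodMk ?_ hz))
    · exact measurable_pi_lambda _ fun i => measurable_pi_lambda _ fun j =>
        (hmom _ _).comp measurable_fst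
    · exact measurable_pi_lambda _ fun i => measurable_pi_lambda _ fun j =>
        (hmom _ _).comp measurable_fst
  exact (hp.stronglyMeasurable.integral_prod_right' (ν := γ)).measurable

theorem bounded_integral_par [IsGaussian γ] (hX : MemLp X 2 P) {f : Par K → ℝ} (hf : Tame f) :
    ∃ C : ℝ, ∀ s, |∫ z, f (par P X s (z s)) ∂γ| ≤ C := by
  obtain ⟨C, m, hC, hb⟩ := hf.growth
  set a : ℝ := ∫ ω, ‖X ω‖ * ‖X ω‖ ∂P
  have ha : 0 ≤ a := integral_nonneg fun ω => by positivity
  have hmom : ∀ s (l l' : Fin K ⊕ Fin K), ‖∫ ω, X ω s l * X ω s l' ∂P‖ ≤ a := by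
    intro s l l'
    refine norm_integral_le_of_norm_le (hX.norm.integrable_mul hX.norm) (ae_of_all _ fun ω => ?_)
    rw [norm_mul]
    have h : ∀ l, ‖X ω s l‖ ≤ ‖X ω‖ := fun l =>
      (PiLp.norm_apply_le (X ω s) l).trans ((X ω).norm_coe_le_norm s)
    exact mul_le_mul (h l) (h l') (norm_nonneg _) (norm_nonneg _)
  have hpar : ∀ s (z : PathSpace K), ‖par P X s (z s)‖ ≤ a + ‖z‖ := by
    intro s z
    have hpi : ∀ A : Fin K → Fin K → ℝ, (∀ i j, ‖A i j‖ ≤ a) → ‖A‖ ≤ a + ‖z‖ := fun A hA =>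
      ((pi_norm_le_iff_of_nonneg ha).2 fun i => (pi_norm_le_iff_of_nonneg ha).2 (hA i)).trans
        (le_add_of_nonneg_right (norm_nonneg _))
    rw [Prod.norm_def, Prod.norm_def]
    exact max_le (hpi _ fun i j => hmom _ _ _) (max_le (hpi _ fun i j => hmom _ _ _)
      ((z.norm_coe_le_norm s).trans (le_add_of_nonneg_left ha)))
  refine ⟨∫ z, C * (1 + a) ^ m * (1 + ‖z‖) ^ m ∂γ, fun s => ?_⟩
  refine norm_integral_le_of_norm_le (f := fun z => f (par P X s (z s)))
    ((Tame.integrable_one_add_norm_pow γ m).const_mul _) (ae_of_all _ fun z => (hb _).trans ?_)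
  rw [mul_assoc, ← mul_pow]
  gcongr
  have := hpar s z
  nlinarith [mul_nonneg ha (norm_nonneg z)]

theorem integrable_integral_par_smul {V : Type*} [NormedAddCommGroup V] [NormedSpace ℝ V]
    [SFinite P] [IsGaussian γ] (hX : Measurable X)
    (hX2 : MemLp X 2 P) {f : Par K → ℝ} (hf : Tame f) (w : C(unitInterval, V)) :
    Integrable fun r => (∫ z, f (par P X r (z r)) ∂γ) • w r := by
  obtain ⟨C, hC⟩ := bounded_integral_par (γ := γ) hX2 hf
  have hw : Integrable fun r => w r :=
    w.continuous.integrable_of_hasCompactSupport (.of_compactSpace _)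
  exact hw.bdd_smul C (measurable_integral_par hX hf.measurable).aestronglyMeasurable
    (ae_of_all _ hC)

/-- Two jointly measurable processes that agree almost surely at each time agree almost surely at
almost all times. -/
theorem ae_ae_eq_of_forall_ae_eq [IsProbabilityMeasure P] [IsProbabilityMeasure γ]
    {d d' : unitInterval → Ω → ℝ} (hd : Measurable (Function.uncurry d))
    (hd' : Measurable (Function.uncurry d'))
    (h : ∀ s, (fun a : Ω × PathSpace K => d s a.1) =ᵐ[P.prod γ] fun a => d' s a.1) :
    ∀ᵐ ω ∂P, ∀ᵐ s, d s ω = d' s ω := by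
  have h1 : ∀ s, ∀ᵐ ω ∂P, d s ω = d' s ω := by
    intro s
    filter_upwards [Measure.ae_ae_of_ae_prod (h s)] with ω hω
    exact Filter.eventually_const.1 hω
  exact (Measure.ae_ae_comm (μ := (volume : Measure unitInterval)) (ν := P)
    (p := fun s ω => d s ω = d' s ω) (measurableSet_eq_fun hd hd')).1
    (Filter.Eventually.of_forall h1)

theorem continuous_setIntegral_Ici {E : Type*} [NormedAddCommGroup E] [NormedSpace ℝ E]
    {g : unitInterval → E} (hg : Integrable g) :
    Continuous fun s : unitInterval => ∫ r in Set.Ici s, g r := by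
  simp only [setIntegral_Ici_eq]
  have h := unitInterval.measurePreserving_symm.integrable_comp_of_integrable hg
  exact (continuous_setIntegral_Iic h).comp unitInterval.continuous_symm

theorem setIntegral_inner_right {V : Type*} [NormedAddCommGroup V] [InnerProductSpace ℝ V]
    [CompleteSpace V] {F : unitInterval → V} (hF : Integrable F) (S : Set unitInterval) (y : V) :
    ∫ r in S, inner ℝ (F r) y = inner ℝ (∫ r in S, F r) y := by
  simp only [real_inner_comm y]
  exact (innerSL ℝ y).integral_comp_comm hF.integrableOn

end

section Main

variable {Ω : Type*} [mΩ : MeasurableSpace Ω] {P : Measure Ω} [IsProbabilityMeasure P]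
  {K din dout : ℕ} {Win : Ω → EuclideanSpace ℝ (Fin din)} {Wout : Ω → EuclideanSpace ℝ (Fin dout)}
  {V : Type*} [NormedAddCommGroup V] [InnerProductSpace ℝ V] [FiniteDimensional ℝ V]
  [MeasurableSpace V] [BorelSpace V] {ν : Measure V} [IsGaussian ν]
  {ρ : ℝ → ℝ} {ηu ηv σu σv Cρ : ℝ} {e : Ω → V} {X : Ω → PathSpace K}
  {v : Fin K ⊕ Fin K → C(unitInterval, V)} {e₀ : V} {τ : V → V}
  {x : EuclideanSpace ℝ (Fin din)} {ℓ : EuclideanSpace ℝ (Fin dout) → ℝ}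

theorem memLp_pathOf (he : MemLp e 2 P) (hX : X =ᵐ[P] fun ω => pathOf v (e ω)) : MemLp X 2 P :=
  (memLp_congr_ae hX).2 ((pathOf v).comp_memLp' he)

theorem ae_forall_coord (hX : X =ᵐ[P] fun ω => pathOf v (e ω)) :
    ∀ᵐ ω ∂P, ∀ s l, X ω s l = inner ℝ (v l s) (e ω) := by
  filter_upwards [hX] with ω hω s l
  rw [hω, pathOf_apply]

theorem integrable_fieldH (hρ : Differentiable ℝ ρ) (hρ' : Differentiable ℝ (deriv ρ))
    (hρ1 : ∀ t, |deriv ρ t| ≤ Cρ) (hρ2 : ∀ t, |deriv (deriv ρ) t| ≤ Cρ)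
    (v : Fin K ⊕ Fin K → C(unitInterval, V)) (k : Fin K) :
    Integrable fun r => fieldH ν ρ ηu ηv σu σv k fun l => v l r := by
  have h := (caratheodory_fieldH (ν := ν) (ηu := ηu) (ηv := ηv) (σu := σu) (σv := σv)
    hρ hρ' hρ1 hρ2 v k).integrable_comp (v (Sum.inl k))
  refine h.congr (ae_of_all _ fun r => ?_)
  simp only
  rw [show Function.update (fun l => v l r) (Sum.inl k) (v (Sum.inl k) r) =
    fun l => v l r from Function.update_eq_self _ _]

theorem integrable_fieldB (hρ : Differentiable ℝ ρ) (hρ' : Differentiable ℝ (deriv ρ))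
    (hρ1 : ∀ t, |deriv ρ t| ≤ Cρ) (hρ2 : ∀ t, |deriv (deriv ρ) t| ≤ Cρ)
    (v : Fin K ⊕ Fin K → C(unitInterval, V)) (k : Fin K) :
    Integrable fun r => fieldB ν ρ ηu ηv σu σv k fun l => v l r := by
  have h := (caratheodory_fieldB (ν := ν) (ηu := ηu) (ηv := ηv) (σu := σu) (σv := σv)
    hρ hρ' hρ1 hρ2 v k).integrable_comp (v (Sum.inr k))
  refine h.congr (ae_of_all _ fun r => ?_)
  simp only
  rw [show Function.update (fun l => v l r) (Sum.inr k) (v (Sum.inr k) r) =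
    fun l => v l r from Function.update_eq_self _ _]

/-- A solution of the closed deterministic system gives a solution of the limit system. -/
theorem isLimitSolution_of_closedSystem
    (hρ : Differentiable ℝ ρ) (hρ' : Differentiable ℝ (deriv ρ))
    (hρ1 : ∀ t, |deriv ρ t| ≤ Cρ) (hρ2 : ∀ t, |deriv (deriv ρ) t| ≤ Cρ)
    (hle : initSigma Win Wout ≤ mΩ) (he : MemLp e 2 P)
    (hem : AEStronglyMeasurable[initSigma Win Wout] e P) (h0 : ν[id] = 0)
    (hν : ∀ x y, gram ν x y = ∫ ω, inner ℝ x (e ω) * inner ℝ y (e ω) ∂P)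
    (he₀ : ∀ ω, inner ℝ e₀ (e ω) = (inner ℝ (Win ω) x : ℝ))
    (hτ : ∀ h ω, inner ℝ (τ h) (e ω) =
      (inner ℝ (Wout ω) (gradient ℓ (∫ ω', (inner ℝ h (e ω') : ℝ) • Wout ω' ∂P)) : ℝ))
    (hv : ∀ k, ClosedSystem ν ρ ηu ηv σu σv e₀ τ v k)
    (hXm : Measurable X) (hX : X =ᵐ[P] fun ω => pathOf v (e ω)) :
    IsLimitSolution P Win Wout x ρ ℓ ηu ηv σu σv X := by
  have hX2 := memLp_pathOf he hX
  have hXe := ae_forall_coord hX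
  have hXW : AEStronglyMeasurable[initSigma Win Wout] X P :=
    ((pathOf v).continuous.comp_aestronglyMeasurable hem).congr hX.symm
  have hγ : IsDrivingField P σu σv X ((ν.prod ν).map (noisePath σu σv v)) :=
    isDrivingField_noisePath h0 hν hXe
  have hev : ∀ l : Fin K ⊕ Fin K, Measurable fun p : unitInterval × Ω => X p.2 p.1 l :=
    measurable_uncurry_coord hXm
  have hpath : Measurable fun (s : unitInterval) (l : Fin K ⊕ Fin K) => v l s :=
    measurable_pi_lambda _ fun l => (v l).continuous.measurable
  have havg : ∀ {f : Par K → ℝ}, Tame f →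
      Measurable fun p : unitInterval × Ω => avg ν σu σv f fun l => v l p.1 := fun hf =>
    ((hf.avg σu σv).measurable.comp hpath).comp measurable_fst
  refine ⟨hXW, (ν.prod ν).map (noisePath σu σv v), hγ, fun k => ⟨⟨fun r ω =>
    ∑ i ∈ Finset.Iio k, avg ν σu σv (coefHB ρ ηu ηv σv k i) (fun l => v l r) * X ω r (Sum.inr i),
    ⟨?_, ?_, fun s => ?_⟩, ?_⟩, ⟨fun r ω =>
    ∑ i ∈ Finset.Iio k, avg ν σu σv (coefBH ρ ηu ηv σu k i) (fun l => v l r) * X ω r (Sum.inl i) +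
      avg ν σu σv (coefBdiag ρ ηu ηv σu k) (fun l => v l r) * X ω r (Sum.inl k),
    ⟨?_, ?_, fun s => ?_⟩, ?_⟩⟩⟩
  · exact Finset.measurable_fun_sum _ fun i _ =>
      (havg (tame_coefHB hρ hρ' hρ1 hρ2 k i)).mul (hev _)
  · filter_upwards [hXe] with ω hω
    refine ((innerSL ℝ (e ω)).integrable_comp
      (integrable_fieldH (ν := ν) (ηu := ηu) (ηv := ηv) (σu := σu) (σv := σv)
        hρ hρ' hρ1 hρ2 v k)).congr (ae_of_all _ fun r => ?_)
    simp [fieldH, hω, real_inner_comm (e ω)]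
  · refine Filter.EventuallyEq.symm ((driftH_ae (σv := σv) hρ hρ' hρ1 hρ2 hle hX2 hXW k s).trans
      (ae_of_all _ fun a => ?_))
    exact Finset.sum_congr rfl fun i _ => by
      rw [integral_par_eq_avg h0 hν hXe hγ (tame_coefHB hρ hρ' hρ1 hρ2 k i).measurable s]
  · filter_upwards [hXe] with ω hω s
    have hF := integrable_fieldH (ν := ν) (ηu := ηu) (ηv := ηv) (σu := σu) (σv := σv)
        hρ hρ' hρ1 hρ2 v k
    rw [hω, (hv k).1 s, inner_add_left, he₀, ← setIntegral_inner_right hF]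
    congr 2
    ext r
    simp [fieldH, sum_inner, inner_smul_left, hω]
  · exact (Finset.measurable_fun_sum _ fun i _ =>
      (havg (tame_coefBH hρ hρ' hρ1 hρ2 k i)).mul (hev _)).add
      ((havg (tame_coefBdiag hρ hρ1 hρ2 k)).mul (hev _))
  · filter_upwards [hXe] with ω hω
    refine ((innerSL ℝ (e ω)).integrable_comp
      (integrable_fieldB (ν := ν) (ηu := ηu) (ηv := ηv) (σu := σu) (σv := σv)
        hρ hρ' hρ1 hρ2 v k)).congr (ae_of_all _ fun r => ?_)
    simp [fieldB, inner_sum, inner_smul_right, inner_add_right, hω, real_inner_comm (e ω)]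
  · refine Filter.EventuallyEq.symm ((driftB_ae (σu := σu) hρ hρ' hρ1 hρ2 hle hX2 hXW k s).trans
      (ae_of_all _ fun a => ?_))
    simp only [integral_par_eq_avg h0 hν hXe hγ (tame_coefBdiag hρ hρ1 hρ2 k).measurable s]
    congr 1
    exact Finset.sum_congr rfl fun i _ => by
      rw [integral_par_eq_avg h0 hν hXe hγ (tame_coefBH hρ hρ' hρ1 hρ2 k i).measurable s]
  · have hy : ∫ ω', X ω' 1 (Sum.inl k) • Wout ω' ∂P =
        ∫ ω', (inner ℝ (v (Sum.inl k) 1) (e ω') : ℝ) • Wout ω' ∂P := by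
      refine integral_congr_ae ?_
      filter_upwards [hXe] with ω hω
      rw [hω]
    filter_upwards [hXe] with ω hω s
    have hF := integrable_fieldB (ν := ν) (ηu := ηu) (ηv := ηv) (σu := σu) (σv := σv)
        hρ hρ' hρ1 hρ2 v k
    rw [hω, (hv k).2 s, inner_sub_left, hτ, hy, ← setIntegral_inner_right hF]
    congr 2
    ext r
    simp [fieldB, sum_inner, inner_smul_left, inner_add_left, hω]

end Main

/-! ### From the limit system to the closed system -/

section Main

variable {Ω : Type*} [mΩ : MeasurableSpace Ω] {P : Measure Ω} [IsProbabilityMeasure P]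
  {K din dout : ℕ} {Win : Ω → EuclideanSpace ℝ (Fin din)} {Wout : Ω → EuclideanSpace ℝ (Fin dout)}
  {V : Type*} [NormedAddCommGroup V] [InnerProductSpace ℝ V] [FiniteDimensional ℝ V]
  [MeasurableSpace V] [BorelSpace V] {ν : Measure V} [IsGaussian ν]
  {ρ : ℝ → ℝ} {ηu ηv σu σv Cρ : ℝ} {e : Ω → V} {X : Ω → PathSpace K}
  {v : Fin K ⊕ Fin K → C(unitInterval, V)} {e₀ : V} {τ : V → V}
  {x : EuclideanSpace ℝ (Fin din)} {ℓ : EuclideanSpace ℝ (Fin dout) → ℝ}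
  {γ : Measure (PathSpace K)}

/-- A drift of the form `⟨F s, e⟩`, with `F` deterministic, integrates to `⟨∫ F, e⟩`. -/
theorem IsDriftVersion.setIntegral_eq [IsProbabilityMeasure γ]
    {D : unitInterval → Ω × PathSpace K → ℝ} {d d' : unitInterval → Ω → ℝ}
    (hd : IsDriftVersion P γ D d) (hd' : Measurable (Function.uncurry d'))
    (hD : ∀ s, D s =ᵐ[P.prod γ] fun a => d' s a.1) {F : unitInterval → V} (hF : Integrable F)
    (h : ∀ᵐ ω ∂P, ∀ s, d' s ω = inner ℝ (F s) (e ω)) :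
    ∀ᵐ ω ∂P, ∀ S : Set unitInterval, ∫ r in S, d r ω = inner ℝ (∫ r in S, F r) (e ω) := by
  filter_upwards [h, ae_ae_eq_of_forall_ae_eq hd.measurable hd' fun s => (hd.eq s).trans (hD s)]
    with ω h1 h2 S
  rw [← setIntegral_inner_right hF]
  refine integral_congr_ae (ae_restrict_of_ae ?_)
  filter_upwards [h2] with r hr
  rw [hr, h1]

/-- The coordinates of a solution of the limit system are scalar products of `e` with
deterministic paths, which solve the closed deterministic system. -/
theorem exists_closedSystem_of_isLimitSolution
    (hρ : Differentiable ℝ ρ) (hρ' : Differentiable ℝ (deriv ρ))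
    (hρ1 : ∀ t, |deriv ρ t| ≤ Cρ) (hρ2 : ∀ t, |deriv (deriv ρ) t| ≤ Cρ)
    (hle : initSigma Win Wout ≤ mΩ) (h0 : ν[id] = 0)
    (hν : ∀ x y, gram ν x y = ∫ ω, inner ℝ x (e ω) * inner ℝ y (e ω) ∂P)
    (he₀ : ∀ ω, inner ℝ e₀ (e ω) = (inner ℝ (Win ω) x : ℝ))
    (hτ : ∀ h ω, inner ℝ (τ h) (e ω) =
      (inner ℝ (Wout ω) (gradient ℓ (∫ ω', (inner ℝ h (e ω') : ℝ) • Wout ω' ∂P)) : ℝ))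
    (hXm : Measurable X) (hX2 : MemLp X 2 P)
    (hX : IsLimitSolution P Win Wout x ρ ℓ ηu ηv σu σv X) :
    ∃ v, (∀ k, ClosedSystem ν ρ ηu ηv σu σv e₀ τ v k) ∧ X =ᵐ[P] fun ω => pathOf v (e ω) := by
  obtain ⟨γ, hγ, hsol⟩ := hX.solves
  have := hγ.gaussian
  let cHB : Fin K → Fin K → unitInterval → ℝ :=
    fun k i r => ∫ z, coefHB ρ ηu ηv σv k i (par P X r (z r)) ∂γ
  let cBH : Fin K → Fin K → unitInterval → ℝ :=
    fun k i r => ∫ z, coefBH ρ ηu ηv σu k i (par P X r (z r)) ∂γ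
  let cBd : Fin K → unitInterval → ℝ :=
    fun k r => ∫ z, coefBdiag ρ ηu ηv σu k (par P X r (z r)) ∂γ
  have tHB : ∀ k i : Fin K, Tame (coefHB ρ ηu ηv σv k i) :=
    fun k i => tame_coefHB hρ hρ' hρ1 hρ2 k i
  have tBH : ∀ k i : Fin K, Tame (coefBH ρ ηu ηv σu k i) :=
    fun k i => tame_coefBH hρ hρ' hρ1 hρ2 k i
  have tBd : ∀ k : Fin K, Tame (coefBdiag ρ ηu ηv σu k) := fun k => tame_coefBdiag hρ hρ1 hρ2 k
  have hev : ∀ l : Fin K ⊕ Fin K, Measurable fun p : unitInterval × Ω => X p.2 p.1 l :=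
    measurable_uncurry_coord hXm
  have hcm : ∀ {f : Par K → ℝ}, Tame f →
      Measurable fun p : unitInterval × Ω => ∫ z, f (par P X p.1 (z p.1)) ∂γ := fun hf =>
    (measurable_integral_par hXm hf.measurable).comp measurable_fst
  let FH : (Fin K ⊕ Fin K → C(unitInterval, V)) → Fin K → unitInterval → V :=
    fun v k r => ∑ i ∈ Finset.Iio k, cHB k i r • v (Sum.inr i) r
  let FB : (Fin K ⊕ Fin K → C(unitInterval, V)) → Fin K → unitInterval → V :=
    fun v k r => ∑ i ∈ Finset.Iio k, cBH k i r • v (Sum.inl i) r + cBd k r • v (Sum.inl k) r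
  have iFH : ∀ v k, Integrable (FH v k) := fun v k =>
    integrable_finsetSum _ fun i _ => integrable_integral_par_smul hXm hX2 (tHB k i) _
  have iFB : ∀ v k, Integrable (FB v k) := fun v k =>
    (integrable_finsetSum _ fun i _ => integrable_integral_par_smul hXm hX2 (tBH k i) _).add
      (integrable_integral_par_smul hXm hX2 (tBd k) _)
  -- The coordinates of level `k` are represented by `v`, which solves the equations of level `k`
  -- with the coefficients of `X`; only afterwards are these identified with averages given by `v`.
  let Good : (Fin K ⊕ Fin K → C(unitInterval, V)) → Fin K → Prop := fun v k =>
    (∀ᵐ ω ∂P, ∀ s, X ω s (Sum.inl k) = inner ℝ (v (Sum.inl k) s) (e ω)) ∧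
    (∀ᵐ ω ∂P, ∀ s, X ω s (Sum.inr k) = inner ℝ (v (Sum.inr k) s) (e ω)) ∧
    (∀ s, v (Sum.inl k) s = e₀ + ∫ r in Set.Iic s, FH v k r) ∧
    ∀ s, v (Sum.inr k) s = τ (v (Sum.inl k) 1) - ∫ r in Set.Ici s, FB v k r
  have cFH : ∀ k v v', (∀ i < k, v (Sum.inr i) = v' (Sum.inr i)) → FH v k = FH v' k := by
    intro k v v' h
    funext r
    exact Finset.sum_congr rfl fun i hi => by rw [h i (Finset.mem_Iio.1 hi)]
  have cFB : ∀ k v v', (∀ i ≤ k, v (Sum.inl i) = v' (Sum.inl i)) → FB v k = FB v' k := by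
    intro k v v' h
    funext r
    simp only [FB, h k le_rfl]
    congr 1
    exact Finset.sum_congr rfl fun i hi => by rw [h i (Finset.mem_Iio.1 hi).le]
  obtain ⟨v, hv⟩ : ∃ v, ∀ k, Good v k := by
    refine exists_of_triangular (fun k v v' h hv => ?_) (fun k v hv => ?_) 0
    · have e1 := cFH k v v' fun i hi => (h i hi.le).2
      have e2 := cFB k v v' fun i hi => (h i hi).1
      simp only [Good, ← (h k le_rfl).1, ← (h k le_rfl).2, ← e1, ← e2]
      exact hv
    obtain ⟨⟨d, hd, hdX⟩, d', hd', hdX'⟩ := hsol k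
    let x' : C(unitInterval, V) := ⟨fun s => e₀ + ∫ r in Set.Iic s, FH v k r,
      continuous_const.add (continuous_setIntegral_Iic (iFH v k))⟩
    let w : Fin K ⊕ Fin K → C(unitInterval, V) := Function.update v (Sum.inl k) x'
    let y' : C(unitInterval, V) := ⟨fun s => τ (x' 1) - ∫ r in Set.Ici s, FB w k r,
      continuous_const.sub (continuous_setIntegral_Ici (iFB w k))⟩
    have hwk : w (Sum.inl k) = x' := Function.update_self ..
    have hw : ∀ i < k, w (Sum.inl i) = v (Sum.inl i) ∧ w (Sum.inr i) = v (Sum.inr i) :=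
      update_below v x' (.inl rfl)
    have hxX : ∀ᵐ ω ∂P, ∀ s, X ω s (Sum.inl k) = inner ℝ (x' s) (e ω) := by
      have hall : ∀ᵐ ω ∂P, ∀ i : Fin K, i < k → ∀ s,
          X ω s (Sum.inr i) = inner ℝ (v (Sum.inr i) s) (e ω) :=
        ae_all_iff.2 fun i => Filter.eventually_imp_distrib_left.2 fun hi => (hv i hi).2.1
      have key := hd.setIntegral_eq (e := e)
        (d' := fun r ω => ∑ i ∈ Finset.Iio k, cHB k i r * X ω r (Sum.inr i))
        (Finset.measurable_fun_sum _ fun i _ => (hcm (tHB k i)).mul (hev _))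
        (fun s => driftH_ae hρ hρ' hρ1 hρ2 hle hX2 hX.measurable k s) (iFH v k) (by
          filter_upwards [hall] with ω hω s
          simp only [FH, sum_inner, real_inner_smul_left]
          exact Finset.sum_congr rfl fun i hi => by rw [hω i (Finset.mem_Iio.1 hi)])
      filter_upwards [key, hdX] with ω h1 h2 s
      rw [h2, h1]
      simp only [x', ContinuousMap.coe_mk, inner_add_left, he₀]
    have hyX : ∀ᵐ ω ∂P, ∀ s, X ω s (Sum.inr k) = inner ℝ (y' s) (e ω) := by
      have hall : ∀ᵐ ω ∂P, ∀ i : Fin K, i < k → ∀ s,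
          X ω s (Sum.inl i) = inner ℝ (v (Sum.inl i) s) (e ω) :=
        ae_all_iff.2 fun i => Filter.eventually_imp_distrib_left.2 fun hi => (hv i hi).1
      have key := hd'.setIntegral_eq (e := e)
        (d' := fun r ω => ∑ i ∈ Finset.Iio k, cBH k i r * X ω r (Sum.inl i) +
          cBd k r * X ω r (Sum.inl k))
        ((Finset.measurable_fun_sum _ fun i _ => (hcm (tBH k i)).mul (hev _)).add
          ((hcm (tBd k)).mul (hev _)))
        (fun s => driftB_ae hρ hρ' hρ1 hρ2 hle hX2 hX.measurable k s) (iFB w k) (by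
          filter_upwards [hall, hxX] with ω hω hω' s
          simp only [FB, inner_add_left, sum_inner, real_inner_smul_left, hwk, hω']
          congr 1
          exact Finset.sum_congr rfl fun i hi => by
            rw [hω i (Finset.mem_Iio.1 hi), (hw i (Finset.mem_Iio.1 hi)).1])
      have hy : ∫ ω', X ω' 1 (Sum.inl k) • Wout ω' ∂P =
          ∫ ω', (inner ℝ (x' 1) (e ω') : ℝ) • Wout ω' ∂P := by
        refine integral_congr_ae ?_
        filter_upwards [hxX] with ω hω
        rw [hω]
      filter_upwards [key, hdX'] with ω h1 h2 s
      rw [h2, h1, hy, ← hτ]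
      simp only [y', ContinuousMap.coe_mk, inner_sub_left]
    have hxk : Function.update w (Sum.inr k) y' (Sum.inl k) = x' := by simp [hwk]
    have hyk : Function.update w (Sum.inr k) y' (Sum.inr k) = y' := Function.update_self ..
    have hlow := fun i hi => update_below w y' (k := k) (.inr rfl) i hi
    have e1 : FH (Function.update w (Sum.inr k) y') k = FH v k :=
      cFH k _ _ fun i hi => (hlow i hi).2.trans (hw i hi).2
    have e2 : FB (Function.update w (Sum.inr k) y') k = FB w k := by
      refine cFB k _ _ fun i hi => ?_
      simp
    refine ⟨x', y', ?_⟩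
    simp only [Good, w] at *
    rw [hxk, hyk, e1, e2]
    exact ⟨hxX, hyX, fun s => rfl, fun s => rfl⟩
  have hXe : ∀ᵐ ω ∂P, ∀ s l, X ω s l = inner ℝ (v l s) (e ω) := by
    have h1 : ∀ᵐ ω ∂P, ∀ k : Fin K, (∀ s, X ω s (Sum.inl k) = inner ℝ (v (Sum.inl k) s) (e ω)) ∧
        ∀ s, X ω s (Sum.inr k) = inner ℝ (v (Sum.inr k) s) (e ω) :=
      ae_all_iff.2 fun k => (hv k).1.and (hv k).2.1
    filter_upwards [h1] with ω hω s l
    rcases l with k | k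
    exacts [(hω k).1 s, (hω k).2 s]
  refine ⟨v, fun k => ⟨fun s => ?_, fun s => ?_⟩, ?_⟩
  · rw [(hv k).2.2.1 s]
    congr 2
    ext r
    simp only [FH, fieldH, cHB]
    exact Finset.sum_congr rfl fun i _ => by
      rw [integral_par_eq_avg h0 hν hXe hγ (tHB k i).measurable r]
  · rw [(hv k).2.2.2 s]
    congr 2
    ext r
    simp only [FB, fieldB, cBH, cBd]
    rw [integral_par_eq_avg h0 hν hXe hγ (tBd k).measurable r]
    congr 1
    exact Finset.sum_congr rfl fun i _ => by
      rw [integral_par_eq_avg h0 hν hXe hγ (tBH k i).measurable r]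
  · filter_upwards [hXe] with ω hω
    ext s l
    rw [hω, pathOf_apply]

end Main

/-! ### The boundary data -/

section Main

variable {Ω : Type*} {din dout : ℕ} {Win : Ω → EuclideanSpace ℝ (Fin din)}
  {Wout : Ω → EuclideanSpace ℝ (Fin dout)}

theorem IsSubgaussianVector.memLp_inner [MeasurableSpace Ω] {P : Measure Ω}
    [IsProbabilityMeasure P] {d : ℕ} {W : Ω → EuclideanSpace ℝ (Fin d)}
    (h : IsSubgaussianVector W P) (u : EuclideanSpace ℝ (Fin d)) :
    MemLp (fun ω => (inner ℝ u (W ω) : ℝ)) 2 P := by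
  obtain ⟨-, c, hc⟩ := h
  have h1 := ((hc u).memLp 2).add
    (memLp_const (μ := P) (p := 2) (inner ℝ u (∫ ω', W ω' ∂P) : ℝ))
  refine (memLp_congr_ae (ae_of_all _ fun ω => ?_)).1 h1
  simp [inner_sub_right]

/-- The random vector `(W_in · x, W_out)`, of which the boundary values are linear functions. The
index `none` stands for the first component. -/
noncomputable def boundaryVector (Win : Ω → EuclideanSpace ℝ (Fin din))
    (Wout : Ω → EuclideanSpace ℝ (Fin dout)) (x : EuclideanSpace ℝ (Fin din)) (ω : Ω) :
    EuclideanSpace ℝ (Option (Fin dout)) :=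
  WithLp.toLp 2 fun o => o.elim (inner ℝ (Win ω) x) fun j => Wout ω j

/-- The vector `(0, h)`. -/
noncomputable def extendZero {d : ℕ} (h : EuclideanSpace ℝ (Fin d)) :
    EuclideanSpace ℝ (Option (Fin d)) :=
  WithLp.toLp 2 fun o => o.elim 0 fun j => h j

theorem inner_single_boundaryVector (x : EuclideanSpace ℝ (Fin din)) (ω : Ω) :
    (inner ℝ (EuclideanSpace.single none 1) (boundaryVector Win Wout x ω) : ℝ) =
      inner ℝ (Win ω) x := by
  simp [boundaryVector, EuclideanSpace.inner_single_left]

theorem inner_extendZero_boundaryVector (x : EuclideanSpace ℝ (Fin din))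
    (h : EuclideanSpace ℝ (Fin dout)) (ω : Ω) :
    (inner ℝ (extendZero h) (boundaryVector Win Wout x ω) : ℝ) = inner ℝ (Wout ω) h := by
  simp [boundaryVector, extendZero, PiLp.inner_apply, Fintype.sum_option, mul_comm]

theorem memLp_boundaryVector [MeasurableSpace Ω] {P : Measure Ω}
    [IsProbabilityMeasure P] (hWin : IsSubgaussianVector Win P)
    (hWout : IsSubgaussianVector Wout P) (x : EuclideanSpace ℝ (Fin din)) :
    MemLp (boundaryVector Win Wout x) 2 P := by
  refine MemLp.of_eval_piLp fun o => ?_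
  rcases o with - | j
  · simpa [boundaryVector, real_inner_comm] using hWin.memLp_inner x
  · simpa [boundaryVector, EuclideanSpace.inner_single_left] using
      hWout.memLp_inner (EuclideanSpace.single j 1)

theorem measurable_boundaryVector {m : MeasurableSpace Ω} (hWin : Measurable Win)
    (hWout : Measurable Wout) (x : EuclideanSpace ℝ (Fin din)) :
    Measurable (boundaryVector Win Wout x) := by
  refine (WithLp.measurable_toLp 2 _).comp (measurable_pi_lambda _ fun o => ?_)
  rcases o with - | j
  · exact (continuous_id.inner continuous_const).measurable.comp hWin
  · exact (EuclideanSpace.proj (𝕜 := ℝ) j : _ →L[ℝ] ℝ).continuous.measurable.comp hWout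

end Main

end LimitDynamics

theorem theorem2 {Ω : Type*} [MeasurableSpace Ω] (P : Measure Ω) [IsProbabilityMeasure P]
    (K din dout : ℕ)
    (Win : Ω → EuclideanSpace ℝ (Fin din)) (Wout : Ω → EuclideanSpace ℝ (Fin dout))
    (hWin : Measurable Win) (hWout : Measurable Wout)
    (hWinSG : LimitDynamics.IsSubgaussianVector Win P)
    (hWoutSG : LimitDynamics.IsSubgaussianVector Wout P)
    (x : EuclideanSpace ℝ (Fin din))
    (ρ : ℝ → ℝ) (Cρ : ℝ)
    (hρ : Differentiable ℝ ρ) (hρ' : Differentiable ℝ (deriv ρ))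
    (hρ0 : |ρ 0| ≤ Cρ) (hρ1 : ∀ t, |deriv ρ t| ≤ Cρ) (hρ2 : ∀ t, |deriv (deriv ρ) t| ≤ Cρ)
    (ℓ : EuclideanSpace ℝ (Fin dout) → ℝ) (Cℓ : ℝ≥0)
    (hℓ : Differentiable ℝ ℓ) (hℓ' : LipschitzWith Cℓ (gradient ℓ))
    (ηu ηv σu σv : ℝ) :
    ∃! X : Lp (LimitDynamics.PathSpace K) 2 P,
      LimitDynamics.IsLimitSolution P Win Wout x ρ ℓ ηu ηv σu σv X := by
  open LimitDynamics in
  set e := boundaryVector Win Wout x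
  have he : MemLp e 2 P := memLp_boundaryVector hWinSG hWoutSG x
  have hem' : Measurable[initSigma Win Wout] e :=
    measurable_boundaryVector (m := initSigma Win Wout)
      ((comap_measurable Win).mono le_sup_left le_rfl)
      ((comap_measurable Wout).mono le_sup_right le_rfl) x
  have hem : AEStronglyMeasurable[initSigma Win Wout] e P :=
    hem'.aestronglyMeasurable
  have hle : initSigma Win Wout ≤ ‹MeasurableSpace Ω› :=
    sup_le hWin.comap_le hWout.comap_le
  obtain ⟨ν, _, h0, hν⟩ := exists_gaussian_gram he
  -- Both boundary values are scalar products of `e` with deterministic vectors.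
  have he₀ := inner_single_boundaryVector (Win := Win) (Wout := Wout) x
  have hτ := fun h => inner_extendZero_boundaryVector (Win := Win) (Wout := Wout) x
    (gradient ℓ (∫ ω', (inner ℝ h (e ω') : ℝ) • Wout ω' ∂P))
  have hm : ∀ X : Lp (PathSpace K) 2 P, Measurable X := fun X =>
    (Lp.stronglyMeasurable X).measurable
  obtain ⟨v, hv⟩ := ClosedSystem.exists (K := K) (ν := ν) (ηu := ηu) (ηv := ηv) (σu := σu)
    (σv := σv) hρ hρ' hρ1 hρ2 (EuclideanSpace.single none 1)
    (fun h => extendZero (gradient ℓ (∫ ω', (inner ℝ h (e ω') : ℝ) • Wout ω' ∂P)))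
  have hvX := ((pathOf v).comp_memLp' he).coeFn_toLp
  refine ⟨((pathOf v).comp_memLp' he).toLp, ?_, fun X hX => ?_⟩
  · exact isLimitSolution_of_closedSystem hρ hρ' hρ1 hρ2 hle he hem h0 hν he₀ hτ hv (hm _) hvX
  · obtain ⟨v', hv', hX'⟩ := exists_closedSystem_of_isLimitSolution hρ hρ' hρ1 hρ2 hle h0 hν
      he₀ hτ (hm X) (Lp.memLp X) hX
    obtain rfl := ClosedSystem.unique hρ hρ' hρ1 hρ2 hv hv'
    exact Lp.ext (hX'.trans hvX.symm)
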